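/- A polytope is the convex hull of a finite set of points; its size is the number of its facets. A polytope $Q\subseteq\mathbb{R}^{n}$ is an extension of a polytope $R\subseteq\mathbb{R}^{m}$ ($n\ge m$) if the orthogonal projection of $Q$ onto the first $m$ coordinates equals $R$; it is a minimum size extension of $R$ if no extension of $R$, in any dimension, has smaller size. A convex heptagon $P\subseteq\mathbb{R}^2$ (a polytope with exactly seven vertices) is in general position if, writing $\overline{ab}$ for the line through $a\neq b$, (1) there are no four pairwise distinct vertices $u_1,\dots,u_4$ of $P$ such that $\overline{u_1u_2}$ and $\overline{u_3u_4}$ are parallel; (2) there are no six pairwise distinct vertices $u_1,\dots,u_6$ of $P$ such that $\overline{u_1u_2}$, $\overline{u_3u_4}$, $\overline{u_5u_6}$ have a common point; (3) there are no seven pairwise distinct vertices $u_1,\dots,u_7$ of $P$ such that the intersection points $\overline{u_1u_2}\cap\overline{u_3u_4}$, $\overline{u_2u_5}\cap\overline{u_4u_6}$ and $\overline{u_3u_7}\cap\overline{u_1u_5}$ lie on one line. Theorem. Let $P\subseteq\mathbb{R}^2$ be a convex heptagon in general position, let $d\ge 0$ be an integer, and let $Q$ be any minimum size extension of $P\times[0,1]^d\subseteq\mathbb{R}^{2+d}$.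 Then at least $\frac19$ of the vertices of $Q$ are hidden, i.e. the number of vertices of $Q$ whose projection onto the first $2+d$ coordinates is not a vertex of $P\times[0,1]^d$ is at least $\frac19$ of the number of all vertices of $Q$. -/

import Mathlib

/-- A polytope: the convex hull of a finite set of points. -/
def IsPolytope {n : ℕ} (Q : Set (Fin n → ℝ)) : Prop :=
  ∃ s : Set (Fin n → ℝ), s.Finite ∧ Q = convexHull ℝ s

/-- The vertices of a polytope are its extreme points. -/
def vertices {n : ℕ} (Q : Set (Fin n → ℝ)) : Set (Fin n → ℝ) :=
  Q.extremePoints ℝ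

/-- The facets of a polytope: the nonempty faces of codimension one. Faces are
the sets of maximizers of a linear functional (`IsExposed`, which also admits the empty set). -/
def facets {n : ℕ} (Q : Set (Fin n → ℝ)) : Set (Set (Fin n → ℝ)) :=
  {F | IsExposed ℝ Q F ∧ F.Nonempty ∧
    Module.finrank ℝ (vectorSpan ℝ F) + 1 = Module.finrank ℝ (vectorSpan ℝ Q)}

/-- The size of a polytope: its number of facets. -/
noncomputable def size {n : ℕ} (Q : Set (Fin n → ℝ)) : ℕ∞ :=
  (facets Q).encard

/-- The orthogonal projection of `ℝ^(m+q)` onto the first `m` coordinates. -/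
def proj (m q : ℕ) : (Fin (m + q) → ℝ) →ₗ[ℝ] (Fin m → ℝ) :=
  LinearMap.funLeft ℝ ℝ (Fin.castAdd q)

/-- `Q ⊆ ℝ^(m+q)` is an extension of `P ⊆ ℝ^m`: it is a polytope whose projection onto the
first `m` coordinates equals `P`. -/
def IsExtension {m q : ℕ} (P : Set (Fin m → ℝ)) (Q : Set (Fin (m + q) → ℝ)) : Prop :=
  IsPolytope Q ∧ proj m q '' Q = P

/-- An extension of `P` whose size is least among all extensions of `P`, in every dimension. -/
def IsMinimumSizeExtension {m q : ℕ} (P : Set (Fin m → ℝ)) (Q : Set (Fin (m + q) → ℝ)) : Prop :=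
  IsExtension P Q ∧
    ∀ (r : ℕ) (Q' : Set (Fin (m + r) → ℝ)), IsExtension P Q' → size Q ≤ size Q'

/-- The vertices of the extension `Q` that are not projected onto vertices of `P`. -/
def hiddenVertices {m q : ℕ} (P : Set (Fin m → ℝ)) (Q : Set (Fin (m + q) → ℝ)) :
    Set (Fin (m + q) → ℝ) :=
  {v | v ∈ vertices Q ∧ proj m q v ∉ vertices P}

/-- The product `P × [0,1]^d` in `ℝ^(m+d)`. -/
def prodCube {m : ℕ} (P : Set (Fin m → ℝ)) (d : ℕ) : Set (Fin (m + d) → ℝ) :=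
  {x | (fun i : Fin m => x (Fin.castAdd d i)) ∈ P ∧
    ∀ j : Fin d, x (Fin.natAdd m j) ∈ Set.Icc (0 : ℝ) 1}

/-- A convex heptagon: a polytope in the plane with exactly seven vertices. -/
def IsConvexHeptagon (P : Set (Fin 2 → ℝ)) : Prop :=
  IsPolytope P ∧ (vertices P).ncard = 7

/-- The line through two (distinct) points of the plane. -/
def lineThrough (a b : Fin 2 → ℝ) : AffineSubspace ℝ (Fin 2 → ℝ) :=
  affineSpan ℝ {a, b}

/-- General position of a convex heptagon: no two lines through four distinct vertices are
parallel, no three lines through six distinct vertices are concurrent, and there is no labeling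
`u₀, …, u₆` of the vertices such that the points `u₀u₁ ∩ u₂u₃`, `u₁u₄ ∩ u₃u₅`, `u₂u₆ ∩ u₀u₄`
lie on one line. -/
structure InGeneralPosition (P : Set (Fin 2 → ℝ)) : Prop where
  not_parallel : ∀ u : Fin 4 → (Fin 2 → ℝ), Function.Injective u → (∀ i, u i ∈ vertices P) →
    ¬ (lineThrough (u 0) (u 1)).Parallel (lineThrough (u 2) (u 3))
  not_concurrent : ∀ u : Fin 6 → (Fin 2 → ℝ), Function.Injective u → (∀ i, u i ∈ vertices P) →
    ¬ ∃ x, x ∈ lineThrough (u 0) (u 1) ∧ x ∈ lineThrough (u 2) (u 3) ∧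
      x ∈ lineThrough (u 4) (u 5)
  not_collinear : ∀ u : Fin 7 → (Fin 2 → ℝ), Function.Injective u → (∀ i, u i ∈ vertices P) →
    ¬ ∃ x y z, (x ∈ lineThrough (u 0) (u 1) ∧ x ∈ lineThrough (u 2) (u 3)) ∧
      (y ∈ lineThrough (u 1) (u 4) ∧ y ∈ lineThrough (u 3) (u 5)) ∧
      (z ∈ lineThrough (u 2) (u 6) ∧ z ∈ lineThrough (u 0) (u 4)) ∧
      Collinear ℝ {x, y, z}

/-! A nontrivial polytope with at most k facets is the same thing as a bounded solution set of
affine equations and k affine inequalities (`size_le_of_hRep`, `hRep_of_isPolytope`), so sizes can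
be bounded by counting inequalities. After homogenization the polytope becomes a pointed cone, its
vertices become the normalized extreme rays, and the inequalities become linear slack functions.

Upper bound on the size. Every convex heptagon is the projection of a body in space given by three
upper and three lower bounds on a height (`exists_lift`); adding the 2d inequalities of the cube
gives an extension of `P × [0,1]^d` of size at most 6 + 2d (`exists_extension`). Hence a minimum
size extension has a description by 6 + 2d inequalities.

Induction on d (`card_le_hidden`). The last cube coordinate has minimum 0 and maximum 1 on Q, and
both extreme slices extend `P × [0,1]^(d-1)`. By `HRep.cut`, either both slices need two
inequalities fewer than Q or one of them needs three fewer. The second case is impossible, since 5 +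
2(d-1) inequalities never suffice (`not_hRep_prodCube`). So both slices satisfy the induction
hypothesis. Their hidden vertices are hidden in Q, and every vertex of Q strictly between the slices
is hidden, so the ratio 1/9 persists.

Base case. Six inequalities give at most nine vertices (`ncard_isRay_le_nine`), and at least one of
them is hidden (`exists_hidden_ray`); five inequalities give at most six vertices, too few for a
heptagon (`ncard_isRay_le_six`). For the hidden vertex, suppose all extreme rays project to vertices
of P. The slack vectors form a space cut out by 6 - dim E linear relations. With no relation, or
with dim E at most 3, there are at most six rays. With one relation the rays are the pairs of
opposite signs together with the zero indices, and either two of them collide in the plane, which is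
excluded by counting, or six of them form a prism, whose three parallel or concurrent edges
contradict conditions (1) and (2) (`oneRelation_absurd`). With two relations the columns are six
plane vectors (a Gale diagram), and the supports of the rays depend only on the signs and
coincidences of these vectors sorted by angle. A finite check over all patterns shows: at most six
rays, or seven rays containing a prism or a wedge configuration, or eight rays without two
triangular facets sharing an edge. A prism contradicts (2), a wedge contradicts (3), and eight rays
over seven vertices collide in a way that forces such triangles (`rayList_absurd`). -/

/-! ### Ear inequalities in a convex heptagon. -/

/-- Twice the signed area of the triangle `a b c`. -/
def br (a b c : Fin 2 → ℝ) : ℝ :=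
  (b 0 - a 0) * (c 1 - a 1) - (b 1 - a 1) * (c 0 - a 0)

/-- Seven points in counterclockwise convex position. -/
def ConvexCyclic (p : Fin 7 → Fin 2 → ℝ) : Prop :=
  ∀ i j k : Fin 7, i < j → j < k → 0 < br (p i) (p j) (p k)

/-- Cyclic relabelling. -/
def rot (c : Fin 7) (p : Fin 7 → Fin 2 → ℝ) : Fin 7 → Fin 2 → ℝ := fun i => p (c + i)

theorem rot_rot (a b : Fin 7) (p : Fin 7 → Fin 2 → ℝ) : rot a (rot b p) = rot (b + a) p := by
  funext i; simp [rot, add_assoc]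

theorem br_cycle (a b c : Fin 2 → ℝ) : br b c a = br a b c := by
  unfold br; ring

theorem br_swap (a b c : Fin 2 → ℝ) : br a c b = - br a b c := by
  unfold br; ring

theorem ConvexCyclic.rot {p : Fin 7 → Fin 2 → ℝ} (hp : ConvexCyclic p) (c : Fin 7) :
    ConvexCyclic (rot c p) := by
  intro i j k hij hjk
  have key : ∀ c i j k : Fin 7, i < j → j < k →
      (c + i < c + j ∧ c + j < c + k) ∨ (c + j < c + k ∧ c + k < c + i) ∨
        (c + k < c + i ∧ c + i < c + j) := by decide +kernel
  simp only [_root_.rot]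
  rcases key c i j k hij hjk with ⟨h1, h2⟩ | ⟨h1, h2⟩ | ⟨h1, h2⟩
  · exact hp _ _ _ h1 h2
  · rw [← br_cycle]; exact hp _ _ _ h1 h2
  · rw [← br_cycle, ← br_cycle]; exact hp _ _ _ h1 h2

/-- First comparison of products of opposite ears of the hexagon `p 1, …, p 6`. -/
def EarLeft (p : Fin 7 → Fin 2 → ℝ) : Prop :=
  br (p 1) (p 2) (p 3) * br (p 4) (p 5) (p 6) ≤ br (p 2) (p 3) (p 4) * br (p 1) (p 5) (p 6)

/-- Second comparison of products of opposite ears of the hexagon `p 1, …, p 6`. -/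
def EarRight (p : Fin 7 → Fin 2 → ℝ) : Prop :=
  br (p 1) (p 2) (p 3) * br (p 4) (p 5) (p 6) ≤ br (p 3) (p 4) (p 5) * br (p 1) (p 2) (p 6)

/-- Multiplying the two negated inequalities and cancelling the common ears 234 and 456 leaves
[023][156] < [123][056]. The identity `key` writes the opposite difference, times [026], as a sum of
positive terms. -/
theorem earRight_rot_one {p : Fin 7 → Fin 2 → ℝ} (hp : ConvexCyclic p) (h : ¬ EarLeft p) :
    EarRight (rot 1 p) := by
  have H := fun i j k hij hjk => hp i j k hij hjk
  by_contra h'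
  simp only [EarLeft, EarRight, rot, not_le] at h h'
  simp only [Fin.isValue, show (1 : Fin 7) + 1 = 2 from rfl, show (1 : Fin 7) + 2 = 3 from rfl,
    show (1 : Fin 7) + 3 = 4 from rfl, show (1 : Fin 7) + 4 = 5 from rfl,
    show (1 : Fin 7) + 5 = 6 from rfl, show (1 : Fin 7) + 6 = 0 from rfl] at h'
  have e1 : br (p 5) (p 6) (p 0) = br (p 0) (p 5) (p 6) := br_cycle _ _ _
  have e2 : br (p 2) (p 3) (p 0) = br (p 0) (p 2) (p 3) := br_cycle _ _ _
  rw [e1, e2] at h'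
  have a1 := H 1 2 3 (by decide) (by decide)
  have a2 := H 4 5 6 (by decide) (by decide)
  have a3 := H 2 3 4 (by decide) (by decide)
  have a4 := H 1 5 6 (by decide) (by decide)
  have a5 := H 0 2 3 (by decide) (by decide)
  have a6 := H 0 5 6 (by decide) (by decide)
  have a7 := H 0 2 6 (by decide) (by decide)
  have a8 := H 0 1 6 (by decide) (by decide)
  have a9 := H 2 5 6 (by decide) (by decide)
  have a10 := H 2 3 6 (by decide) (by decide)
  have a11 := H 0 1 2 (by decide) (by decide)
  have key : br (p 0) (p 2) (p 6) * (br (p 0) (p 2) (p 3) * br (p 1) (p 5) (p 6) -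
      br (p 1) (p 2) (p 3) * br (p 0) (p 5) (p 6)) =
      br (p 0) (p 2) (p 3) * br (p 0) (p 1) (p 6) * br (p 2) (p 5) (p 6) +
      br (p 0) (p 5) (p 6) * br (p 2) (p 3) (p 6) * br (p 0) (p 1) (p 2) := by
    unfold br; ring
  have k1 : 0 < br (p 0) (p 2) (p 3) * br (p 1) (p 5) (p 6) -
      br (p 1) (p 2) (p 3) * br (p 0) (p 5) (p 6) := by
    refine pos_of_mul_pos_right ?_ a7.le
    rw [key]; positivity
  have m := mul_lt_mul'' h h' (by positivity) (by positivity)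
  have : 0 < (br (p 2) (p 3) (p 4) * br (p 4) (p 5) (p 6)) *
      (br (p 0) (p 2) (p 3) * br (p 1) (p 5) (p 6) -
      br (p 1) (p 2) (p 3) * br (p 0) (p 5) (p 6)) := by positivity
  linarith [m, this]

/-- As before, the product of the negated inequalities reduces to [046][156] < [016][456], which
contradicts the Plücker relation `key`. -/
theorem earRight_rot_five {p : Fin 7 → Fin 2 → ℝ} (hp : ConvexCyclic p) (h : ¬ EarLeft p) :
    EarRight (rot 5 p) := by
  by_contra h'
  simp only [EarLeft, EarRight, rot, not_le] at h h'
  simp only [Fin.isValue, show (5 : Fin 7) + 1 = 6 from rfl, show (5 : Fin 7) + 2 = 0 from rfl,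
    show (5 : Fin 7) + 3 = 1 from rfl, show (5 : Fin 7) + 4 = 2 from rfl,
    show (5 : Fin 7) + 5 = 3 from rfl, show (5 : Fin 7) + 6 = 4 from rfl] at h'
  have a1 := hp 1 2 3 (by decide) (by decide)
  have a2 := hp 4 5 6 (by decide) (by decide)
  have a3 := hp 2 3 4 (by decide) (by decide)
  have a4 := hp 1 5 6 (by decide) (by decide)
  have a5 := hp 0 4 6 (by decide) (by decide)
  have a6 := hp 0 1 6 (by decide) (by decide)
  have a7 := hp 0 5 6 (by decide) (by decide)
  have a8 := hp 1 4 6 (by decide) (by decide)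
  have e1 : br (p 6) (p 0) (p 4) = br (p 0) (p 4) (p 6) := br_cycle _ _ _ |>.symm
  have e2 : br (p 6) (p 0) (p 1) = br (p 0) (p 1) (p 6) := br_cycle _ _ _ |>.symm
  rw [e1, e2] at h'
  have key : br (p 0) (p 4) (p 6) * br (p 1) (p 5) (p 6) =
      br (p 0) (p 1) (p 6) * br (p 4) (p 5) (p 6) +
      br (p 0) (p 5) (p 6) * br (p 1) (p 4) (p 6) := by
    unfold br; ring
  have m := mul_lt_mul'' h h' (by positivity) (by positivity)
  have : 0 < (br (p 1) (p 2) (p 3) * br (p 2) (p 3) (p 4)) *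
      (br (p 0) (p 5) (p 6) * br (p 1) (p 4) (p 6)) := by positivity
  have k2 : (br (p 1) (p 2) (p 3) * br (p 2) (p 3) (p 4)) *
      (br (p 0) (p 4) (p 6) * br (p 1) (p 5) (p 6)) =
      (br (p 1) (p 2) (p 3) * br (p 2) (p 3) (p 4)) *
      (br (p 0) (p 1) (p 6) * br (p 4) (p 5) (p 6)) + (br (p 1) (p 2) (p 3) * br (p 2) (p 3) (p 4)) *
      (br (p 0) (p 5) (p 6) * br (p 1) (p 4) (p 6)) := by rw [key]; ring
  linarith [m, this, k2]

/-- The chain is [345][026][126] < [234][056][126] < [234][026][156] < [026][123][456]; its middle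
link is the Plücker relation `key`, and the factor [026] cancels at the end. -/
theorem not_earRight {p : Fin 7 → Fin 2 → ℝ} (hp : ConvexCyclic p) (h : ¬ EarLeft p)
    (h' : ¬ EarLeft (rot 1 p)) : ¬ EarRight p := by
  simp only [EarLeft, EarRight, rot, not_le] at h h' ⊢
  simp only [Fin.isValue, show (1 : Fin 7) + 1 = 2 from rfl, show (1 : Fin 7) + 2 = 3 from rfl,
    show (1 : Fin 7) + 3 = 4 from rfl, show (1 : Fin 7) + 4 = 5 from rfl,
    show (1 : Fin 7) + 5 = 6 from rfl, show (1 : Fin 7) + 6 = 0 from rfl] at h'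
  have e1 : br (p 5) (p 6) (p 0) = br (p 0) (p 5) (p 6) := br_cycle _ _ _
  have e2 : br (p 2) (p 6) (p 0) = br (p 0) (p 2) (p 6) := br_cycle _ _ _
  rw [e1, e2] at h'
  have a3 := hp 2 3 4 (by decide) (by decide)
  have a7 := hp 0 2 6 (by decide) (by decide)
  have a8 := hp 0 1 6 (by decide) (by decide)
  have a9 := hp 2 5 6 (by decide) (by decide)
  have a10 := hp 1 2 6 (by decide) (by decide)
  have key : br (p 0) (p 2) (p 6) * br (p 1) (p 5) (p 6) =
      br (p 0) (p 1) (p 6) * br (p 2) (p 5) (p 6) +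
      br (p 0) (p 5) (p 6) * br (p 1) (p 2) (p 6) := by
    unfold br; ring
  have s1 := mul_lt_mul_of_pos_right h' a10
  have s2 : 0 < br (p 2) (p 3) (p 4) * (br (p 0) (p 1) (p 6) * br (p 2) (p 5) (p 6)) := by
    positivity
  have s3 := mul_lt_mul_of_pos_left h a7
  refine lt_of_mul_lt_mul_left ?_ a7.le
  have s4 : br (p 2) (p 3) (p 4) * (br (p 0) (p 2) (p 6) * br (p 1) (p 5) (p 6)) =
    br (p 2) (p 3) (p 4) * (br (p 0) (p 1) (p 6) * br (p 2) (p 5) (p 6)) +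
    br (p 2) (p 3) (p 4) * (br (p 0) (p 5) (p 6) * br (p 1) (p 2) (p 6)) := by rw [key]; ring
  linarith

/-- Reflected relabelling, which keeps the orientation after reflecting the plane. -/
def mirror (p : Fin 7 → Fin 2 → ℝ) : Fin 7 → Fin 2 → ℝ := fun i => ![(p (-i)) 1, (p (-i)) 0]

theorem br_mirror (p : Fin 7 → Fin 2 → ℝ) (i j k : Fin 7) :
    br (mirror p i) (mirror p j) (mirror p k) = br (p (-k)) (p (-j)) (p (-i)) := by
  simp [mirror, br]; ring

theorem ConvexCyclic.mirror {p : Fin 7 → Fin 2 → ℝ} (hp : ConvexCyclic p) :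
    ConvexCyclic (mirror p) := by
  intro i j k hij hjk
  have key : ∀ i j k : Fin 7, i < j → j < k →
      (-k < -j ∧ -j < -i) ∨ (-i < -k ∧ -k < -j) := by decide +kernel
  rw [br_mirror]
  rcases key i j k hij hjk with ⟨h1, h2⟩ | ⟨h1, h2⟩
  · exact hp _ _ _ h1 h2
  · rw [br_cycle]; exact hp _ _ _ h1 h2

theorem earLeft_mirror (p : Fin 7 → Fin 2 → ℝ) : EarLeft (mirror p) ↔ EarRight p := by
  simp only [EarLeft, EarRight, br_mirror]
  simp only [Fin.isValue, show -(1 : Fin 7) = 6 from rfl, show -(2 : Fin 7) = 5 from rfl,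
    show -(3 : Fin 7) = 4 from rfl, show -(4 : Fin 7) = 3 from rfl,
    show -(5 : Fin 7) = 2 from rfl, show -(6 : Fin 7) = 1 from rfl]
  rw [mul_comm (br (p 4) (p 5) (p 6))]

theorem mirror_rot (p : Fin 7 → Fin 2 → ℝ) (c : Fin 7) : rot c (mirror p) = mirror (rot (-c) p) := by
  funext i; simp [rot, mirror, add_comm]

/-- If `EarLeft` failed everywhere, its failure at rotation 2 would give `EarRight` at 2 + 5 = 0,
while its failures at 0 and 1 forbid `EarRight` at 0. -/
theorem exists_earLeft {p : Fin 7 → Fin 2 → ℝ} (hp : ConvexCyclic p) :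
    ∃ m, EarLeft (rot m p) := by
  by_contra h
  push Not at h
  have h1 := earRight_rot_five (hp.rot 2) (h 2)
  have h2 := not_earRight (hp.rot 0) (h 0) (by rw [rot_rot]; exact h _)
  rw [rot_rot] at h1
  exact h2 h1

theorem exists_earRight {p : Fin 7 → Fin 2 → ℝ} (hp : ConvexCyclic p) :
    ∃ m, EarRight (rot m p) := by
  obtain ⟨m, hm⟩ := exists_earLeft hp.mirror
  rw [mirror_rot, earLeft_mirror] at hm
  exact ⟨_, hm⟩

/-- Every convex heptagon has a vertex at which the two ear comparisons needed for an extension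
with six facets hold. -/
theorem exists_center {p : Fin 7 → Fin 2 → ℝ} (hp : ConvexCyclic p) :
    ∃ c, EarLeft (rot (c + 1) p) ∧ EarRight (rot (c + 6) p) := by
  by_contra h
  push Not at h
  -- Failure at m gives `EarRight` at m + 1 = (m + 2) + 6 modulo 7, so the assumption at the center
  -- m + 2 excludes `EarLeft` at m + 3. Since 3 generates the integers modulo 7, one failure spreads
  -- to every rotation.
  have step : ∀ m, ¬ EarLeft (rot m p) → ¬ EarLeft (rot (m + 3) p) := by
    intro m hm h3
    have h1 := earRight_rot_one (hp.rot m) hm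
    rw [rot_rot] at h1
    have h2 := h (m + 2) (by rwa [add_assoc])
    apply h2
    convert h1 using 2
    rw [add_assoc]; rfl
  by_cases hall : ∀ m, EarLeft (rot m p)
  · obtain ⟨m, hm⟩ := exists_earRight hp
    refine h (m + 1) (hall _) ?_
    convert hm using 2
    rw [add_assoc]; exact add_zero _
  · push Not at hall
    obtain ⟨m, hm⟩ := hall
    obtain ⟨k, hk⟩ := exists_earLeft hp
    have s : ∀ n : ℕ, ¬ EarLeft (rot (m + n • 3) p) := by
      intro n
      induction n with
      | zero => simpa using hm
      | succ n ih => have := step _ ih; rwa [add_assoc, ← succ_nsmul] at this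
    have : ∀ m k : Fin 7, ∃ n : Fin 7, m + (n : ℕ) • (3 : Fin 7) = k := by decide +kernel
    obtain ⟨n, hn⟩ := this m k
    exact s n (hn ▸ hk)

/-! ### Lifting the heptagon to six inequalities in space. -/

/-- `br a b` as an affine function of the third point. -/
def brAff (a b : Fin 2 → ℝ) : (Fin 2 → ℝ) →ᵃ[ℝ] ℝ where
  toFun := br a b
  linear := (b 0 - a 0) • LinearMap.proj 1 - (b 1 - a 1) • LinearMap.proj 0
  map_vadd' := by intro x v; simp [br]; ring

theorem Convex.three_mem {E : Type*} [AddCommGroup E] [Module ℝ E] {s : Set E} (hs : Convex ℝ s)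
    {a b c : E} (ha : a ∈ s) (hb : b ∈ s) (hc : c ∈ s) {u v w : ℝ} (hu : 0 ≤ u) (hv : 0 ≤ v)
    (hw : 0 ≤ w) (h : u + v + w = 1) : u • a + v • b + w • c ∈ s := by
  have := hs.sum_mem (t := Finset.univ) (w := ![u, v, w]) (z := ![a, b, c])
    (by intro i _; fin_cases i <;> simpa) (by simp [Fin.sum_univ_three, h])
    (by intro i _; fin_cases i <;> simpa)
  simpa [Fin.sum_univ_three] using this

theorem br_barycentric (a b c x : Fin 2 → ℝ) (h : br a b c ≠ 0) :
    x = (br b c x / br a b c) • a + (br c a x / br a b c) • b + (br a b x / br a b c) • c := by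
  funext i
  simp only [Pi.add_apply, Pi.smul_apply, smul_eq_mul]
  field_simp
  fin_cases i <;> simp [br] <;> ring

theorem br_sum (a b c x : Fin 2 → ℝ) : br b c x + br c a x + br a b x = br a b c := by
  unfold br; ring

theorem mem_of_br_nonneg {s : Set (Fin 2 → ℝ)} (hs : Convex ℝ s) {a b c x : Fin 2 → ℝ}
    (ha : a ∈ s) (hb : b ∈ s) (hc : c ∈ s) (h : 0 < br a b c) (h1 : 0 ≤ br a b x)
    (h2 : 0 ≤ br b c x) (h3 : 0 ≤ br c a x) : x ∈ s := by
  rw [br_barycentric a b c x h.ne']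
  refine hs.three_mem ha hb hc (by positivity) (by positivity) (by positivity) ?_
  rw [← add_div, ← add_div, br_sum, div_self h.ne']

/-- The diagonals from `p 0` cut the heptagon into a fan of triangles. The triangle containing x is
the first one at which x passes from the left to the right of the diagonal. -/
theorem mem_convexHull_of_edges {p : Fin 7 → Fin 2 → ℝ} (hp : ConvexCyclic p) {x : Fin 2 → ℝ}
    (h : ∀ i, 0 ≤ br (p i) (p (i + 1)) x) : x ∈ convexHull ℝ (Set.range p) := by
  have hm : ∀ i, p i ∈ convexHull ℝ (Set.range p) := fun i => subset_convexHull _ _ ⟨i, rfl⟩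
  have hc := convex_convexHull ℝ (Set.range p)
  have sw : ∀ a b : Fin 2 → ℝ, br a b x = - br b a x := by intro a b; unfold br; ring
  have tri : ∀ k : Fin 7, 0 < k → k < k + 1 → 0 ≤ br (p 0) (p k) x → br (p 0) (p (k + 1)) x ≤ 0 →
      x ∈ convexHull ℝ (Set.range p) := by
    intro k h0 h1 h2 h3
    refine mem_of_br_nonneg hc (hm 0) (hm k) (hm (k + 1)) (hp _ _ _ h0 h1) h2 (h k) ?_
    rw [sw]; linarith
  have h1 : 0 ≤ br (p 0) (p 1) x := h 0
  have h6 : br (p 0) (p 6) x ≤ 0 := by rw [sw]; have := h 6; simp at this; linarith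
  by_cases c2 : br (p 0) (p 2) x ≤ 0
  · exact tri 1 (by decide) (by decide) h1 c2
  by_cases c3 : br (p 0) (p 3) x ≤ 0
  · exact tri 2 (by decide) (by decide) (le_of_not_ge c2) c3
  by_cases c4 : br (p 0) (p 4) x ≤ 0
  · exact tri 3 (by decide) (by decide) (le_of_not_ge c3) c4
  by_cases c5 : br (p 0) (p 5) x ≤ 0
  · exact tri 4 (by decide) (by decide) (le_of_not_ge c4) c5
  · exact tri 5 (by decide) (by decide) (le_of_not_ge c5) h6

/-- Lift `q 2` to height s, `q 5` to height t and the other vertices to 0. The scale factors make A,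
B, D equal to s at `q 2`, and B, C, F equal to t at `q 5`. The only remaining bounds that are not
automatic are s ≤ C at `q 2` and t ≤ A at `q 5`, which are `hX` and `hY`. -/
theorem exists_lift_of_center {q : Fin 7 → Fin 2 → ℝ} (hq : ConvexCyclic q)
    (hX : br (q 2) (q 3) (q 4) * br (q 0) (q 5) (q 6) ≤ br (q 3) (q 4) (q 5) * br (q 0) (q 2) (q 6))
    (hY : br (q 3) (q 4) (q 5) * br (q 0) (q 1) (q 2) ≤ br (q 2) (q 3) (q 4) * br (q 0) (q 1) (q 5)) :
    ∃ U L : Fin 3 → ((Fin 2 → ℝ) →ᵃ[ℝ] ℝ), L 0 = 0 ∧ ∀ x, x ∈ convexHull ℝ (Set.range q) ↔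
      ∃ z : ℝ, (∀ j, z ≤ U j x) ∧ ∀ j, L j x ≤ z := by
  set s := br (q 2) (q 3) (q 4) with hs
  set t := br (q 3) (q 4) (q 5) with ht
  have s0 : 0 < s := hq _ _ _ (by decide) (by decide)
  have t0 : 0 < t := hq _ _ _ (by decide) (by decide)
  have h012 := hq 0 1 2 (by decide) (by decide)
  have h123 := hq 1 2 3 (by decide) (by decide)
  have h456 := hq 4 5 6 (by decide) (by decide)
  have h056 := hq 0 5 6 (by decide) (by decide)
  have h013 := hq 0 1 3 (by decide) (by decide)
  have h134 := hq 1 3 4 (by decide) (by decide)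
  have h346 := hq 3 4 6 (by decide) (by decide)
  have h046 := hq 0 4 6 (by decide) (by decide)
  have h026 := hq 0 2 6 (by decide) (by decide)
  have h015 := hq 0 1 5 (by decide) (by decide)
  set A : (Fin 2 → ℝ) →ᵃ[ℝ] ℝ := (s / br (q 0) (q 1) (q 2)) • brAff (q 0) (q 1) with hA
  set B : (Fin 2 → ℝ) →ᵃ[ℝ] ℝ := brAff (q 3) (q 4) with hB
  set C : (Fin 2 → ℝ) →ᵃ[ℝ] ℝ := (t / br (q 0) (q 5) (q 6)) • brAff (q 6) (q 0) with hC
  set D : (Fin 2 → ℝ) →ᵃ[ℝ] ℝ := (s / br (q 1) (q 2) (q 3)) • brAff (q 3) (q 1) with hD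
  set F : (Fin 2 → ℝ) →ᵃ[ℝ] ℝ := (t / br (q 4) (q 5) (q 6)) • brAff (q 6) (q 4) with hF
  have vA : ∀ x, A x = s / br (q 0) (q 1) (q 2) * br (q 0) (q 1) x := fun x => rfl
  have vB : ∀ x, B x = br (q 3) (q 4) x := fun x => rfl
  have vC : ∀ x, C x = t / br (q 0) (q 5) (q 6) * br (q 6) (q 0) x := fun x => rfl
  have vD : ∀ x, D x = s / br (q 1) (q 2) (q 3) * br (q 3) (q 1) x := fun x => rfl
  have vF : ∀ x, F x = t / br (q 4) (q 5) (q 6) * br (q 6) (q 4) x := fun x => rfl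
  refine ⟨![A, B, C], ![0, D, F], rfl, fun x => ⟨fun hx => ?_, ?_⟩⟩
  -- The set of points admitting a height is convex, so it suffices to give heights for the seven
  -- vertices.
  · let S : Set (Fin 2 → ℝ) := {x | ∃ z : ℝ, (∀ j, z ≤ (![A, B, C] : Fin 3 → _) j x) ∧
      ∀ j, (![0, D, F] : Fin 3 → (Fin 2 → ℝ) →ᵃ[ℝ] ℝ) j x ≤ z}
    have hS : Convex ℝ S := by
      rintro x ⟨z, hz1, hz2⟩ y ⟨w, hw1, hw2⟩ a b ha hb hab
      refine ⟨a * z + b * w, fun j => ?_, fun j => ?_⟩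
      · rw [Convex.combo_affine_apply hab]
        exact add_le_add (mul_le_mul_of_nonneg_left (hz1 j) ha)
          (mul_le_mul_of_nonneg_left (hw1 j) hb)
      · rw [Convex.combo_affine_apply hab]
        exact add_le_add (mul_le_mul_of_nonneg_left (hz2 j) ha)
          (mul_le_mul_of_nonneg_left (hw2 j) hb)
    suffices h : Set.range q ⊆ S from convexHull_min h hS hx
    have cyc : ∀ i j k : Fin 7, i < j → j < k → 0 ≤ br (q i) (q j) (q k) ∧
        0 ≤ br (q j) (q k) (q i) ∧ 0 ≤ br (q k) (q i) (q j) ∧ br (q k) (q j) (q i) ≤ 0 ∧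
        br (q j) (q i) (q k) ≤ 0 ∧ br (q i) (q k) (q j) ≤ 0 := by
      intro i j k h1 h2
      have := (hq i j k h1 h2).le
      refine ⟨this, ?_, ?_, ?_, ?_, ?_⟩ <;> (unfold br at *; linarith)
    have r1 : ∀ a b : Fin 2 → ℝ, br a b a = 0 := by intro a b; unfold br; ring
    have r2 : ∀ a b : Fin 2 → ℝ, br a b b = 0 := by intro a b; unfold br; ring
    have pA : 0 ≤ s / br (q 0) (q 1) (q 2) := by positivity
    have pC : 0 ≤ t / br (q 0) (q 5) (q 6) := by positivity
    have pD : 0 ≤ s / br (q 1) (q 2) (q 3) := by positivity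
    have pF : 0 ≤ t / br (q 4) (q 5) (q 6) := by positivity
    have mk : ∀ x z, 0 ≤ z → D x ≤ z → F x ≤ z → z ≤ A x → z ≤ B x → z ≤ C x → x ∈ S := by
      intro x z h1 h2 h3 h4 h5 h6
      refine ⟨z, fun j => ?_, fun j => ?_⟩ <;> fin_cases j <;> simpa
    rintro _ ⟨i, rfl⟩
    have P0 := fun {k x : ℝ} => mul_nonneg (a := k) (b := x)
    have N0 := fun {k x : ℝ} => mul_nonpos_of_nonneg_of_nonpos (a := k) (b := x)
    have z0 : ∀ k : ℝ, k * 0 ≤ 0 := fun k => by simp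
    have z1 : ∀ k : ℝ, 0 ≤ k * 0 := fun k => by simp
    fin_cases i
    · refine mk _ 0 le_rfl ?_ ?_ ?_ ?_ ?_
      · rw [vD]; exact N0 pD (cyc 0 1 3 (by decide) (by decide)).2.2.2.1
      · rw [vF]; exact N0 pF (cyc 0 4 6 (by decide) (by decide)).2.2.2.1
      · rw [vA]; simp [r1]
      · rw [vB]; exact (cyc 0 3 4 (by decide) (by decide)).2.1
      · rw [vC]; simp [r2]
    · refine mk _ 0 le_rfl ?_ ?_ ?_ ?_ ?_
      · rw [vD]; simp [r2]
      · rw [vF]; exact N0 pF (cyc 1 4 6 (by decide) (by decide)).2.2.2.1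
      · rw [vA]; simp [r2]
      · rw [vB]; exact (cyc 1 3 4 (by decide) (by decide)).2.1
      · rw [vC]; exact P0 pC (cyc 0 1 6 (by decide) (by decide)).2.2.1
    · refine mk _ s s0.le ?_ ?_ ?_ ?_ ?_
      · rw [vD]; show _ * br (q 3) (q 1) (q 2) ≤ _
        rw [← br_cycle (q 3) (q 1) (q 2), div_mul_cancel₀ _ h123.ne']
      · rw [vF]; exact (N0 pF (cyc 2 4 6 (by decide) (by decide)).2.2.2.1).trans s0.le
      · rw [vA]; show _ ≤ _ * br (q 0) (q 1) (q 2)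
        rw [div_mul_cancel₀ _ h012.ne']
      · rw [vB]; show _ ≤ br (q 3) (q 4) (q 2); rw [br_cycle]
      · rw [vC]; show _ ≤ _ * br (q 6) (q 0) (q 2)
        rw [← br_cycle (q 6) (q 0) (q 2), div_mul_eq_mul_div, le_div_iff₀ h056]; exact hX
    · refine mk _ 0 le_rfl ?_ ?_ ?_ ?_ ?_
      · rw [vD]; simp [r1]
      · rw [vF]; exact N0 pF (cyc 3 4 6 (by decide) (by decide)).2.2.2.1
      · rw [vA]; exact P0 pA (cyc 0 1 3 (by decide) (by decide)).1
      · rw [vB]; simp [r1]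
      · rw [vC]; exact P0 pC (cyc 0 3 6 (by decide) (by decide)).2.2.1
    · refine mk _ 0 le_rfl ?_ ?_ ?_ ?_ ?_
      · rw [vD]; exact N0 pD (cyc 1 3 4 (by decide) (by decide)).2.2.2.2.1
      · rw [vF]; simp [r2]
      · rw [vA]; exact P0 pA (cyc 0 1 4 (by decide) (by decide)).1
      · rw [vB]; simp [r2]
      · rw [vC]; exact P0 pC (cyc 0 4 6 (by decide) (by decide)).2.2.1
    · refine mk _ t t0.le ?_ ?_ ?_ ?_ ?_
      · rw [vD]; exact (N0 pD (cyc 1 3 5 (by decide) (by decide)).2.2.2.2.1).trans t0.le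
      · rw [vF]; show _ * br (q 6) (q 4) (q 5) ≤ _
        rw [← br_cycle (q 6) (q 4) (q 5), div_mul_cancel₀ _ h456.ne']
      · rw [vA]; show _ ≤ _ * br (q 0) (q 1) (q 5)
        rw [div_mul_eq_mul_div, le_div_iff₀ h012]; exact hY
      · rw [vB]; exact le_rfl
      · rw [vC]; show _ ≤ _ * br (q 6) (q 0) (q 5)
        rw [← br_cycle (q 6) (q 0) (q 5), div_mul_cancel₀ _ h056.ne']
    · refine mk _ 0 le_rfl ?_ ?_ ?_ ?_ ?_
      · rw [vD]; exact N0 pD (cyc 1 3 6 (by decide) (by decide)).2.2.2.2.1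
      · rw [vF]; simp [r1]
      · rw [vA]; exact P0 pA (cyc 0 1 6 (by decide) (by decide)).1
      · rw [vB]; exact (cyc 3 4 6 (by decide) (by decide)).1
      · rw [vC]; simp [r1]
  · rintro ⟨z, hU, hL⟩
    have uA : z ≤ A x := hU 0
    have uB : z ≤ B x := hU 1
    have uC : z ≤ C x := hU 2
    have l0 : 0 ≤ z := hL 0
    have lD : D x ≤ z := hL 1
    have lF : F x ≤ z := hL 2
    have pA : 0 < s / br (q 0) (q 1) (q 2) := by positivity
    have pC : 0 < t / br (q 0) (q 5) (q 6) := by positivity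
    have cancel : ∀ {k y : ℝ}, 0 < k → 0 ≤ k * y → 0 ≤ y := fun hk h =>
      nonneg_of_mul_nonneg_right h hk
    apply mem_convexHull_of_edges hq
    intro i
    fin_cases i
    · exact cancel pA (l0.trans uA)
    -- Each edge inequality is a positive multiple of an upper bound minus a lower bound: the edges
    -- 01, 34, 60 come from A, B, C against 0, and the edges 12, 23, 45, 56 from A - D, B - D, B -
    -- F, C - F.
    · have e : A x - D x = s * br (q 0) (q 1) (q 3) / (br (q 0) (q 1) (q 2) * br (q 1) (q 2) (q 3)) *
          br (q 1) (q 2) x := by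
        rw [vA, vD]; field_simp; unfold br; ring
      exact cancel (by positivity) (e ▸ sub_nonneg.2 (lD.trans uA))
    · have e : B x - D x = br (q 1) (q 3) (q 4) / br (q 1) (q 2) (q 3) * br (q 2) (q 3) x := by
        rw [vB, vD, hs]; field_simp; unfold br; ring
      exact cancel (by positivity) (e ▸ sub_nonneg.2 (lD.trans uB))
    · exact l0.trans uB
    · have e : B x - F x = br (q 3) (q 4) (q 6) / br (q 4) (q 5) (q 6) * br (q 4) (q 5) x := by
        rw [vB, vF, ht]; field_simp; unfold br; ring
      exact cancel (by positivity) (e ▸ sub_nonneg.2 (lF.trans uB))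
    · have e : C x - F x = t * br (q 0) (q 4) (q 6) / (br (q 0) (q 5) (q 6) * br (q 4) (q 5) (q 6)) *
          br (q 5) (q 6) x := by
        rw [vC, vF]; field_simp; unfold br; ring
      exact cancel (by positivity) (e ▸ sub_nonneg.2 (lF.trans uC))
    · exact cancel pC (l0.trans uC)

theorem exists_lift {p : Fin 7 → Fin 2 → ℝ} (hp : ConvexCyclic p) :
    ∃ U L : Fin 3 → ((Fin 2 → ℝ) →ᵃ[ℝ] ℝ), L 0 = 0 ∧ ∀ x, x ∈ convexHull ℝ (Set.range p) ↔
      ∃ z : ℝ, (∀ j, z ≤ U j x) ∧ ∀ j, L j x ≤ z := by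
  obtain ⟨c, h1, h2⟩ := exists_center hp
  have hr : Set.range (rot c p) = Set.range p :=
    (Equiv.addLeft c).surjective.range_comp p
  rw [← hr]
  rw [← rot_rot] at h1 h2
  simp only [EarLeft, EarRight] at h1 h2
  generalize hq : rot c p = q at *
  have hq' : ConvexCyclic q := hq ▸ hp.rot c
  simp only [rot, Fin.isValue, show (1 : Fin 7) + 1 = 2 from rfl, show (1 : Fin 7) + 2 = 3 from rfl,
    show (1 : Fin 7) + 3 = 4 from rfl, show (1 : Fin 7) + 4 = 5 from rfl,
    show (1 : Fin 7) + 5 = 6 from rfl, show (1 : Fin 7) + 6 = 0 from rfl] at h1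
  simp only [rot, Fin.isValue, show (6 : Fin 7) + 1 = 0 from rfl, show (6 : Fin 7) + 2 = 1 from rfl,
    show (6 : Fin 7) + 3 = 2 from rfl, show (6 : Fin 7) + 4 = 3 from rfl,
    show (6 : Fin 7) + 5 = 4 from rfl, show (6 : Fin 7) + 6 = 5 from rfl] at h2
  refine exists_lift_of_center hq' ?_ ?_
  · rw [← br_cycle (q 0) (q 5) (q 6), ← br_cycle (q 0) (q 2) (q 6)]; exact h1
  · rw [mul_comm]; exact h2

/-! ### Cyclic order of the vertices by angle. -/

/-- A nonzero vector of angle in `[0, π)`. -/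
def Upper (x y : ℝ) : Prop := 0 < y ∨ (y = 0 ∧ 0 < x)

open Classical in
/-- A monotone function of the angle of a vector in the upper half plane. -/
noncomputable def angleKey (x y : ℝ) : WithBot ℝ := if y = 0 then ⊥ else ((-x / y : ℝ) : WithBot ℝ)

theorem angleKey_lt {x y x' y' : ℝ} (h : Upper x y) (h' : Upper x' y')
    (hk : angleKey x y < angleKey x' y') : 0 < x * y' - y * x' := by
  unfold angleKey at hk
  rcases h with h | ⟨h, hx⟩ <;> rcases h' with h' | ⟨h', hx'⟩
  · rw [if_neg h.ne', if_neg h'.ne', WithBot.coe_lt_coe, div_lt_div_iff₀ h h'] at hk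
    linarith
  · simp [h'] at hk
  · subst h; simp; positivity
  · simp [h, h'] at hk

theorem angleKey_eq {x y x' y' : ℝ} (h : Upper x y) (h' : Upper x' y')
    (hk : angleKey x y = angleKey x' y') : x * y' - y * x' = 0 := by
  unfold angleKey at hk
  rcases h with h | ⟨h, hx⟩ <;> rcases h' with h' | ⟨h', hx'⟩
  · rw [if_neg h.ne', if_neg h'.ne', WithBot.coe_inj, div_eq_div_iff h.ne' h'.ne'] at hk
    linarith
  · simp [h', h.ne'] at hk
  · simp [h, h'.ne'] at hk
  · simp [h, h']

theorem angleKey_le {x y x' y' : ℝ} (h : Upper x y) (h' : Upper x' y')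
    (hk : angleKey x y ≤ angleKey x' y') : 0 ≤ x * y' - y * x' := by
  rcases hk.lt_or_eq with hk | hk
  · exact (angleKey_lt h h' hk).le
  · exact (angleKey_eq h h' hk).ge

theorem convex_sdiff_extremePoint {P : Set (Fin 2 → ℝ)} (hP : Convex ℝ P) {x : Fin 2 → ℝ}
    (hx : x ∈ P.extremePoints ℝ) : Convex ℝ (P \ {x}) :=
  ((hP.mem_extremePoints_iff_convex_sdiff).1 hx).2

/-- Of three distinct collinear points one lies on the segment between the other two, so it is not
extreme; the three ranges of t decide which one. -/
theorem br_ne_zero {P : Set (Fin 2 → ℝ)} (hP : Convex ℝ P) {a b c : Fin 2 → ℝ}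
    (ha : a ∈ P.extremePoints ℝ) (hb : b ∈ P.extremePoints ℝ) (hc : c ∈ P.extremePoints ℝ)
    (hab : a ≠ b) (hac : a ≠ c) (hbc : b ≠ c) : br a b c ≠ 0 := by
  intro h
  have ht : ∃ t : ℝ, c = (1 - t) • a + t • b := by
    have : a 0 ≠ b 0 ∨ a 1 ≠ b 1 := by
      by_contra hcon; push Not at hcon
      apply hab; funext i; fin_cases i; exacts [hcon.1, hcon.2]
    unfold br at h
    rcases this with h0 | h0
    · have h0' : b 0 - a 0 ≠ 0 := sub_ne_zero.2 h0.symm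
      refine ⟨(c 0 - a 0) / (b 0 - a 0), ?_⟩
      funext i; simp only [Pi.add_apply, Pi.smul_apply, smul_eq_mul]; field_simp
      fin_cases i <;> simp <;> linarith
    · have h0' : b 1 - a 1 ≠ 0 := sub_ne_zero.2 h0.symm
      refine ⟨(c 1 - a 1) / (b 1 - a 1), ?_⟩
      funext i; simp only [Pi.add_apply, Pi.smul_apply, smul_eq_mul]; field_simp
      fin_cases i <;> simp <;> linarith
  obtain ⟨t, ht⟩ := ht
  have key : ∀ {x y z : Fin 2 → ℝ}, x ∈ P.extremePoints ℝ → y ∈ P.extremePoints ℝ →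
      z ∈ P.extremePoints ℝ → x ≠ z → y ≠ z → ∀ u : ℝ, 0 ≤ u → u ≤ 1 →
      z ≠ (1 - u) • x + u • y := by
    intro x y z hx hy hz hxz hyz u h0 h1 he
    have := (convex_sdiff_extremePoint hP hz) ⟨hx.1, hxz⟩ ⟨hy.1, hyz⟩ (sub_nonneg.2 h1) h0 (by ring)
    exact this.2 he.symm
  rcases lt_or_ge t 0 with h0 | h0
  · refine key hc hb ha hac.symm hab.symm (-t / (1 - t)) (div_nonneg (by linarith) (by linarith))
      (by rw [div_le_one (by linarith)]; linarith) ?_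
    have : (1 - t) ≠ 0 := by linarith
    rw [ht]; funext i; simp; field_simp; ring
  rcases le_or_gt t 1 with h1 | h1
  · exact key ha hb hc hac hbc t h0 h1 ht
  · refine key hc ha hb hbc.symm hab (1 - 1 / t) ?_ ?_ ?_
    · rw [sub_nonneg, div_le_one (by linarith)]; linarith
    · have : 0 < 1 / t := by positivity
      linarith
    · have : t ≠ 0 := by linarith
      rw [ht]; funext i; simp; field_simp; ring

/-- Seen from the lowest vertex (leftmost among ties), all other vertices have directions with angle
in [0, π), and they are sorted by that angle. -/
theorem exists_convexCyclic {P : Set (Fin 2 → ℝ)} (hP : IsConvexHeptagon P) :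
    ∃ p : Fin 7 → Fin 2 → ℝ, ConvexCyclic p ∧ Set.range p = vertices P ∧
      P = convexHull ℝ (Set.range p) := by
  obtain ⟨⟨s, hs, rfl⟩, hcard⟩ := hP
  set P := convexHull ℝ s with hPdef
  have hconv : Convex ℝ P := convex_convexHull ℝ s
  have hfin : (vertices P).Finite := Set.finite_of_ncard_ne_zero (by omega)
  have hne : hfin.toFinset.Nonempty := by
    rw [Set.Finite.toFinset_nonempty]
    exact Set.nonempty_of_ncard_ne_zero (by omega)
  obtain ⟨a, ha, hmin⟩ := hfin.toFinset.exists_min_image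
    (fun v : Fin 2 → ℝ => toLex (v 1, v 0)) hne
  rw [Set.Finite.mem_toFinset] at ha
  have hc6 : (hfin.toFinset.erase a).card = 6 := by
    rw [Finset.card_erase_of_mem (by simpa using ha), ← Set.ncard_eq_toFinset_card _ hfin, hcard]
  let e := (hfin.toFinset.erase a).equivFinOfCardEq hc6
  let w : Fin 6 → Fin 2 → ℝ := fun i => (e.symm i : Fin 2 → ℝ)
  have hw : ∀ i, w i ∈ vertices P ∧ w i ≠ a := fun i => by
    have := (e.symm i).2
    rw [Finset.mem_erase, Set.Finite.mem_toFinset] at this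
    exact ⟨this.2, this.1⟩
  have hwinj : Function.Injective w := fun i j h => e.symm.injective (Subtype.ext h)
  have hwsurj : ∀ v ∈ vertices P, v ≠ a → ∃ i, w i = v := fun v hv hva =>
    ⟨e ⟨v, by rw [Finset.mem_erase, Set.Finite.mem_toFinset]; exact ⟨hva, hv⟩⟩, by simp [w]⟩
  have hup : ∀ i, Upper (w i 0 - a 0) (w i 1 - a 1) := by
    intro i
    have h := hmin (w i) (by rw [Set.Finite.mem_toFinset]; exact (hw i).1)
    rw [Prod.Lex.toLex_le_toLex] at h
    rcases h with h | ⟨h1, h2⟩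
    · exact Or.inl (sub_pos.2 h)
    · refine Or.inr ⟨by simp only at h1; linarith, sub_pos.2 (lt_of_le_of_ne h2 ?_)⟩
      intro h3
      apply (hw i).2
      funext j; fin_cases j
      exacts [h3.symm, h1.symm]
  let key : Fin 6 → WithBot ℝ := fun i => angleKey (w i 0 - a 0) (w i 1 - a 1)
  let τ := Tuple.sort key
  have hmono : Monotone (key ∘ τ) := Tuple.monotone_sort key
  let u : Fin 6 → Fin 2 → ℝ := w ∘ τ
  have hu : ∀ i, u i ∈ vertices P ∧ u i ≠ a := fun i => hw _
  have huinj : Function.Injective u := hwinj.comp τ.injective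
  have h0 : ∀ i j, i < j → 0 < br a (u i) (u j) := by
    intro i j hij
    refine lt_of_le_of_ne ?_ (br_ne_zero hconv ha (hu i).1 (hu j).1 (hu i).2.symm (hu j).2.symm
      (huinj.ne hij.ne)).symm
    exact angleKey_le (hup _) (hup _) (hmono hij.le)
  have h1 : ∀ i j k, i < j → j < k → 0 < br (u i) (u j) (u k) := by
    intro i j k hij hjk
    -- A wrong turn at `u j` would place it in the triangle with corners a, `u i`, `u k`, all of
    -- them in P without `u j`, which is convex because `u j` is extreme.
    by_contra hcon
    have hd := convex_sdiff_extremePoint hconv (hu j).1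
    have := mem_of_br_nonneg hd (a := a) (b := u i) (c := u k) (x := u j) ⟨ha.1, (hu j).2.symm⟩
      ⟨(hu i).1.1, huinj.ne hij.ne⟩ ⟨(hu k).1.1, huinj.ne hjk.ne'⟩ (h0 i k (hij.trans hjk))
      (h0 i j hij).le (by rw [br_swap]; linarith) (by rw [← br_cycle]; exact (h0 j k hjk).le)
    exact this.2 rfl
  have hrange : Set.range (Fin.cons a u : Fin 7 → Fin 2 → ℝ) = vertices P := by
    ext v
    constructor
    · rintro ⟨i, rfl⟩
      refine Fin.cases ?_ (fun i => ?_) i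
      · exact ha
      · exact (hu i).1
    · intro hv
      by_cases hva : v = a
      · exact ⟨0, hva.symm⟩
      · obtain ⟨i, hi⟩ := hwsurj v hv hva
        exact ⟨(τ.symm i).succ, by simp [u, hi]⟩
  refine ⟨Fin.cons a u, ?_, hrange, ?_⟩
  · intro i j k hij hjk
    obtain ⟨j, rfl⟩ := Fin.exists_succ_eq.2 (Fin.ne_zero_of_lt hij)
    obtain ⟨k, rfl⟩ := Fin.exists_succ_eq.2 (Fin.ne_zero_of_lt hjk)
    rw [Fin.succ_lt_succ_iff] at hjk
    revert hij
    refine Fin.cases (fun _ => ?_) (fun i hij => ?_) i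
    · exact h0 j k hjk
    · rw [Fin.succ_lt_succ_iff] at hij
      exact h1 i j k hij hjk
  · rw [hrange]
    have hcomp : IsCompact P := hs.isCompact_convexHull (𝕜 := ℝ)
    have := closure_convexHull_extremePoints hcomp hconv
    refine this.symm.trans ?_
    exact (hfin.isCompact_convexHull (𝕜 := ℝ)).isClosed.closure_eq

/-! ### Pointed cones and their extreme rays. -/

section Cone

variable {E ι : Type*} [AddCommGroup E] [Module ℝ E]

/-- `h` is positive on the nonzero elements of the cone `{x | ∀ i, 0 ≤ σ i x}`. -/
def ConePos (σ : ι → E →ₗ[ℝ] ℝ) (h : E →ₗ[ℝ] ℝ) : Prop :=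
  ∀ x, (∀ i, 0 ≤ σ i x) → x ≠ 0 → 0 < h x

/-- The generators of the extreme rays of the cone `{x | ∀ i, 0 ≤ σ i x}`, normalized by `h`. -/
structure IsRay (σ : ι → E →ₗ[ℝ] ℝ) (h : E →ₗ[ℝ] ℝ) (x : E) : Prop where
  one : h x = 1
  nonneg : ∀ i, 0 ≤ σ i x
  minimal : ∀ y, (∀ i, σ i x = 0 → σ i y = 0) → y = h y • x

variable {σ : ι → E →ₗ[ℝ] ℝ} {h : E →ₗ[ℝ] ℝ}

theorem IsRay.ne_zero {x : E} (hx : IsRay σ h x) : x ≠ 0 := by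
  rintro rfl; simpa using hx.one

theorem IsRay.eq_of_support {x y : E} (hx : IsRay σ h x) (hy : IsRay σ h y)
    (hxy : ∀ i, σ i x = 0 → σ i y = 0) : y = x := by
  have := hx.minimal y hxy
  rwa [hy.one, one_smul] at this

/-- A normalized ray is determined by the set of inequalities that are tight at it. -/
theorem finite_isRay [Fintype ι] (σ : ι → E →ₗ[ℝ] ℝ) (h : E →ₗ[ℝ] ℝ) : {x | IsRay σ h x}.Finite := by
  classical
  refine Set.Finite.of_finite_image (f := fun x => Finset.univ.filter fun i => σ i x = 0)
    (Set.toFinite _) ?_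
  intro x hx y hy hxy
  refine (hx.eq_of_support hy fun i hi => ?_).symm
  have : i ∈ Finset.univ.filter fun i => σ i x = 0 := by simpa using hi
  simp only at hxy
  rw [hxy] at this
  simpa using this

/-- Ratio test: move in direction y until the first decreasing slack reaches zero. -/
theorem exists_step [Fintype ι] {x y : E} (hx : ∀ i, 0 ≤ σ i x) (hxy : ∀ i, σ i x = 0 → σ i y = 0)
    (hy : ∃ i, σ i y < 0) : ∃ t : ℝ, 0 < t ∧ (∀ i, 0 ≤ σ i (x + t • y)) ∧
      ∃ i, σ i x ≠ 0 ∧ σ i (x + t • y) = 0 := by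
  classical
  obtain ⟨i₀, hi₀⟩ := hy
  obtain ⟨i, hi, hmin⟩ := (Finset.univ.filter fun i => σ i y < 0).exists_min_image
    (fun i => σ i x / (- σ i y)) ⟨i₀, by simpa using hi₀⟩
  have hi : σ i y < 0 := by simpa using hi
  have hxi : 0 < σ i x := lt_of_le_of_ne (hx i) fun h0 => by
    have := hxy i h0.symm; linarith
  refine ⟨σ i x / (- σ i y), div_pos hxi (by linarith), fun j => ?_, i, hxi.ne', ?_⟩
  · rw [map_add, map_smul, smul_eq_mul]
    rcases lt_or_ge (σ j y) 0 with hj | hj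
    · have := hmin j (by simpa using hj)
      have h2 := mul_le_mul_of_nonneg_right this (show 0 ≤ - σ j y by linarith)
      rw [div_mul_cancel₀ _ (show - σ j y ≠ 0 by linarith)] at h2
      linarith
    · have : 0 ≤ σ i x / (- σ i y) := (div_pos hxi (by linarith)).le
      have := mul_nonneg this hj
      linarith [hx j]
  · rw [map_add, map_smul, smul_eq_mul]
    have := hi.ne
    field_simp
    simp

/-- A pointed cone is generated by its extreme rays. -/
theorem mem_convexHull_isRay [Fintype ι] (hpos : ConePos σ h) {x : E} (h1 : h x = 1) (hx : ∀ i, 0 ≤ σ i x) :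
    x ∈ convexHull ℝ {x | IsRay σ h x} := by
  classical
  obtain ⟨n, hn⟩ : ∃ n, (Finset.univ.filter fun i => σ i x ≠ 0).card = n := ⟨_, rfl⟩
  induction n using Nat.strong_induction_on generalizing x with
  | _ n ih =>
    by_cases hray : IsRay σ h x
    · exact subset_convexHull _ _ hray
    obtain ⟨y, hy, hne⟩ : ∃ y, (∀ i, σ i x = 0 → σ i y = 0) ∧ y ≠ h y • x := by
      by_contra hcon; push Not at hcon
      exact hray ⟨h1, hx, hcon⟩
    -- A direction of height zero inside the minimal face of x. Positivity of h forces both z and -z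
    -- to leave the cone, and each exit point has more tight inequalities than x.
    let z := y - h y • x
    have hz0 : z ≠ 0 := sub_ne_zero.2 hne
    have hz : h z = 0 := by simp [z, h1]
    have hzs : ∀ i, σ i x = 0 → σ i z = 0 := fun i hi => by simp [z, hi, hy i hi]
    have neg : ∀ w : E, w ≠ 0 → h w = 0 → ∃ i, σ i w < 0 := by
      intro w hw hw0
      by_contra hcon; push Not at hcon
      exact (hpos w hcon hw).ne' hw0
    have small : ∀ w : E, h w = 0 → (∀ i, σ i x = 0 → σ i w = 0) → (∃ i, σ i w < 0) →
        ∃ t : ℝ, 0 < t ∧ x + t • w ∈ convexHull ℝ {x | IsRay σ h x} := by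
      intro w hw hws hwn
      obtain ⟨t, ht, hnn, i, hi, hi0⟩ := exists_step hx hws hwn
      refine ⟨t, ht, ih _ ?_ (by simp [h1, hw]) hnn rfl⟩
      rw [← hn]
      apply Finset.card_lt_card
      refine ⟨fun j hj => ?_, fun hsub => ?_⟩
      · simp only [Finset.mem_filter, Finset.mem_univ, true_and] at hj ⊢
        intro hj0; apply hj; simp [hj0, hws j hj0]
      · have := hsub (show i ∈ _ by simpa using hi)
        simp only [Finset.mem_filter, Finset.mem_univ, true_and] at this
        exact this hi0
    obtain ⟨t, ht, hmt⟩ := small z hz hzs (neg z hz0 hz)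
    obtain ⟨u, hu, hmu⟩ := small (-z) (by simp [hz]) (fun i hi => by simp [hzs i hi])
      (neg (-z) (neg_ne_zero.2 hz0) (by simp [hz]))
    -- x is the weighted mean of the exit points x + t z and x - u z.
    have := convex_convexHull ℝ {x | IsRay σ h x} hmt hmu (a := u / (t + u)) (b := t / (t + u))
      (by positivity) (by positivity) (by field_simp; ring)
    convert this using 1
    have htu : t + u ≠ 0 := by positivity
    rw [smul_add, smul_add, add_add_add_comm, ← add_smul, smul_neg, smul_neg, smul_smul, smul_smul,
      ← sub_eq_add_neg, ← sub_smul]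
    have e1 : u / (t + u) + t / (t + u) = 1 := by field_simp; ring
    have e2 : u / (t + u) * t - t / (t + u) * u = 0 := by ring
    rw [e1, e2]; simp

theorem ConePos.injective (hpos : ConePos σ h) {x : E} (hx : ∀ i, σ i x = 0) : x = 0 := by
  by_contra hne
  have h1 := hpos x (fun i => (hx i).ge) hne
  have h2 := hpos (-x) (fun i => by simp [hx i]) (neg_ne_zero.2 hne)
  rw [map_neg] at h2
  linarith

/-- A nonzero element of the cone with minimal support yields a ray generator. -/
theorem isRay_of_minimal (hpos : ConePos σ h) {x : E} (hx : ∀ i, 0 ≤ σ i x) (h0 : x ≠ 0)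
    (hmin : ∀ y, (∀ i, σ i x = 0 → σ i y = 0) → ∃ c : ℝ, y = c • x) :
    IsRay σ h ((h x)⁻¹ • x) := by
  have hp := hpos x hx h0
  refine ⟨by simp [hp.ne'], fun i => ?_, fun y hy => ?_⟩
  · rw [map_smul]; exact mul_nonneg (inv_nonneg.2 hp.le) (hx i)
  · obtain ⟨c, rfl⟩ := hmin y fun i hi => hy i (by simp [hi])
    simp [smul_smul, hp.ne']

/-- The ray generators are exactly the extreme points of the base of the cone. -/
theorem isRay_of_extreme [Fintype ι] (hpos : ConePos σ h) {x : E}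
    (hx : x ∈ Set.extremePoints ℝ {x | h x = 1 ∧ ∀ i, 0 ≤ σ i x}) : IsRay σ h x := by
  have hm := mem_convexHull_isRay hpos hx.1.1 hx.1.2
  have hsub : {x | IsRay σ h x} ⊆ {x | h x = 1 ∧ ∀ i, 0 ≤ σ i x} := fun y hy => ⟨hy.1, hy.2⟩
  have hconv : Convex ℝ {x | h x = 1 ∧ ∀ i, 0 ≤ σ i x} := by
    rintro a ⟨ha, ha'⟩ b ⟨hb, hb'⟩ u v hu hv huv
    refine ⟨by simp [ha, hb, huv], fun i => ?_⟩
    simp only [map_add, map_smul, smul_eq_mul]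
    exact add_nonneg (mul_nonneg hu (ha' i)) (mul_nonneg hv (hb' i))
  by_contra hcon
  have hd := ((hconv.mem_extremePoints_iff_convex_sdiff).1 hx).2
  have : convexHull ℝ {x | IsRay σ h x} ⊆ {x | h x = 1 ∧ ∀ i, 0 ≤ σ i x} \ {x} :=
    convexHull_min (fun y hy => ⟨hsub hy, fun h => hcon (h ▸ hy)⟩) hd
  exact (this hm).2 rfl

theorem IsRay.extreme {x : E} (hx : IsRay σ h x) :
    x ∈ Set.extremePoints ℝ {x | h x = 1 ∧ ∀ i, 0 ≤ σ i x} := by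
  refine ⟨⟨hx.1, hx.2⟩, ?_⟩
  rintro a ⟨ha, ha'⟩ b ⟨hb, hb'⟩ ⟨u, v, hu, hv, huv, rfl⟩
  have := hx.minimal a fun i hi => by
    simp only [map_add, map_smul, smul_eq_mul] at hi
    have h1 := mul_nonneg hu.le (ha' i)
    have h2 := mul_nonneg hv.le (hb' i)
    have : u * σ i a = 0 := by linarith
    simpa [hu.ne'] using this
  rwa [ha, one_smul] at this

end Cone

/-! ### Inequality descriptions and the number of facets. -/

section HRep

variable {V : Type*} [AddCommGroup V] [Module ℝ V]

/-- `Q` is the solution set of affine equations and at most `k` affine inequalities. -/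
def HRep (Q : Set V) (k : ℕ) : Prop :=
  ∃ (S : Set (V →ᵃ[ℝ] ℝ)) (t : Finset (V →ᵃ[ℝ] ℝ)), t.card ≤ k ∧
    Q = {x | (∀ e ∈ S, e x = 0) ∧ ∀ f ∈ t, 0 ≤ f x}

theorem affine_add (f : V →ᵃ[ℝ] ℝ) (x w : V) : f (x + w) = f x + f.linear w := by
  have := f.map_vadd x w
  rw [vadd_eq_add, vadd_eq_add] at this
  rw [add_comm x, this, add_comm]

theorem affine_sub (f : V →ᵃ[ℝ] ℝ) (x y : V) : f.linear (x - y) = f x - f y := by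
  have := affine_add f y (x - y)
  rw [add_sub_cancel] at this
  linarith

theorem affine_combo (f : V →ᵃ[ℝ] ℝ) {x y : V} {a b : ℝ} (hab : a + b = 1) :
    f (a • x + b • y) = a * f x + b * f y :=
  Convex.combo_affine_apply hab

theorem convex_solutions (S : Set (V →ᵃ[ℝ] ℝ)) (t : Finset (V →ᵃ[ℝ] ℝ)) :
    Convex ℝ {x | (∀ e ∈ S, e x = 0) ∧ ∀ f ∈ t, 0 ≤ f x} := by
  rintro x ⟨hx, hx'⟩ y ⟨hy, hy'⟩ a b ha hb hab
  refine ⟨fun e he => ?_, fun f hf => ?_⟩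
  · rw [affine_combo e hab, hx e he, hy e he]; simp
  · rw [affine_combo f hab]
    exact add_nonneg (mul_nonneg ha (hx' f hf)) (mul_nonneg hb (hy' f hf))

theorem HRep.convex {Q : Set V} {k : ℕ} (h : HRep Q k) : Convex ℝ Q := by
  obtain ⟨S, t, -, rfl⟩ := h
  exact convex_solutions S t

/-- A point of a convex set at which only those of finitely many nonnegative functions vanish
that vanish identically. -/
theorem exists_relint {C : Set V} (hC : Convex ℝ C) (hne : C.Nonempty)
    (t : Finset (V →ᵃ[ℝ] ℝ)) (hnn : ∀ f ∈ t, ∀ x ∈ C, 0 ≤ f x) :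
    ∃ z ∈ C, ∀ f ∈ t, f z = 0 → ∀ y ∈ C, f y = 0 := by
  classical
  induction t using Finset.induction_on with
  | empty => obtain ⟨z, hz⟩ := hne; exact ⟨z, hz, by simp⟩
  | insert f t _ ih =>
    obtain ⟨z, hz, h⟩ := ih fun g hg => hnn g (Finset.mem_insert_of_mem hg)
    by_cases hf : ∀ y ∈ C, f y = 0
    · refine ⟨z, hz, fun g hg => ?_⟩
      rcases Finset.mem_insert.1 hg with rfl | hg
      · exact fun _ => hf
      · exact h g hg
    · push Not at hf
      obtain ⟨y, hy, hfy⟩ := hf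
      refine ⟨(1 / 2 : ℝ) • z + (1 / 2 : ℝ) • y, hC hz hy (by norm_num) (by norm_num) (by norm_num),
        fun g hg h0 => ?_⟩
      rw [affine_combo g (by norm_num)] at h0
      have h1 := hnn g hg z hz
      have h2 := hnn g hg y hy
      rcases Finset.mem_insert.1 hg with rfl | hg
      · exact absurd (by linarith) hfy
      · exact h g hg (by linarith)

theorem exists_push {S : Set (V →ᵃ[ℝ] ℝ)} {t : Finset (V →ᵃ[ℝ] ℝ)} {z w : V}
    (hS : ∀ e ∈ S, e z = 0) (ht : ∀ f ∈ t, 0 ≤ f z) (hSw : ∀ e ∈ S, e.linear w = 0)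
    (htw : ∀ f ∈ t, f z = 0 → 0 ≤ f.linear w) :
    ∃ ε : ℝ, 0 < ε ∧ z + ε • w ∈ {x | (∀ e ∈ S, e x = 0) ∧ ∀ f ∈ t, 0 ≤ f x} := by
  have hev : ∀ᶠ ε : ℝ in nhdsWithin 0 (Set.Ioi 0), ∀ f ∈ t, 0 ≤ f (z + ε • w) := by
    rw [Filter.eventually_all_finset]
    intro f hf
    rcases (ht f hf).eq_or_lt with h0 | h0
    · filter_upwards [self_mem_nhdsWithin] with ε hε
      rw [affine_add, map_smul, ← h0, zero_add]
      exact mul_nonneg (le_of_lt hε) (htw f hf h0.symm)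
    · have hc : Filter.Tendsto (fun ε : ℝ => f z + ε * f.linear w) (nhds 0) (nhds (f z + 0 * f.linear w)) :=
        Continuous.tendsto (by fun_prop) 0
      rw [zero_mul, add_zero] at hc
      filter_upwards [nhdsWithin_le_nhds (hc.eventually (lt_mem_nhds h0))] with ε hε
      rw [affine_add, map_smul]; exact hε.le
  obtain ⟨ε, h1, h2⟩ := (hev.and self_mem_nhdsWithin).exists
  refine ⟨ε, h2, fun e he => ?_, h1⟩
  rw [affine_add, map_smul, hS e he, hSw e he]; simp

end HRep

/-- Every facet equals the zero set on Q of one of the describing inequalities, so there are at most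
as many facets as inequalities. The inequality is found at a relative interior point z of the facet.
-/
theorem size_le_of_hRep {n k : ℕ} {Q : Set (Fin n → ℝ)} (hQ : HRep Q k) : size Q ≤ k := by
  have hconv := hQ.convex
  obtain ⟨S, t, hk, hQe⟩ := hQ
  suffices h : facets Q ⊆ (fun f : (Fin n → ℝ) →ᵃ[ℝ] ℝ => {x ∈ Q | f x = 0}) '' (t : Set _) by
    calc size Q ≤ _ := Set.encard_le_encard h
      _ ≤ _ := Set.encard_image_le _ _
      _ = t.card := Set.encard_coe_eq_coe_finsetCard t
      _ ≤ k := by exact_mod_cast hk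
  rintro F ⟨hexp, hne, hdim⟩
  have hFconv := hexp.convex hconv
  obtain ⟨l, hl⟩ := hexp hne
  have hFQ : F ⊆ Q := by rw [hl]; exact fun x hx => hx.1
  have memS : ∀ x ∈ Q, ∀ e ∈ S, e x = 0 := fun x hx => by rw [hQe] at hx; exact hx.1
  have memt : ∀ x ∈ Q, ∀ f ∈ t, 0 ≤ f x := fun x hx => by rw [hQe] at hx; exact hx.2
  obtain ⟨z, hz, hzt⟩ := exists_relint hFconv hne t fun f hf x hx => memt x (hFQ hx) f hf
  have hzl : ∀ y ∈ Q, l y ≤ l z := by rw [hl] at hz; exact hz.2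
  have key : ∃ f ∈ t, f z = 0 ∧ ∃ y ∈ Q, f y ≠ 0 := by
    by_contra hcon
    push Not at hcon
    -- If everything tight at z vanished on Q, one could move from z slightly away from any x in Q
    -- and stay in Q; the maximality of l at z then gives l z ≤ l x, so the facet would be all of Q.
    have hQF : Q ⊆ F := by
      intro x hx
      obtain ⟨ε, hε, hmem⟩ := exists_push (w := z - x) (memS z (hFQ hz)) (memt z (hFQ hz))
        (fun e he => by rw [affine_sub, memS z (hFQ hz) e he, memS x hx e he]; simp)
        (fun f hf h0 => by rw [affine_sub, h0, hcon f hf h0 x hx]; simp)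
      rw [← hQe] at hmem
      have := hzl _ hmem
      rw [map_add, map_smul, map_sub, smul_eq_mul] at this
      have h2 : l z ≤ l x := by
        by_contra hlt; push Not at hlt
        have := mul_pos hε (sub_pos.2 hlt); linarith
      rw [hl]
      exact ⟨hx, fun y hy => (hzl y hy).trans h2⟩
    rw [hFQ.antisymm hQF] at hdim
    omega
  obtain ⟨f, hf, hfz, y, hy, hfy⟩ := key
  refine ⟨f, hf, ?_⟩
  have hsub : F ⊆ {x ∈ Q | f x = 0} := fun x hx => ⟨hFQ hx, hzt f hf hfz x hx⟩
  refine Set.Subset.antisymm ?_ hsub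
  rintro x ⟨hx, hfx⟩
  have hle : vectorSpan ℝ F ≤ vectorSpan ℝ {x ∈ Q | f x = 0} := vectorSpan_mono ℝ hsub
  have hlt : vectorSpan ℝ {x ∈ Q | f x = 0} < vectorSpan ℝ Q := by
    refine lt_of_le_of_ne (vectorSpan_mono ℝ fun x hx => hx.1) fun heq => hfy ?_
    have hker : vectorSpan ℝ {x ∈ Q | f x = 0} ≤ LinearMap.ker f.linear := by
      rw [vectorSpan, Submodule.span_le]
      rintro _ ⟨a, ha, b, hb, rfl⟩
      show f.linear (a - b) = 0
      rw [affine_sub, ha.2, hb.2, sub_zero]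
    have h1 : y - z ∈ vectorSpan ℝ Q := vsub_mem_vectorSpan ℝ hy (hFQ hz)
    rw [← heq] at h1
    have h2 : f.linear (y - z) = 0 := hker h1
    rw [affine_sub, hfz, sub_zero] at h2
    exact h2
  have hfr := Submodule.finrank_lt_finrank_of_lt hlt
  have heq := Submodule.eq_of_le_of_finrank_le hle (by omega)
  have hmem : x - z ∈ vectorSpan ℝ F := by
    rw [heq]; exact vsub_mem_vectorSpan ℝ ⟨hx, hfx⟩ ⟨hFQ hz, hfz⟩
  have hker : vectorSpan ℝ F ≤ LinearMap.ker (l : (Fin n → ℝ) →ₗ[ℝ] ℝ) := by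
    rw [vectorSpan, Submodule.span_le]
    rintro _ ⟨a, ha, b, hb, rfl⟩
    rw [hl] at ha hb
    show l (a - b) = 0
    rw [map_sub, sub_eq_zero]
    exact le_antisymm (hb.2 _ ha.1) (ha.2 _ hb.1)
  have h0 : l (x - z) = 0 := hker hmem
  rw [map_sub, sub_eq_zero] at h0
  rw [hl]
  exact ⟨hx, fun y hy => h0 ▸ hzl y hy⟩

section Polytope

variable {n : ℕ} (s : Set (Fin n → ℝ))

/-- Restriction of affine functions to a set of points. -/
def restr : ((Fin n → ℝ) →ᵃ[ℝ] ℝ) →ₗ[ℝ] (s → ℝ) where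
  toFun f := fun v => f v
  map_add' _ _ := rfl
  map_smul' _ _ := rfl

/-- Evaluation of restricted affine functions at a point of the set. -/
def evalAt (v : s) : LinearMap.range (restr s) →ₗ[ℝ] ℝ :=
  (LinearMap.proj v).comp (Submodule.subtype _)

/-- The sum of the values of a restricted affine function. -/
noncomputable def evalSum [Fintype s] : LinearMap.range (restr s) →ₗ[ℝ] ℝ := ∑ v, evalAt s v

theorem conePos_evalSum [Fintype s] : ConePos (evalAt s) (evalSum s) := by
  intro x hx hne
  rw [evalSum, LinearMap.sum_apply]
  refine Finset.sum_pos' (fun v _ => hx v) ?_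
  by_contra hcon
  push Not at hcon
  apply hne
  ext v
  exact le_antisymm (hcon v (Finset.mem_univ v)) (hx v)

variable {s}

theorem affine_nonneg_convexHull (f : (Fin n → ℝ) →ᵃ[ℝ] ℝ) (hf : ∀ v ∈ s, 0 ≤ f v) :
    ∀ x ∈ convexHull ℝ s, 0 ≤ f x := by
  have hc : Convex ℝ {x | 0 ≤ f x} := by
    intro x hx y hy a b ha hb hab
    show 0 ≤ f _
    rw [affine_combo f hab]
    exact add_nonneg (mul_nonneg ha hx) (mul_nonneg hb hy)
  exact fun x hx => convexHull_min (t := {x | 0 ≤ f x}) hf hc hx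

/-- The facet cut out by an extreme ray of the cone of nonnegative affine functions. -/
theorem facet_of_isRay [Fintype s] (hs : (convexHull ℝ s).Nontrivial)
    {φ : LinearMap.range (restr s)} (hφ : IsRay (evalAt s) (evalSum s) φ)
    {f : (Fin n → ℝ) →ᵃ[ℝ] ℝ} (hf : restr s f = φ) :
    {x ∈ convexHull ℝ s | f x = 0} ∈ facets (convexHull ℝ s) := by
  have hfv : ∀ v : s, f v = evalAt s v φ := fun v => congrFun hf v
  have hnn : ∀ x ∈ convexHull ℝ s, 0 ≤ f x :=
    affine_nonneg_convexHull f fun v hv => (hfv ⟨v, hv⟩) ▸ hφ.nonneg ⟨v, hv⟩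
  have hsn : s.Nontrivial := by
    by_contra hcon
    rw [Set.not_nontrivial_iff] at hcon
    refine (Set.not_nontrivial_iff.2 ?_) hs
    rcases hcon.eq_empty_or_singleton with h | ⟨a, h⟩ <;> simp [h]
  -- functions vanishing with `f` on `s` are multiples of `f` on `s`
  have hmul : ∀ g : (Fin n → ℝ) →ᵃ[ℝ] ℝ, (∀ v ∈ s, f v = 0 → g v = 0) →
      ∃ c : ℝ, ∀ v ∈ s, g v = c * f v := by
    intro g hg
    have := hφ.minimal ⟨restr s g, g, rfl⟩ fun v hv => hg v v.2 (by rw [hfv, hv])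
    refine ⟨evalSum s ⟨restr s g, g, rfl⟩, fun v hv => ?_⟩
    have h2 := congrArg (evalAt s ⟨v, hv⟩) this
    rw [map_smul, smul_eq_mul, ← hfv] at h2
    exact h2
  obtain ⟨w, hw, hfw⟩ : ∃ w ∈ s, f w = 0 := by
    by_contra hcon
    push Not at hcon
    obtain ⟨a, ha, b, hb, hab⟩ := hsn
    obtain ⟨i, hi⟩ := Function.ne_iff.1 hab
    -- If f vanished nowhere on s, every affine function would be a multiple of f there. Applied to
    -- the constant 1 this makes f constant on s; applied to a coordinate separating a and b it
    -- makes that coordinate constant too.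
    obtain ⟨c, hc⟩ := hmul (AffineMap.const ℝ _ 1) fun v hv h0 => absurd h0 (hcon v hv)
    obtain ⟨c', hc'⟩ := hmul (LinearMap.proj (R := ℝ) (φ := fun _ : Fin n => ℝ) i).toAffineMap
      fun v hv h0 => absurd h0 (hcon v hv)
    have h1 := hc a ha
    have h2 := hc b hb
    have h3 := hc' a ha
    have h4 := hc' b hb
    simp only [AffineMap.const_apply, LinearMap.coe_toAffineMap, LinearMap.proj_apply] at h1 h2 h3 h4
    apply hi
    have hc0 : c ≠ 0 := by rintro rfl; simp at h1
    have : f a = f b := mul_left_cancel₀ hc0 (h1.symm.trans h2)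
    rw [h3, h4, this]
  have hwQ := subset_convexHull ℝ s hw
  -- `f` is not constant
  obtain ⟨u, hu, hfu⟩ : ∃ u ∈ s, f u ≠ 0 := by
    by_contra hcon
    push Not at hcon
    apply hφ.ne_zero
    ext v
    exact (hfv v).symm.trans (hcon v v.2)
  have hfacet_sub : {x ∈ convexHull ℝ s | f x = 0} ⊆ convexHull ℝ s := fun x hx => hx.1
  refine ⟨fun _ => ⟨-(LinearMap.toContinuousLinearMap f.linear), ?_⟩, ⟨w, hwQ, hfw⟩, ?_⟩
  · have hval : ∀ x y, -(LinearMap.toContinuousLinearMap f.linear) y ≤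
        -(LinearMap.toContinuousLinearMap f.linear) x ↔ f x ≤ f y := by
      intro x y
      rw [neg_le_neg_iff]
      simp only [LinearMap.coe_toContinuousLinearMap']
      rw [← sub_nonneg, ← map_sub, affine_sub, sub_nonneg]
    ext x
    simp only [Set.mem_ofPred_eq]
    refine and_congr_right fun hx => ⟨fun h0 y hy => (hval x y).2 (h0 ▸ hnn y hy), fun h => ?_⟩
    exact le_antisymm (hfw ▸ (hval x w).1 (h w hwQ)) (hnn x hx)
  · let D := vectorSpan ℝ (convexHull ℝ s)
    let G := vectorSpan ℝ {x ∈ convexHull ℝ s | f x = 0}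
    have hGker : G ≤ LinearMap.ker f.linear := by
      show vectorSpan ℝ _ ≤ _
      rw [vectorSpan, Submodule.span_le]
      rintro _ ⟨a, ha, b, hb, rfl⟩
      show f.linear (a - b) = 0
      rw [affine_sub, ha.2, hb.2, sub_zero]
    -- A functional ψ that kills G but not y yields an affine function vanishing on s wherever f
    -- does. It is thus a multiple of f on s, so ψ is a multiple of `f.linear` on D and kills y
    -- after all.
    have hkerG : D ⊓ LinearMap.ker f.linear ≤ G := by
      rintro y ⟨hyD, hyk⟩
      by_contra hyG
      obtain ⟨ψ, hψy, hψG⟩ := Submodule.exists_le_ker_of_notMem hyG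
      let g : (Fin n → ℝ) →ᵃ[ℝ] ℝ := ψ.toAffineMap - AffineMap.const ℝ _ (ψ w)
      have hg : ∀ x, g x = ψ (x - w) := fun x => by simp [g]
      obtain ⟨c, hc⟩ := hmul g fun v hv h0 => by
        rw [hg]
        exact hψG (vsub_mem_vectorSpan ℝ ⟨subset_convexHull ℝ s hv, h0⟩ ⟨hwQ, hfw⟩)
      apply hψy
      have hDle : D ≤ LinearMap.ker (ψ - c • f.linear) := by
        show vectorSpan ℝ (convexHull ℝ s) ≤ _
        rw [← direction_affineSpan, affineSpan_convexHull, direction_affineSpan, vectorSpan,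
          Submodule.span_le]
        rintro _ ⟨a, ha, b, hb, rfl⟩
        show (ψ - c • f.linear) (a - b) = 0
        have h1 := hc a ha
        have h2 := hc b hb
        rw [hg, map_sub] at h1 h2
        simp only [LinearMap.sub_apply, LinearMap.smul_apply, smul_eq_mul, affine_sub, map_sub ψ]
        linarith
      have := hDle hyD
      rw [LinearMap.mem_ker, LinearMap.sub_apply, LinearMap.smul_apply,
        LinearMap.mem_ker.1 hyk, smul_zero, sub_zero] at this
      exact this
    have hGD : G ≤ D := vectorSpan_mono ℝ hfacet_sub
    have hG : G = D ⊓ LinearMap.ker f.linear := le_antisymm (le_inf hGD hGker) hkerG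
    let fD : D →ₗ[ℝ] ℝ := f.linear.domRestrict D
    have hsurj : Function.Surjective fD := by
      apply LinearMap.surjective
      intro h0
      have h1 : u - w ∈ D := vsub_mem_vectorSpan ℝ (subset_convexHull ℝ s hu) hwQ
      have h2 : f.linear (u - w) = 0 := LinearMap.congr_fun h0 ⟨u - w, h1⟩
      rw [affine_sub, hfw, sub_zero] at h2
      exact hfu h2
    have hrn := fD.finrank_range_add_finrank_ker
    rw [LinearMap.range_eq_top.2 hsurj, finrank_top, Module.finrank_self] at hrn
    have hker : Module.finrank ℝ (LinearMap.ker fD) = Module.finrank ℝ G := by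
      rw [hG, inf_comm]
      have : LinearMap.ker fD = (LinearMap.ker f.linear).comap D.subtype := rfl
      rw [this]
      have e := (Submodule.equivSubtypeMap D ((LinearMap.ker f.linear).comap D.subtype)).finrank_eq
      rw [e, Submodule.map_comap_subtype, inf_comm]
    show Module.finrank ℝ G + 1 = Module.finrank ℝ D
    omega

end Polytope

/-- The affine functions nonnegative on s, restricted to s, form a pointed cone. Its extreme rays
inject into the facets and generate the cone, so together with the equations of the affine hull they
describe Q: a hyperplane separating an outside point would be a positive combination of them.
Nontriviality is needed because for a single point the ray of constants cuts out no facet. -/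
theorem hRep_of_isPolytope {n k : ℕ} {Q : Set (Fin n → ℝ)} (hQ : IsPolytope Q)
    (hnt : Q.Nontrivial) (hk : size Q ≤ k) : HRep Q k := by
  classical
  obtain ⟨s, hs, rfl⟩ := hQ
  have : Fintype s := hs.fintype
  choose lift hlift using fun φ : LinearMap.range (restr s) => φ.2
  have hfin := finite_isRay (evalAt s) (evalSum s)
  let Z : Set ((Fin n → ℝ) →ᵃ[ℝ] ℝ) := {e | ∀ x ∈ convexHull ℝ s, e x = 0}
  refine ⟨Z, hfin.toFinset.image lift, ?_, ?_⟩
  · refine Finset.card_image_le.trans ?_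
    have h1 : {φ | IsRay (evalAt s) (evalSum s) φ}.encard ≤ (facets (convexHull ℝ s)).encard := by
      refine Set.encard_le_encard_of_injOn (f := fun φ => {x ∈ convexHull ℝ s | lift φ x = 0})
        (fun φ hφ => facet_of_isRay hnt hφ (hlift φ)) ?_
      intro φ hφ ψ hψ hEq
      refine (IsRay.eq_of_support hφ hψ fun v hv => ?_).symm
      have hvQ := subset_convexHull ℝ s v.2
      have : (v : Fin n → ℝ) ∈ {x ∈ convexHull ℝ s | lift φ x = 0} :=
        ⟨hvQ, (congrFun (hlift φ) v).trans hv⟩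
      simp only at hEq
      rw [hEq] at this
      exact (congrFun (hlift ψ) v).symm.trans this.2
    have h2 := h1.trans hk
    rw [hfin.encard_eq_coe_toFinset_card] at h2
    exact_mod_cast h2
  · apply Set.Subset.antisymm
    · intro x hx
      refine ⟨fun e he => he x hx, fun f hf => ?_⟩
      obtain ⟨φ, hφ, rfl⟩ := Finset.mem_image.1 hf
      rw [Set.Finite.mem_toFinset] at hφ
      refine affine_nonneg_convexHull _ (fun v hv => ?_) x hx
      have : lift φ v = evalAt s ⟨v, hv⟩ φ := congrFun (hlift φ) ⟨v, hv⟩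
      exact this ▸ hφ.nonneg ⟨v, hv⟩
    · rintro x ⟨hx1, hx2⟩
      -- The arbitrary choice of `lift` is harmless: two functions agreeing on s differ by one of
      -- the equations in Z, which hold at x.
      have huniq : ∀ f g : (Fin n → ℝ) →ᵃ[ℝ] ℝ, restr s f = restr s g → f x = g x := by
        intro f g hfg
        have : f - g ∈ Z := by
          have hv : ∀ v ∈ s, f v = g v := fun v hv => congrFun hfg ⟨v, hv⟩
          intro y hy
          refine le_antisymm ?_ ?_
          · have := affine_nonneg_convexHull (g - f) (fun v hvs => by simp [hv v hvs]) y hy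
            simp at this ⊢; linarith
          · exact affine_nonneg_convexHull (f - g) (fun v hvs => by simp [hv v hvs]) y hy
        have := hx1 _ this
        simp at this; linarith
      by_contra hxQ
      obtain ⟨l, u, hlx, hl⟩ := geometric_hahn_banach_point_closed (convex_convexHull ℝ s)
        (hs.isClosed_convexHull ℝ) hxQ
      let g : (Fin n → ℝ) →ᵃ[ℝ] ℝ :=
        (l : (Fin n → ℝ) →ₗ[ℝ] ℝ).toAffineMap - AffineMap.const ℝ _ u
      have hg : ∀ y, g y = l y - u := fun y => by simp [g]
      let γ : LinearMap.range (restr s) := ⟨restr s g, g, rfl⟩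
      have hγ : ∀ v, 0 ≤ evalAt s v γ := fun v => by
        show 0 ≤ g v
        rw [hg]; linarith [hl v (subset_convexHull ℝ s v.2)]
      obtain ⟨a, ha⟩ : s.Nonempty := by
        rw [← convexHull_nonempty_iff (𝕜 := ℝ)]; exact hnt.nonempty
      have hγ0 : γ ≠ 0 := by
        intro h0
        have : evalAt s ⟨a, ha⟩ γ = 0 := by rw [h0, map_zero]
        have h2 : g a = 0 := this
        rw [hg] at h2
        linarith [hl a (subset_convexHull ℝ s ha)]
      have hH := conePos_evalSum s γ hγ hγ0
      set H := evalSum s γ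
      have hmem := mem_convexHull_isRay (conePos_evalSum s) (x := H⁻¹ • γ)
        (by rw [map_smul, smul_eq_mul]; exact inv_mul_cancel₀ hH.ne')
        (fun v => by rw [map_smul]; exact mul_nonneg (inv_nonneg.2 hH.le) (hγ v))
      have hconv : Convex ℝ {φ : LinearMap.range (restr s) | 0 ≤ lift φ x} := by
        intro φ hφ ψ hψ b c hb hc _
        show 0 ≤ lift (b • φ + c • ψ) x
        rw [huniq (lift (b • φ + c • ψ)) (b • lift φ + c • lift ψ) (by
          rw [hlift, map_add, map_smul, map_smul, hlift, hlift]; rfl)]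
        exact add_nonneg (mul_nonneg hb hφ) (mul_nonneg hc hψ)
      have h3 : 0 ≤ lift (H⁻¹ • γ) x := convexHull_min (t := {φ | 0 ≤ lift φ x})
        (fun φ hφ => hx2 _ (Finset.mem_image_of_mem _ (by simpa using hφ))) hconv hmem
      rw [huniq (lift (H⁻¹ • γ)) (H⁻¹ • g) (by rw [hlift, map_smul]; rfl)] at h3
      have h4 : 0 ≤ H⁻¹ * g x := h3
      have h5 := nonneg_of_mul_nonneg_right h4 (inv_pos.2 hH)
      rw [hg] at h5
      linarith

/-! ### Homogenization: vertices as normalized extreme rays. -/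

section Homogenization

variable {V : Type*} [AddCommGroup V] [Module ℝ V]

/-- The linear function on `V × ℝ` extending an affine function on `V × {1}`. -/
def homog (f : V →ᵃ[ℝ] ℝ) : V × ℝ →ₗ[ℝ] ℝ :=
  f.linear.comp (LinearMap.fst ℝ V ℝ) + (f 0) • LinearMap.snd ℝ V ℝ

theorem homog_apply (f : V →ᵃ[ℝ] ℝ) (y : V) (c : ℝ) : homog f (y, c) = f.linear y + f 0 * c := by
  simp [homog]

theorem affine_eq (f : V →ᵃ[ℝ] ℝ) (x : V) : f x = f.linear x + f 0 := by
  have := affine_add f 0 x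
  rw [zero_add] at this
  linarith

@[simp] theorem homog_one (f : V →ᵃ[ℝ] ℝ) (x : V) : homog f (x, 1) = f x := by
  rw [homog_apply, affine_eq f x, mul_one]

/-- The cone over the solution set of a system of affine equations. -/
def coneSpace (S : Set (V →ᵃ[ℝ] ℝ)) : Submodule ℝ (V × ℝ) := ⨅ e ∈ S, LinearMap.ker (homog e)

theorem mem_coneSpace {S : Set (V →ᵃ[ℝ] ℝ)} {p : V × ℝ} :
    p ∈ coneSpace S ↔ ∀ e ∈ S, homog e p = 0 := by
  simp [coneSpace, Submodule.mem_iInf]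

/-- An affine function as a linear function on the cone. -/
def slack (S : Set (V →ᵃ[ℝ] ℝ)) (f : V →ᵃ[ℝ] ℝ) : coneSpace S →ₗ[ℝ] ℝ :=
  (homog f).comp (coneSpace S).subtype

/-- The height function on the cone. -/
def height (S : Set (V →ᵃ[ℝ] ℝ)) : coneSpace S →ₗ[ℝ] ℝ :=
  (LinearMap.snd ℝ V ℝ).comp (coneSpace S).subtype

/-- The projection of the cone to the base space. -/
def basePoint (S : Set (V →ᵃ[ℝ] ℝ)) : coneSpace S →ₗ[ℝ] V :=
  (LinearMap.fst ℝ V ℝ).comp (coneSpace S).subtype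

theorem slack_eq {S : Set (V →ᵃ[ℝ] ℝ)} (f : V →ᵃ[ℝ] ℝ) {p : coneSpace S} (hp : height S p = 1) :
    slack S f p = f (basePoint S p) := by
  obtain ⟨⟨y, c⟩, hpS⟩ := p
  have : c = 1 := hp
  subst this
  exact homog_one f y

theorem basePoint_mem {S : Set (V →ᵃ[ℝ] ℝ)} {p : coneSpace S} (hp : height S p = 1) :
    ∀ e ∈ S, e (basePoint S p) = 0 := by
  intro e he
  rw [← slack_eq e hp]
  exact mem_coneSpace.1 p.2 e he

theorem basePoint_injective {S : Set (V →ᵃ[ℝ] ℝ)} {p q : coneSpace S} (hp : height S p = 1)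
    (hq : height S q = 1) (h : basePoint S p = basePoint S q) : p = q :=
  Subtype.ext (Prod.ext h (hp.trans hq.symm))

theorem exists_basePoint {S : Set (V →ᵃ[ℝ] ℝ)} {x : V} (hx : ∀ e ∈ S, e x = 0) :
    ∃ p : coneSpace S, height S p = 1 ∧ basePoint S p = x :=
  ⟨⟨(x, 1), mem_coneSpace.2 fun e he => by rw [homog_one, hx e he]⟩, rfl, rfl⟩

variable {ι : Type*} {S : Set (V →ᵃ[ℝ] ℝ)} {s : ι → V →ᵃ[ℝ] ℝ} {Q : Set V}

theorem image_base (hQ : Q = {x | (∀ e ∈ S, e x = 0) ∧ ∀ i, 0 ≤ s i x}) :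
    basePoint S '' {p | height S p = 1 ∧ ∀ i, 0 ≤ slack S (s i) p} = Q := by
  rw [hQ]
  ext x
  constructor
  · rintro ⟨p, ⟨hp, hp'⟩, rfl⟩
    exact ⟨basePoint_mem hp, fun i => slack_eq (s i) hp ▸ hp' i⟩
  · rintro ⟨h1, h2⟩
    obtain ⟨p, hp, rfl⟩ := exists_basePoint h1
    exact ⟨p, ⟨hp, fun i => (slack_eq (s i) hp).symm ▸ h2 i⟩, rfl⟩

theorem image_isRay [Fintype ι] (hQ : Q = {x | (∀ e ∈ S, e x = 0) ∧ ∀ i, 0 ≤ s i x})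
    (hpos : ConePos (fun i => slack S (s i)) (height S)) :
    basePoint S '' {p | IsRay (fun i => slack S (s i)) (height S) p} = Q.extremePoints ℝ := by
  have hb := image_base hQ
  ext x
  constructor
  · rintro ⟨p, hp, rfl⟩
    refine ⟨hb ▸ ⟨p, ⟨hp.1, hp.2⟩, rfl⟩, ?_⟩
    intro a ha b hbm hab
    rw [← hb] at ha hbm
    obtain ⟨a, ha, rfl⟩ := ha
    obtain ⟨b, hbm, rfl⟩ := hbm
    obtain ⟨u, v, hu, hv, huv, huv'⟩ := hab
    rw [hp.extreme.2 ha hbm ⟨u, v, hu, hv, huv, ?_⟩]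
    refine basePoint_injective ?_ hp.1 ?_
    · simp [ha.1, hbm.1, huv]
    · simpa using huv'
  · intro hx
    have hxQ := hx.1
    rw [← hb] at hxQ
    obtain ⟨p, hp, rfl⟩ := hxQ
    refine ⟨p, isRay_of_extreme hpos ⟨hp, ?_⟩, rfl⟩
    rintro a ha b hbm ⟨u, v, hu, hv, huv, huv'⟩
    have ha' : basePoint S a ∈ Q := hb ▸ ⟨a, ha, rfl⟩
    have hb' : basePoint S b ∈ Q := hb ▸ ⟨b, hbm, rfl⟩
    refine basePoint_injective ha.1 hp.1 (hx.2 ha' hb' ⟨u, v, hu, hv, huv, ?_⟩)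
    rw [← huv']; simp

theorem injOn_basePoint {σ : ι → coneSpace S →ₗ[ℝ] ℝ} :
    Set.InjOn (basePoint S) {p | IsRay σ (height S) p} :=
  fun _ hp _ hq h => basePoint_injective hp.one hq.one h

end Homogenization

theorem eq_zero_of_ray_subset {n : ℕ} {Q : Set (Fin n → ℝ)} (hb : Bornology.IsBounded Q)
    {x w : Fin n → ℝ} (h : ∀ r : ℝ, 0 ≤ r → x + r • w ∈ Q) : w = 0 := by
  by_contra hw
  obtain ⟨C, hC⟩ := hb.exists_norm_le
  have hw' : 0 < ‖w‖ := norm_pos_iff.2 hw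
  have hC0 : 0 ≤ C := (norm_nonneg _).trans (hC _ (h 0 le_rfl))
  have h1 := hC _ (h ((C + ‖x‖ + 1) / ‖w‖) (by positivity))
  have h2 : ‖((C + ‖x‖ + 1) / ‖w‖) • w‖ = C + ‖x‖ + 1 := by
    rw [norm_smul, Real.norm_of_nonneg (by positivity), div_mul_cancel₀ _ hw'.ne']
  have h3 := norm_sub_le (x + ((C + ‖x‖ + 1) / ‖w‖) • w) x
  rw [add_sub_cancel_left, h2] at h3
  linarith

/-- If (y, c) is in the cone with c ≤ 0, then x + r (y - c x) stays in Q for all r ≥ 0 and every x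
in Q, so y = c x by boundedness. Two different points x force c = 0 and then y = 0. -/
theorem conePos_of_bounded {n : ℕ} {ι : Type*} {S : Set ((Fin n → ℝ) →ᵃ[ℝ] ℝ)}
    {s : ι → (Fin n → ℝ) →ᵃ[ℝ] ℝ} {Q : Set (Fin n → ℝ)}
    (hQ : Q = {x | (∀ e ∈ S, e x = 0) ∧ ∀ i, 0 ≤ s i x}) (hb : Bornology.IsBounded Q)
    (hnt : Q.Nontrivial) : ConePos (fun i => slack S (s i)) (height S) := by
  rintro ⟨⟨y, c⟩, hpS⟩ hp hne
  by_contra hc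
  have hc : c ≤ 0 := le_of_not_gt hc
  have key : ∀ x ∈ Q, y = c • x := by
    intro x hx
    refine sub_eq_zero.1 (eq_zero_of_ray_subset (x := x) hb fun r hr => ?_)
    have lin : ∀ f : (Fin n → ℝ) →ᵃ[ℝ] ℝ, f (x + r • (y - c • x)) =
        f x + r * (homog f (y, c) - c * f x) := by
      intro f
      rw [affine_add, map_smul, map_sub, map_smul, homog_apply, affine_eq f x, smul_eq_mul,
        smul_eq_mul]
      ring
    rw [hQ] at hx ⊢
    refine ⟨fun e he => ?_, fun i => ?_⟩
    · rw [lin, hx.1 e he, mem_coneSpace.1 hpS e he]; simp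
    · rw [lin]
      have h1 : 0 ≤ homog (s i) (y, c) := hp i
      have h2 := mul_nonneg (neg_nonneg.2 hc) (hx.2 i)
      have h3 := mul_nonneg hr (show 0 ≤ homog (s i) (y, c) - c * s i x by linarith)
      linarith [hx.2 i]
  obtain ⟨a, ha, b, hbQ, hab⟩ := hnt
  have h1 := (key a ha).symm.trans (key b hbQ)
  have hc0 : c = 0 := by
    by_contra hc0
    exact hab (smul_right_injective _ hc0 h1)
  apply hne
  have hy := key a ha
  rw [hc0, zero_smul] at hy
  exact Subtype.ext (Prod.ext hy hc0)

theorem HRep.fintype_form {V : Type*} [AddCommGroup V] [Module ℝ V] {Q : Set V} {k : ℕ}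
    (h : HRep Q k) : ∃ (S : Set (V →ᵃ[ℝ] ℝ)) (s : Fin k → V →ᵃ[ℝ] ℝ),
      Q = {x | (∀ e ∈ S, e x = 0) ∧ ∀ i, 0 ≤ s i x} := by
  obtain ⟨S, t, ht, rfl⟩ := h
  -- The list of inequalities is padded to length k by the trivial inequality 0 ≤ 0.
  refine ⟨S, fun i => if h : (i : ℕ) < t.card then (t.equivFin.symm ⟨i, h⟩ : V →ᵃ[ℝ] ℝ) else 0, ?_⟩
  ext x
  refine and_congr_right fun _ => ⟨fun h i => ?_, fun h f hf => ?_⟩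
  · dsimp only
    split_ifs with hi
    · exact h _ (t.equivFin.symm ⟨i, hi⟩).2
    · exact le_rfl
  · have hlt := (t.equivFin ⟨f, hf⟩).2
    have := h ⟨t.equivFin ⟨f, hf⟩, hlt.trans_le ht⟩
    simpa [hlt] using this

theorem HRep.of_fintype {V : Type*} [AddCommGroup V] [Module ℝ V] {Q : Set V} {ι : Type*}
    [Fintype ι] {S : Set (V →ᵃ[ℝ] ℝ)} {s : ι → V →ᵃ[ℝ] ℝ}
    (h : Q = {x | (∀ e ∈ S, e x = 0) ∧ ∀ i, 0 ≤ s i x}) : HRep Q (Fintype.card ι) := by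
  classical
  refine ⟨S, Finset.univ.image s, Finset.card_image_le, ?_⟩
  rw [h]; simp

theorem HRep.mono {V : Type*} [AddCommGroup V] [Module ℝ V] {Q : Set V} {k l : ℕ}
    (h : HRep Q k) (hkl : k ≤ l) : HRep Q l := by
  obtain ⟨S, t, ht, hQ⟩ := h
  exact ⟨S, t, ht.trans hkl, hQ⟩

theorem isPolytope_of_hRep {n k : ℕ} {Q : Set (Fin n → ℝ)} (h : HRep Q k)
    (hb : Bornology.IsBounded Q) (hnt : Q.Nontrivial) :
    (Q.extremePoints ℝ).Finite ∧ Q = convexHull ℝ (Q.extremePoints ℝ) := by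
  have hconv := h.convex
  obtain ⟨S, s, hQ⟩ := h.fintype_form
  have hpos := conePos_of_bounded hQ hb hnt
  have hi := image_isRay hQ hpos
  refine ⟨hi ▸ (finite_isRay _ _).image _, ?_⟩
  apply Set.Subset.antisymm
  · rw [← hi, ← LinearMap.image_convexHull]
    intro x hx
    rw [← image_base hQ] at hx
    obtain ⟨p, hp, rfl⟩ := hx
    exact ⟨p, mem_convexHull_isRay hpos hp.1 hp.2, rfl⟩
  · exact convexHull_min (fun x hx => hx.1) hconv

/-! ### Faces at the two ends of an affine function. -/

section Cut

variable {V : Type*} [AddCommGroup V] [Module ℝ V]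

open Classical in
/-- The inequalities that are tight on the face `g = 0` of `Q`, but not on `Q`. -/
noncomputable def tightOn (t : Finset (V →ᵃ[ℝ] ℝ)) (Q : Set V) (g : V →ᵃ[ℝ] ℝ) :
    Finset (V →ᵃ[ℝ] ℝ) :=
  t.filter fun f => (∀ x ∈ Q, g x = 0 → f x = 0) ∧ ∃ y ∈ Q, f y ≠ 0

theorem mem_tightOn {t : Finset (V →ᵃ[ℝ] ℝ)} {Q : Set V} {g f : V →ᵃ[ℝ] ℝ} :
    f ∈ tightOn t Q g ↔ f ∈ t ∧ (∀ x ∈ Q, g x = 0 → f x = 0) ∧ ∃ y ∈ Q, f y ≠ 0 := by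
  simp [tightOn]

/-- Inequalities that are constant on a slice can be dropped from its description. -/
theorem hRep_slice {S : Set (V →ᵃ[ℝ] ℝ)} {t K : Finset (V →ᵃ[ℝ] ℝ)} {Q : Set V}
    (hQ : Q = {x | (∀ e ∈ S, e x = 0) ∧ ∀ f ∈ t, 0 ≤ f x}) (g : V →ᵃ[ℝ] ℝ)
    (hK : K ⊆ t) (κ : (V →ᵃ[ℝ] ℝ) → ℝ) (hκ : ∀ f ∈ K, 0 ≤ κ f)
    (hconst : ∀ f ∈ K, ∀ x ∈ Q, g x = 0 → f x = κ f) :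
    HRep {x ∈ Q | g x = 0} (t.card - K.card) := by
  classical
  refine ⟨S ∪ {g} ∪ (fun f => f - AffineMap.const ℝ V (κ f)) '' (K : Set (V →ᵃ[ℝ] ℝ)), t \ K,
    (Finset.card_sdiff_of_subset hK).le, ?_⟩
  ext x
  constructor
  · rintro ⟨hx, hg⟩
    refine ⟨?_, ?_⟩
    · rintro e ((he | he) | ⟨f, hf, rfl⟩)
      · rw [hQ] at hx; exact hx.1 e he
      · rw [Set.mem_singleton_iff] at he; rw [he, hg]
      · simp [hconst f hf x hx hg]
    · intro f hf
      rw [hQ] at hx; exact hx.2 f (Finset.mem_sdiff.1 hf).1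
  · rintro ⟨h1, h2⟩
    refine ⟨?_, h1 g (by simp)⟩
    rw [hQ]
    refine ⟨fun e he => h1 e (by simp [he]), fun f hf => ?_⟩
    by_cases hfK : f ∈ K
    · have := h1 (f - AffineMap.const ℝ V (κ f)) (Or.inr ⟨f, hfK, rfl⟩)
      simp [sub_eq_zero] at this
      rw [this]; exact hκ f hfK
    · exact h2 f (Finset.mem_sdiff.2 ⟨hf, hfK⟩)

/-- Without an inequality cutting out the face g = 0, one could step from its relative interior away
from any point of Q and make g negative. If a single f cuts it out, every direction leaving f
unchanged also leaves g unchanged, so f and g are proportional on Q. -/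
theorem tightOn_spec {S : Set (V →ᵃ[ℝ] ℝ)} {t : Finset (V →ᵃ[ℝ] ℝ)} {Q : Set V}
    (hQ : Q = {x | (∀ e ∈ S, e x = 0) ∧ ∀ f ∈ t, 0 ≤ f x}) {g : V →ᵃ[ℝ] ℝ}
    (hg : ∀ x ∈ Q, 0 ≤ g x) (h0 : ∃ x ∈ Q, g x = 0) (h1 : ∃ x ∈ Q, g x ≠ 0) :
    (tightOn t Q g).Nonempty ∧ ∀ f, tightOn t Q g = {f} →
      ∃ c : ℝ, 0 < c ∧ ∀ x ∈ Q, f x = c * g x := by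
  have hconv : Convex ℝ Q := hQ ▸ convex_solutions S t
  have memS : ∀ x ∈ Q, ∀ e ∈ S, e x = 0 := fun x hx => by rw [hQ] at hx; exact hx.1
  have memt : ∀ x ∈ Q, ∀ f ∈ t, 0 ≤ f x := fun x hx => by rw [hQ] at hx; exact hx.2
  have hC : Convex ℝ {x ∈ Q | g x = 0} := by
    rintro x ⟨hx, hx'⟩ y ⟨hy, hy'⟩ a b ha hb hab
    exact ⟨hconv hx hy ha hb hab, by rw [affine_combo g hab, hx', hy']; simp⟩
  obtain ⟨z, ⟨hz, hgz⟩, hzt⟩ := exists_relint hC (by obtain ⟨x, hx, hx'⟩ := h0; exact ⟨x, hx, hx'⟩) t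
    fun f hf x hx => memt x hx.1 f hf
  have tight : ∀ f ∈ t, f ∉ tightOn t Q g → f z = 0 → ∀ x ∈ Q, f x = 0 := by
    intro f hf hfJ hfz x hx
    by_contra hfx
    exact hfJ (mem_tightOn.2 ⟨hf, fun y hy hy' => hzt f hf hfz y ⟨hy, hy'⟩, x, hx, hfx⟩)
  -- moving from `z` in a direction along which the tight inequalities do not decrease
  have move : ∀ w : V, (∀ e ∈ S, e.linear w = 0) → (∀ f ∈ tightOn t Q g, 0 ≤ f.linear w) →
      (∀ f ∈ t, (∀ x ∈ Q, f x = 0) → f.linear w = 0) → 0 ≤ g.linear w := by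
    intro w hw1 hw2 hw3
    obtain ⟨ε, hε, hmem⟩ := exists_push (w := w) (memS z hz) (memt z hz) hw1 (fun f hf hfz => by
      by_cases hfJ : f ∈ tightOn t Q g
      · exact hw2 f hfJ
      · exact (hw3 f hf (tight f hf hfJ hfz)).ge)
    rw [← hQ] at hmem
    have := hg _ hmem
    rw [affine_add, hgz, zero_add, map_smul, smul_eq_mul] at this
    exact nonneg_of_mul_nonneg_right this hε
  obtain ⟨y, hy, hgy⟩ := h1
  refine ⟨?_, fun f hf => ?_⟩
  · by_contra hcon
    rw [Finset.not_nonempty_iff_eq_empty] at hcon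
    have := move (z - y) (fun e he => by rw [affine_sub, memS z hz e he, memS y hy e he, sub_zero])
      (by rw [hcon]; simp) (fun f hf h0 => by rw [affine_sub, h0 z hz, h0 y hy, sub_zero])
    rw [affine_sub, hgz, zero_sub] at this
    exact hgy (le_antisymm (by linarith) (hg y hy))
  · have hfJ : f ∈ tightOn t Q g := by rw [hf]; simp
    obtain ⟨hft, hf0, x₀, hx₀, hfx₀⟩ := mem_tightOn.1 hfJ
    have hfz : f z = 0 := hf0 z hz hgz
    -- The direction f(x')(x - z) - f(x)(x' - z) leaves f unchanged, hence cannot decrease g;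
    -- exchanging x and x' gives the equality `prop`.
    have half : ∀ x ∈ Q, ∀ x' ∈ Q, f x * g x' ≤ f x' * g x := by
      intro x hx x' hx'
      have lin : ∀ e : V →ᵃ[ℝ] ℝ, e.linear (f x' • (x - z) - f x • (x' - z)) =
          f x' * (e x - e z) - f x * (e x' - e z) := by
        intro e; rw [map_sub, map_smul, map_smul, affine_sub, affine_sub]; rfl
      have := move (f x' • (x - z) - f x • (x' - z))
        (fun e he => by rw [lin, memS x hx e he, memS x' hx' e he, memS z hz e he]; ring)
        (by
          rw [hf]; intro f' hf'
          rw [Finset.mem_singleton] at hf'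
          rw [hf', lin, hfz]; apply le_of_eq; ring)
        (fun e _ h0 => by rw [lin, h0 x hx, h0 x' hx', h0 z hz]; ring)
      rw [lin, hgz] at this
      linarith
    have prop : ∀ x ∈ Q, f x * g y = f y * g x := fun x hx =>
      le_antisymm (half x hx y hy) (half y hy x hx)
    have hgy' : 0 < g y := lt_of_le_of_ne (hg y hy) (Ne.symm hgy)
    have hfy : f y ≠ 0 := by
      intro h
      have := prop x₀ hx₀
      rw [h, zero_mul] at this
      exact hfx₀ ((mul_eq_zero.1 this).resolve_right hgy)
    have hfy' : 0 < f y := lt_of_le_of_ne (memt y hy f hft) (Ne.symm hfy)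
    refine ⟨f y / g y, div_pos hfy' hgy', fun x hx => ?_⟩
    have := prop x hx
    field_simp
    linarith

/-- On the slice g = 0 all inequalities of `tightOn t Q g` are identically zero and can be dropped.
If a single inequality cuts out the opposite face, it is a multiple c (1 - g) and takes the constant
value c on this slice, so it can be dropped as well. -/
theorem hRep_cut_aux {S : Set (V →ᵃ[ℝ] ℝ)} {t : Finset (V →ᵃ[ℝ] ℝ)} {Q : Set V}
    (hQ : Q = {x | (∀ e ∈ S, e x = 0) ∧ ∀ f ∈ t, 0 ≤ f x}) {g g' : V →ᵃ[ℝ] ℝ}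
    (hgg : ∀ x, g' x = 1 - g x) (h0 : ∃ x ∈ Q, g x = 0)
    (hprop : ∀ f, tightOn t Q g' = {f} → ∃ c : ℝ, 0 < c ∧ ∀ x ∈ Q, f x = c * g' x) :
    HRep {x ∈ Q | g x = 0}
      (t.card - ((tightOn t Q g).card + if (tightOn t Q g').card = 1 then 1 else 0)) := by
  classical
  split_ifs with hcard
  · obtain ⟨f, hf⟩ := Finset.card_eq_one.1 hcard
    obtain ⟨c, hc, hfc⟩ := hprop f hf
    have hft : f ∈ t := (mem_tightOn.1 (by rw [hf]; simp : f ∈ tightOn t Q g')).1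
    have hfn : f ∉ tightOn t Q g := by
      intro hmem
      obtain ⟨x, hx, hgx⟩ := h0
      have h1 := (mem_tightOn.1 hmem).2.1 x hx hgx
      rw [hfc x hx, hgg, hgx] at h1
      linarith
    rw [← Finset.card_insert_of_notMem hfn]
    refine hRep_slice hQ g ?_ (fun f' => if f' = f then c else 0) ?_ ?_
    · intro f' hf'
      rcases Finset.mem_insert.1 hf' with rfl | hf'
      · exact hft
      · exact (mem_tightOn.1 hf').1
    · intro f' _; split_ifs
      · exact hc.le
      · exact le_rfl
    · intro f' hf' x hx hgx
      by_cases h : f' = f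
      · subst h; simp [hfc x hx, hgg, hgx]
      · simp only [h, if_false]
        exact (mem_tightOn.1 (Finset.mem_of_mem_insert_of_ne hf' h)).2.1 x hx hgx
  · rw [add_zero]
    exact hRep_slice hQ g (fun f hf => (mem_tightOn.1 hf).1) (fun _ => 0) (fun _ _ => le_rfl)
      fun f hf x hx hgx => (mem_tightOn.1 hf).2.1 x hx hgx

/-- Cutting a polyhedron by two opposite faces saves two inequalities on both, or three on one. -/
theorem HRep.cut {Q : Set V} {k : ℕ} (h : HRep Q k) {g : V →ᵃ[ℝ] ℝ}
    (hg : ∀ x ∈ Q, 0 ≤ g x ∧ g x ≤ 1) (h0 : ∃ x ∈ Q, g x = 0) (h1 : ∃ x ∈ Q, g x = 1) :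
    (∃ l, l + 2 ≤ k ∧ HRep {x ∈ Q | g x = 0} l ∧ HRep {x ∈ Q | g x = 1} l) ∨
      ∃ l, l + 3 ≤ k ∧ (HRep {x ∈ Q | g x = 0} l ∨ HRep {x ∈ Q | g x = 1} l) := by
  obtain ⟨S, t, ht, hQ⟩ := h
  let g' : V →ᵃ[ℝ] ℝ := AffineMap.const ℝ V 1 - g
  have hg' : ∀ x, g' x = 1 - g x := fun x => rfl
  have e : {x ∈ Q | g x = 1} = {x ∈ Q | g' x = 0} := by
    ext x
    simp only [Set.mem_ofPred_eq, hg', sub_eq_zero, eq_comm (a := (1 : ℝ))]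
  obtain ⟨n0, p0⟩ := tightOn_spec hQ (g := g) (fun x hx => (hg x hx).1) h0
    (by obtain ⟨x, hx, h⟩ := h1; exact ⟨x, hx, by rw [h]; norm_num⟩)
  obtain ⟨n1, p1⟩ := tightOn_spec hQ (g := g') (fun x hx => by rw [hg']; linarith [(hg x hx).2])
    (by obtain ⟨x, hx, h⟩ := h1; exact ⟨x, hx, by rw [hg', h]; norm_num⟩)
    (by obtain ⟨x, hx, h⟩ := h0; exact ⟨x, hx, by rw [hg', h]; norm_num⟩)
  have r0 := hRep_cut_aux hQ hg' h0 p1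
  have r1 := hRep_cut_aux hQ (g := g') (g' := g) (fun x => by rw [hg']; ring)
    (by obtain ⟨x, hx, h⟩ := h1; exact ⟨x, hx, by rw [hg', h]; norm_num⟩) p0
  rw [← e] at r1
  have c0 := n0.card_pos
  have c1 := n1.card_pos
  have l0 : (tightOn t Q g).card ≤ t.card :=
    Finset.card_le_card fun f hf => (mem_tightOn.1 hf).1
  have l1 : (tightOn t Q g').card ≤ t.card :=
    Finset.card_le_card fun f hf => (mem_tightOn.1 hf).1
  -- Disjointness bounds the sum of the two cardinalities by that of t, so that the truncated
  -- subtractions of 2 or 3 below are genuine.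
  have hdis : Disjoint (tightOn t Q g) (tightOn t Q g') ∨
      ((tightOn t Q g).card ≠ 1 ∧ (tightOn t Q g').card ≠ 1) := by
    by_cases a0 : (tightOn t Q g).card = 1
    · left
      obtain ⟨f, hf⟩ := Finset.card_eq_one.1 a0
      obtain ⟨c, hc, hfc⟩ := p0 f hf
      rw [hf, Finset.disjoint_singleton_left]
      intro hmem
      obtain ⟨x, hx, hgx⟩ := h1
      have := (mem_tightOn.1 hmem).2.1 x hx (by rw [hg', hgx]; norm_num)
      rw [hfc x hx, hgx] at this
      linarith
    by_cases a1 : (tightOn t Q g').card = 1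
    · left
      obtain ⟨f, hf⟩ := Finset.card_eq_one.1 a1
      obtain ⟨c, hc, hfc⟩ := p1 f hf
      rw [hf, Finset.disjoint_singleton_right]
      intro hmem
      obtain ⟨x, hx, hgx⟩ := h0
      have := (mem_tightOn.1 hmem).2.1 x hx hgx
      rw [hfc x hx, hg', hgx] at this
      linarith
    · exact Or.inr ⟨a0, a1⟩
  have hsum : (tightOn t Q g).card + (tightOn t Q g').card ≤ t.card ∨
      ((tightOn t Q g).card ≠ 1 ∧ (tightOn t Q g').card ≠ 1) := by
    refine hdis.imp_left fun hd => ?_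
    classical
    rw [← Finset.card_union_of_disjoint hd]
    exact Finset.card_le_card (Finset.union_subset (fun f hf => (mem_tightOn.1 hf).1)
      fun f hf => (mem_tightOn.1 hf).1)
  -- One inequality at each end: each slice saves its own and the opposite one. One at one end and
  -- several at the other: the latter slice saves at least 2 + 1. Several at both ends: each slice
  -- saves at least two.
  by_cases a0 : (tightOn t Q g).card = 1 <;> by_cases a1 : (tightOn t Q g').card = 1
  · left
    refine ⟨t.card - 2, by omega, r0.mono ?_, r1.mono ?_⟩
    · rw [if_pos a1]; omega
    · rw [if_pos a0]; omega
  · right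
    refine ⟨t.card - 3, by omega, Or.inr (r1.mono ?_)⟩
    rw [if_pos a0]; omega
  · right
    refine ⟨t.card - 3, by omega, Or.inl (r0.mono ?_)⟩
    rw [if_pos a1]; omega
  · left
    refine ⟨t.card - 2, by omega, r0.mono ?_, r1.mono ?_⟩ <;> omega

end Cut

/-! ### Induction on the dimension of the cube. -/

theorem mem_prodCube_succ {P : Set (Fin 2 → ℝ)} {d : ℕ} {x : Fin (2 + d + 1) → ℝ} :
    x ∈ prodCube P (d + 1) ↔
      (fun i : Fin (2 + d) => x i.castSucc) ∈ prodCube P d ∧ x (Fin.last (2 + d)) ∈ Set.Icc (0 : ℝ) 1 := by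
  constructor
  · rintro ⟨h1, h2⟩
    exact ⟨⟨h1, fun j => h2 j.castSucc⟩, h2 (Fin.last d)⟩
  · rintro ⟨⟨h1, h2⟩, h3⟩
    exact ⟨h1, fun j => Fin.lastCases h3 h2 j⟩

/-- Forgetting the last coordinate. -/
def dropLast (m : ℕ) : (Fin (m + 1) → ℝ) →ₗ[ℝ] (Fin m → ℝ) := LinearMap.funLeft ℝ ℝ Fin.castSucc

section Induction

variable {P : Set (Fin 2 → ℝ)} {d N : ℕ} {Q : Set (Fin N → ℝ)}
  {π : (Fin N → ℝ) →ₗ[ℝ] (Fin (2 + d + 1) → ℝ)}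

/-- The last coordinate of the image under `π`. -/
def lastCoord (π : (Fin N → ℝ) →ₗ[ℝ] (Fin (2 + d + 1) → ℝ)) : (Fin N → ℝ) →ᵃ[ℝ] ℝ :=
  ((LinearMap.proj (Fin.last (2 + d))).comp π).toAffineMap

theorem lastCoord_apply (v : Fin N → ℝ) : lastCoord π v = π v (Fin.last (2 + d)) := rfl

theorem lastCoord_mem (hπ : π '' Q = prodCube P (d + 1)) {v : Fin N → ℝ} (hv : v ∈ Q) :
    0 ≤ lastCoord π v ∧ lastCoord π v ≤ 1 := by
  have : π v ∈ prodCube P (d + 1) := hπ ▸ ⟨v, hv, rfl⟩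
  exact (mem_prodCube_succ.1 this).2

theorem image_slice (hπ : π '' Q = prodCube P (d + 1)) {c : ℝ} (hc : c ∈ Set.Icc (0 : ℝ) 1) :
    (dropLast (2 + d) ∘ₗ π) '' {x ∈ Q | lastCoord π x = c} = prodCube P d := by
  ext y
  constructor
  · rintro ⟨x, ⟨hx, -⟩, rfl⟩
    have : π x ∈ prodCube P (d + 1) := hπ ▸ ⟨x, hx, rfl⟩
    exact (mem_prodCube_succ.1 this).1
  · intro hy
    have : (Fin.snoc y c : Fin (2 + d + 1) → ℝ) ∈ prodCube P (d + 1) := by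
      rw [mem_prodCube_succ]; simpa using ⟨hy, hc⟩
    rw [← hπ] at this
    obtain ⟨x, hx, hxy⟩ := this
    refine ⟨x, ⟨hx, ?_⟩, ?_⟩
    · rw [lastCoord_apply, hxy, Fin.snoc_last]
    · funext i
      show π x i.castSucc = y i
      rw [hxy, Fin.snoc_castSucc]

theorem exists_slice (hP : P.Nonempty) (hπ : π '' Q = prodCube P (d + 1)) {c : ℝ}
    (hc : c ∈ Set.Icc (0 : ℝ) 1) : ∃ x ∈ Q, lastCoord π x = c := by
  have h := image_slice hπ hc
  have hne : (prodCube P d).Nonempty := by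
    obtain ⟨p, hp⟩ := hP
    refine ⟨Fin.append p (fun _ => 0), ?_, fun j => ?_⟩
    · simpa using hp
    · simp
  rw [← h] at hne
  obtain ⟨_, x, hx, -⟩ := hne
  exact ⟨x, hx⟩

theorem extremePoints_slice {c : ℝ} (hc : (∀ x ∈ Q, c ≤ lastCoord π x) ∨ ∀ x ∈ Q, lastCoord π x ≤ c) :
    Set.extremePoints ℝ {x ∈ Q | lastCoord π x = c} = {x ∈ Q.extremePoints ℝ | lastCoord π x = c} := by
  ext v
  constructor
  · rintro ⟨⟨hv, hvc⟩, hext⟩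
    refine ⟨⟨hv, ?_⟩, hvc⟩
    rintro a ha b hb ⟨s, t, hs, ht, hst, rfl⟩
    rw [affine_combo _ hst] at hvc
    have h1 : s * (lastCoord π a - c) + t * (lastCoord π b - c) = 0 := by
      have : (s + t) * c = c := by rw [hst, one_mul]
      linarith
    have h2 : lastCoord π a = c ∧ lastCoord π b = c := by
      rcases hc with hc | hc
      · have i1 := mul_nonneg hs.le (sub_nonneg.2 (hc a ha))
        have i2 := mul_nonneg ht.le (sub_nonneg.2 (hc b hb))
        constructor
        · have : s * (lastCoord π a - c) = 0 := by linarith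
          simpa [hs.ne', sub_eq_zero] using this
        · have : t * (lastCoord π b - c) = 0 := by linarith
          simpa [ht.ne', sub_eq_zero] using this
      · have i1 := mul_nonneg hs.le (sub_nonneg.2 (hc a ha))
        have i2 := mul_nonneg ht.le (sub_nonneg.2 (hc b hb))
        constructor
        · have : s * (lastCoord π a - c) = 0 := by linarith
          simpa [hs.ne', sub_eq_zero] using this
        · have : t * (lastCoord π b - c) = 0 := by linarith
          simpa [ht.ne', sub_eq_zero] using this
    exact hext ⟨ha, h2.1⟩ ⟨hb, h2.2⟩ ⟨s, t, hs, ht, hst, rfl⟩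
  · rintro ⟨hv, hvc⟩
    exact ⟨⟨hv.1, hvc⟩, fun a ha b hb hab => hv.2 ha.1 hb.1 hab⟩

/-- Used contrapositively: a vertex of a slice that is hidden over the smaller product is hidden
over the larger one. -/
theorem dropLast_mem_vertices {x : Fin (2 + d + 1) → ℝ} (hx : x ∈ vertices (prodCube P (d + 1))) :
    dropLast (2 + d) x ∈ vertices (prodCube P d) := by
  have hx1 := mem_prodCube_succ.1 hx.1
  refine ⟨hx1.1, ?_⟩
  rintro a ha b hb ⟨s, t, hs, ht, hst, hab⟩
  have mem : ∀ y ∈ prodCube P d, (Fin.snoc y (x (Fin.last (2 + d))) : Fin (2 + d + 1) → ℝ) ∈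
      prodCube P (d + 1) := fun y hy => by rw [mem_prodCube_succ]; simpa using ⟨hy, hx1.2⟩
  have comb : s • (Fin.snoc a (x (Fin.last (2 + d))) : Fin (2 + d + 1) → ℝ) +
      t • (Fin.snoc b (x (Fin.last (2 + d))) : Fin (2 + d + 1) → ℝ) = x := by
    ext i
    refine Fin.lastCases (n := 2 + d) ?_ (fun i => ?_) i
    · rw [Pi.add_apply, Pi.smul_apply, Pi.smul_apply, Fin.snoc_last, Fin.snoc_last, ← add_smul, hst,
        one_smul]
    · rw [Pi.add_apply, Pi.smul_apply, Pi.smul_apply, Fin.snoc_castSucc, Fin.snoc_castSucc]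
      exact congrFun hab i
  have key := hx.2 (mem a ha) (mem b hb) ⟨s, t, hs, ht, hst, comb⟩
  funext i
  have := congrFun key i.castSucc
  rwa [Fin.snoc_castSucc] at this

theorem not_mem_vertices_of_mid {x : Fin (2 + d + 1) → ℝ} (h0 : x (Fin.last (2 + d)) ≠ 0)
    (h1 : x (Fin.last (2 + d)) ≠ 1) : x ∉ vertices (prodCube P (d + 1)) := by
  intro hx
  have hx1 := mem_prodCube_succ.1 hx.1
  set c := x (Fin.last (2 + d)) with hc
  have hc0 : 0 < c := lt_of_le_of_ne hx1.2.1 (Ne.symm h0)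
  have hc1 : c < 1 := lt_of_le_of_ne hx1.2.2 h1
  set y : Fin (2 + d) → ℝ := fun i => x i.castSucc with hy
  have mem : ∀ r ∈ Set.Icc (0 : ℝ) 1, (Fin.snoc y r : Fin (2 + d + 1) → ℝ) ∈
      prodCube P (d + 1) := fun r hr => by rw [mem_prodCube_succ]; simpa using ⟨hx1.1, hr⟩
  have key := hx.2 (mem 0 (by simp)) (mem 1 (by simp)) ⟨1 - c, c, by linarith, hc0, by ring, by
    funext i
    refine Fin.lastCases ?_ (fun i => ?_) i
    · simp [hc]
    · simp only [Pi.add_apply, Pi.smul_apply, Fin.snoc_castSucc, smul_eq_mul, hy]; ring⟩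
  have := congrFun key (Fin.last (2 + d))
  rw [Fin.snoc_last] at this
  exact h0 this.symm

end Induction

theorem prodCube_nontrivial {P : Set (Fin 2 → ℝ)} (hP : P.Nontrivial) (d : ℕ) :
    (prodCube P d).Nontrivial := by
  obtain ⟨a, ha, b, hb, hab⟩ := hP
  have mem : ∀ p ∈ P, (Fin.append p (fun _ => 0) : Fin (2 + d) → ℝ) ∈ prodCube P d := by
    intro p hp
    refine ⟨by simpa using hp, fun j => by simp⟩
  refine ⟨_, mem a ha, _, mem b hb, fun h => hab ?_⟩
  funext i
  simpa using congrFun h (Fin.castAdd d i)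

theorem nontrivial_of_image {α β : Type*} {f : α → β} {Q : Set α} {R : Set β} (h : f '' Q = R)
    (hR : R.Nontrivial) : Q.Nontrivial := by
  rw [← h] at hR
  obtain ⟨_, ⟨a, ha, rfl⟩, _, ⟨b, hb, rfl⟩, hab⟩ := hR
  exact ⟨a, ha, b, hb, fun h => hab (h ▸ rfl)⟩

/-- A description by 5 + 2(d+1) inequalities would, after a cut, leave a slice over the smaller
product with at most 5 + 2d. -/
theorem not_hRep_prodCube {P : Set (Fin 2 → ℝ)} (hP : P.Nontrivial)
    (base : ∀ (N : ℕ) (Q : Set (Fin N → ℝ)) (π : (Fin N → ℝ) →ₗ[ℝ] (Fin 2 → ℝ)),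
      Bornology.IsBounded Q → π '' Q = P → ¬ HRep Q 5) (d : ℕ) :
    ∀ (N : ℕ) (Q : Set (Fin N → ℝ)) (π : (Fin N → ℝ) →ₗ[ℝ] (Fin (2 + d) → ℝ)),
      Bornology.IsBounded Q → π '' Q = prodCube P d → ¬ HRep Q (5 + 2 * d) := by
  induction d with
  | zero =>
    intro N Q π hb hπ h
    refine base N Q π hb ?_ h
    rw [hπ]
    ext x
    exact ⟨fun hx => hx.1, fun hx => ⟨hx, fun j => j.elim0⟩⟩
  | succ d ih =>
    intro N Q π hb hπ h
    have I0 : (0 : ℝ) ∈ Set.Icc (0 : ℝ) 1 := by simp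
    have I1 : (1 : ℝ) ∈ Set.Icc (0 : ℝ) 1 := by simp
    have no : ∀ c ∈ Set.Icc (0 : ℝ) 1, ∀ l ≤ 5 + 2 * d, ¬ HRep {x ∈ Q | lastCoord π x = c} l :=
      fun c hc l hl hr => ih N _ (dropLast (2 + d) ∘ₗ π) (hb.subset fun x hx => hx.1)
        (image_slice hπ hc) (hr.mono hl)
    rcases h.cut (g := lastCoord π) (fun x hx => lastCoord_mem hπ hx)
      (exists_slice hP.nonempty hπ I0) (exists_slice hP.nonempty hπ I1) with
      ⟨l, hl, h0, h1⟩ | ⟨l, hl, h0 | h1⟩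
    · exact no 0 I0 l (by omega) h0
    · exact no 0 I0 l (by omega) h0
    · exact no 1 I1 l (by omega) h1

/-- A saving of three on one slice is excluded by `not_hRep_prodCube`, so both end slices fall under
the induction hypothesis. Vertices in neither slice are hidden and only help. -/
theorem card_le_hidden {P : Set (Fin 2 → ℝ)} (hP : P.Nontrivial)
    (base5 : ∀ (N : ℕ) (Q : Set (Fin N → ℝ)) (π : (Fin N → ℝ) →ₗ[ℝ] (Fin 2 → ℝ)),
      Bornology.IsBounded Q → π '' Q = P → ¬ HRep Q 5)
    (base6 : ∀ (N : ℕ) (Q : Set (Fin N → ℝ)) (π : (Fin N → ℝ) →ₗ[ℝ] (Fin 2 → ℝ)),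
      Bornology.IsBounded Q → π '' Q = P → HRep Q 6 →
      (Q.extremePoints ℝ).ncard ≤ 9 * {v ∈ Q.extremePoints ℝ | π v ∉ vertices P}.ncard) (d : ℕ) :
    ∀ (N : ℕ) (Q : Set (Fin N → ℝ)) (π : (Fin N → ℝ) →ₗ[ℝ] (Fin (2 + d) → ℝ)),
      Bornology.IsBounded Q → π '' Q = prodCube P d → HRep Q (6 + 2 * d) →
      (Q.extremePoints ℝ).ncard ≤
        9 * {v ∈ Q.extremePoints ℝ | π v ∉ vertices (prodCube P d)}.ncard := by
  induction d with
  | zero =>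
    intro N Q π hb hπ h
    have e : prodCube P 0 = P := by
      ext x
      exact ⟨fun hx => hx.1, fun hx => ⟨hx, fun j => j.elim0⟩⟩
    rw [e] at hπ ⊢
    exact base6 N Q π hb hπ h
  | succ d ih =>
    intro N Q π hb hπ h
    have I0 : (0 : ℝ) ∈ Set.Icc (0 : ℝ) 1 := by simp
    have I1 : (1 : ℝ) ∈ Set.Icc (0 : ℝ) 1 := by simp
    have hnt := nontrivial_of_image hπ (prodCube_nontrivial hP (d + 1))
    have hfin := (isPolytope_of_hRep h hb hnt).1
    have no : ∀ c ∈ Set.Icc (0 : ℝ) 1, ∀ l ≤ 5 + 2 * d, ¬ HRep {x ∈ Q | lastCoord π x = c} l :=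
      fun c hc l hl hr => not_hRep_prodCube hP base5 d N _ (dropLast (2 + d) ∘ₗ π)
        (hb.subset fun x hx => hx.1) (image_slice hπ hc) (hr.mono hl)
    obtain ⟨l, hl, h0, h1⟩ : ∃ l, l + 2 ≤ 6 + 2 * (d + 1) ∧
        HRep {x ∈ Q | lastCoord π x = 0} l ∧ HRep {x ∈ Q | lastCoord π x = 1} l := by
      rcases h.cut (g := lastCoord π) (fun x hx => lastCoord_mem hπ hx)
        (exists_slice hP.nonempty hπ I0) (exists_slice hP.nonempty hπ I1) with
        h | ⟨l, hl, h0 | h1⟩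
      · exact h
      · exact absurd h0 (no 0 I0 l (by omega))
      · exact absurd h1 (no 1 I1 l (by omega))
    set X := Q.extremePoints ℝ with hX
    set H := {v ∈ X | π v ∉ vertices (prodCube P (d + 1))} with hH
    have part : ∀ c ∈ Set.Icc (0 : ℝ) 1, HRep {x ∈ Q | lastCoord π x = c} l →
        ((∀ x ∈ Q, c ≤ lastCoord π x) ∨ ∀ x ∈ Q, lastCoord π x ≤ c) →
        {x ∈ X | lastCoord π x = c}.ncard ≤ 9 * {x ∈ H | lastCoord π x = c}.ncard := by
      intro c hc hr hs
      have := ih N _ (dropLast (2 + d) ∘ₗ π) (hb.subset fun x hx => hx.1) (image_slice hπ hc)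
        (hr.mono (by omega))
      rw [extremePoints_slice hs] at this
      refine this.trans (Nat.mul_le_mul_left _ (Set.ncard_le_ncard ?_ ?_))
      · rintro v ⟨⟨hv, hvc⟩, hv'⟩
        exact ⟨⟨hv, fun hmem => hv' (dropLast_mem_vertices hmem)⟩, hvc⟩
      · exact (hfin.subset fun x hx => hx.1).subset fun x hx => hx.1
    have k0 := part 0 I0 h0 (Or.inl fun x hx => (lastCoord_mem hπ hx).1)
    have k1 := part 1 I1 h1 (Or.inr fun x hx => (lastCoord_mem hπ hx).2)
    have hHfin : H.Finite := hfin.subset fun x hx => hx.1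
    -- The same partition by last coordinate 0, 1 or neither is applied to all vertices and to the
    -- hidden ones; the third parts coincide.
    have split : ∀ Y : Set (Fin N → ℝ), Y.Finite → Y.ncard =
        {x ∈ Y | lastCoord π x = 0}.ncard + {x ∈ Y | lastCoord π x = 1}.ncard +
        {x ∈ Y | lastCoord π x ≠ 0 ∧ lastCoord π x ≠ 1}.ncard := by
      intro Y hY
      have f1 : {x ∈ Y | lastCoord π x = 0}.Finite := hY.subset fun x hx => hx.1
      have f2 : {x ∈ Y | lastCoord π x = 1}.Finite := hY.subset fun x hx => hx.1
      have f3 : {x ∈ Y | lastCoord π x ≠ 0 ∧ lastCoord π x ≠ 1}.Finite :=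
        hY.subset fun x hx => hx.1
      rw [← Set.ncard_union_eq ?_ f1 f2, ← Set.ncard_union_eq ?_ (f1.union f2) f3]
      · congr 1
        ext x
        simp only [Set.mem_union, Set.mem_ofPred_eq]
        tauto
      · rw [Set.disjoint_left]
        rintro x (⟨-, hx⟩ | ⟨-, hx⟩) ⟨-, h, h'⟩
        exacts [h hx, h' hx]
      · rw [Set.disjoint_left]
        rintro x ⟨-, hx⟩ ⟨-, hx'⟩
        rw [hx] at hx'; norm_num at hx'
    have hmid : {x ∈ X | lastCoord π x ≠ 0 ∧ lastCoord π x ≠ 1} =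
        {x ∈ H | lastCoord π x ≠ 0 ∧ lastCoord π x ≠ 1} := by
      ext x
      constructor
      · rintro ⟨hx, h0, h1⟩
        exact ⟨⟨hx, not_mem_vertices_of_mid h0 h1⟩, h0, h1⟩
      · rintro ⟨hx, h⟩
        exact ⟨hx.1, h⟩
    have s1 := split X hfin
    have s2 := split H hHfin
    rw [hmid] at s1
    omega

/-! ### An extension of size at most 6 + 2d. -/

theorem IsConvexHeptagon.nontrivial {P : Set (Fin 2 → ℝ)} (hP : IsConvexHeptagon P) :
    P.Nontrivial := by
  have h : (vertices P).Nontrivial := by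
    have : Finite (vertices P) := Set.finite_of_ncard_ne_zero (by rw [hP.2]; norm_num)
    rw [← Set.one_lt_ncard_iff_nontrivial, hP.2]; norm_num
  exact h.mono fun x hx => hx.1

/-- The product of a heptagon with a cube has an extension with at most `6 + 2 d` facets. -/
theorem exists_extension {P : Set (Fin 2 → ℝ)} (hP : IsConvexHeptagon P) (d : ℕ) :
    ∃ Q : Set (Fin (2 + d + 1) → ℝ), IsExtension (prodCube P d) Q ∧
      size Q ≤ (6 + 2 * d : ℕ) := by
  obtain ⟨p, hp, -, hPp⟩ := exists_convexCyclic hP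
  obtain ⟨U, L, hL0, hUL⟩ := exists_lift hp
  rw [← hPp] at hUL
  let X : (Fin (2 + d + 1) → ℝ) →ₗ[ℝ] (Fin 2 → ℝ) :=
    LinearMap.funLeft ℝ ℝ fun i => (Fin.castAdd d i).castSucc
  let z : (Fin (2 + d + 1) → ℝ) →ₗ[ℝ] ℝ := LinearMap.proj (Fin.last (2 + d))
  let c : Fin d → (Fin (2 + d + 1) → ℝ) →ₗ[ℝ] ℝ := fun j => LinearMap.proj (Fin.natAdd 2 j).castSucc
  let s : (Fin 3 ⊕ Fin 3) ⊕ (Fin d ⊕ Fin d) → (Fin (2 + d + 1) → ℝ) →ᵃ[ℝ] ℝ :=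
    Sum.elim
      (Sum.elim (fun j => (U j).comp X.toAffineMap - z.toAffineMap)
        (fun j => z.toAffineMap - (L j).comp X.toAffineMap))
      (Sum.elim (fun j => (c j).toAffineMap) (fun j => AffineMap.const ℝ _ 1 - (c j).toAffineMap))
  let Q : Set (Fin (2 + d + 1) → ℝ) :=
    {y | (∀ e ∈ (∅ : Set ((Fin (2 + d + 1) → ℝ) →ᵃ[ℝ] ℝ)), e y = 0) ∧ ∀ i, 0 ≤ s i y}
  have hQ : HRep Q (6 + 2 * d) := by
    refine (HRep.of_fintype (Q := Q) rfl).mono (le_of_eq ?_)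
    simp; ring
  have mem : ∀ y, y ∈ Q ↔ ((∀ j, z y ≤ U j (X y)) ∧ ∀ j, L j (X y) ≤ z y) ∧
      ∀ j, 0 ≤ c j y ∧ c j y ≤ 1 := by
    intro y
    simp only [Q, s, Set.mem_ofPred_eq, Set.mem_empty_iff_false, false_imp_iff, implies_true,
      true_and, Sum.forall, Sum.elim_inl, Sum.elim_inr]
    refine and_congr (and_congr (forall_congr' fun j => ?_) (forall_congr' fun j => ?_)) ?_
    · exact sub_nonneg
    · exact sub_nonneg
    · rw [← forall_and]
      exact forall_congr' fun j => and_congr Iff.rfl sub_nonneg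
  have hproj : proj (2 + d) 1 '' Q = prodCube P d := by
    ext x
    constructor
    · rintro ⟨y, hy, rfl⟩
      rw [mem] at hy
      exact ⟨(hUL (X y)).2 ⟨z y, hy.1⟩, fun j => hy.2 j⟩
    · rintro ⟨h1, h2⟩
      obtain ⟨w, hw⟩ := (hUL _).1 h1
      have hX : X (Fin.snoc x w) = fun i => x (Fin.castAdd d i) := by
        funext i; exact Fin.snoc_castSucc (α := fun _ => ℝ) _ _ _
      have hz : z (Fin.snoc x w) = w := Fin.snoc_last (α := fun _ => ℝ) _ _
      have hc : ∀ j, c j (Fin.snoc x w) = x (Fin.natAdd 2 j) := fun j =>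
        Fin.snoc_castSucc (α := fun _ => ℝ) _ _ _
      refine ⟨Fin.snoc x w, ?_, ?_⟩
      · rw [mem, hX, hz]
        exact ⟨hw, fun j => by rw [hc]; exact h2 j⟩
      · funext i
        exact Fin.snoc_castSucc (α := fun _ => ℝ) _ _ _
  have hcompact : IsCompact P := by
    rw [hPp]; exact (Set.finite_range p).isCompact_convexHull ℝ
  have hbdd : Bornology.IsBounded Q := by
    obtain ⟨C, hC⟩ := hcompact.isBounded.exists_norm_le
    obtain ⟨M, hM⟩ := (hcompact.image (f := U 0) (U 0).continuous_of_finiteDimensional).isBounded.exists_norm_le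
    rw [isBounded_iff_forall_norm_le]
    refine ⟨max (max C M) 1, fun y hy => ?_⟩
    rw [mem] at hy
    have hXP : X y ∈ P := (hUL (X y)).2 ⟨z y, hy.1⟩
    rw [pi_norm_le_iff_of_nonneg (by positivity)]
    intro i
    refine Fin.lastCases ?_ (fun i => Fin.addCases (fun i => ?_) (fun j => ?_) i) i
    -- The height is bounded because one lower bound is the zero function and any upper bound is
    -- bounded on the compact P.
    · have h1 : 0 ≤ z y := by have := hy.1.2 0; rwa [hL0] at this
      have h2 := (hy.1.1 0).trans ((le_abs_self _).trans (hM _ ⟨X y, hXP, rfl⟩))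
      show ‖z y‖ ≤ _
      rw [Real.norm_of_nonneg h1]
      exact h2.trans ((le_max_right _ _).trans (le_max_left _ _))
    · show ‖X y i‖ ≤ _
      exact ((norm_le_pi_norm _ i).trans (hC _ hXP)).trans ((le_max_left _ _).trans (le_max_left _ _))
    · show ‖c j y‖ ≤ _
      rw [Real.norm_of_nonneg (hy.2 j).1]
      exact (hy.2 j).2.trans (le_max_right _ _)
  have hnt := nontrivial_of_image hproj (prodCube_nontrivial hP.nontrivial d)
  obtain ⟨hfin, hhull⟩ := isPolytope_of_hRep hQ hbdd hnt
  exact ⟨Q, ⟨⟨_, hfin, hhull⟩, hproj⟩, size_le_of_hRep hQ⟩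

/-! ### Slack relations and elementary counts of extreme rays. -/

section Rays

variable {E : Type*} [AddCommGroup E] [Module ℝ E] {n : ℕ} {σ : Fin n → E →ₗ[ℝ] ℝ}
  {h : E →ₗ[ℝ] ℝ}

theorem IsRay.coeff_eq_zero {x y z : E} (hx : IsRay σ h x) (hy : IsRay σ h y) (hz : IsRay σ h z)
    (hxy : y ≠ x) (hxz : z ≠ x) {a b c : ℝ} (hb : 0 ≤ b) (hc : 0 ≤ c)
    (he : a • x = b • y + c • z) : b = 0 ∧ c = 0 := by
  have key : ∀ i, σ i x = 0 → b * σ i y = 0 ∧ c * σ i z = 0 := by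
    intro i hi
    have := congrArg (σ i) he
    simp only [map_smul, map_add, smul_eq_mul, hi, mul_zero] at this
    have h1 := mul_nonneg hb (hy.nonneg i)
    have h2 := mul_nonneg hc (hz.nonneg i)
    constructor <;> linarith
  constructor
  · by_contra hb0
    exact hxy (hx.eq_of_support hy fun i hi => (mul_eq_zero.1 (key i hi).1).resolve_left hb0)
  · by_contra hc0
    exact hxz (hx.eq_of_support hz fun i hi => (mul_eq_zero.1 (key i hi).2).resolve_left hc0)

/-- Applying h shows that the coefficients of a relation sum to zero, so unless all vanish one has
its sign alone. Solved for that ray, the relation writes it as a nonnegative combination of the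
other two, which extremality forbids. -/
theorem IsRay.linearIndependent {x y z : E} (hx : IsRay σ h x) (hy : IsRay σ h y)
    (hz : IsRay σ h z) (hxy : x ≠ y) (hxz : x ≠ z) (hyz : y ≠ z) :
    LinearIndependent ℝ ![x, y, z] := by
  rw [Fintype.linearIndependent_iff]
  intro c hc
  simp only [Fin.sum_univ_three, Matrix.cons_val_zero, Matrix.cons_val_one, Matrix.cons_val] at hc
  have hs : c 0 + c 1 + c 2 = 0 := by
    have := congrArg h hc
    simpa [hx.one, hy.one, hz.one] using this
  have e1 : ∀ k : ℝ, (k * c 0) • x = (-(k * c 1)) • y + (-(k * c 2)) • z := fun k => by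
    have := congrArg (k • ·) hc
    simp only [smul_add, smul_smul, smul_zero] at this
    rw [neg_smul, neg_smul, ← neg_add, eq_neg_iff_add_eq_zero, ← add_assoc]; exact this
  have e2 : ∀ k : ℝ, (k * c 1) • y = (-(k * c 0)) • x + (-(k * c 2)) • z := fun k => by
    rw [neg_smul, e1 k]; module
  have e3 : ∀ k : ℝ, (k * c 2) • z = (-(k * c 0)) • x + (-(k * c 1)) • y := fun k => by
    rw [neg_smul, e1 k]; module
  have f1 := fun k hb hc' => hx.coeff_eq_zero hy hz hxy.symm hxz.symm hb hc' (e1 k)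
  have f2 := fun k hb hc' => hy.coeff_eq_zero hx hz hxy hyz.symm hb hc' (e2 k)
  have f3 := fun k hb hc' => hz.coeff_eq_zero hx hy hxz hyz hb hc' (e3 k)
  have p1 := f1 1
  have p2 := f2 1
  have p3 := f3 1
  have m1 := f1 (-1)
  have m2 := f2 (-1)
  have m3 := f3 (-1)
  have all : c 0 = 0 ∧ c 1 = 0 ∧ c 2 = 0 := by
    rcases le_total (c 0) 0 with h0 | h0 <;> rcases le_total (c 1) 0 with h1 | h1 <;>
      rcases le_total (c 2) 0 with h2 | h2
    · refine ⟨?_, ?_, ?_⟩ <;> linarith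
    · have := p3 (by linarith) (by linarith); refine ⟨?_, ?_, ?_⟩ <;> linarith [this.1, this.2]
    · have := p2 (by linarith) (by linarith); refine ⟨?_, ?_, ?_⟩ <;> linarith [this.1, this.2]
    · have := m1 (by linarith) (by linarith); refine ⟨?_, ?_, ?_⟩ <;> linarith [this.1, this.2]
    · have := p1 (by linarith) (by linarith); refine ⟨?_, ?_, ?_⟩ <;> linarith [this.1, this.2]
    · have := m2 (by linarith) (by linarith); refine ⟨?_, ?_, ?_⟩ <;> linarith [this.1, this.2]
    · have := m3 (by linarith) (by linarith); refine ⟨?_, ?_, ?_⟩ <;> linarith [this.1, this.2]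
    · refine ⟨?_, ?_, ?_⟩ <;> linarith
  intro i; fin_cases i
  exacts [all.1, all.2.1, all.2.2]

theorem finrank_le_of_conePos (hpos : ConePos σ h) : Module.finrank ℝ E ≤ n := by
  have hinj : Function.Injective (LinearMap.pi σ) := by
    rw [injective_iff_map_eq_zero]
    exact fun x hx => hpos.injective fun i => congrFun hx i
  simpa using LinearMap.finrank_le_finrank_of_injective hinj

/-- The image of the slack map is cut out by linear relations. -/
theorem exists_relations (hpos : ConePos σ h) {r : ℕ} (hr : Module.finrank ℝ E + r = n) :
    ∃ a : Fin r → Fin n → ℝ, LinearIndependent ℝ a ∧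
      ∀ s : Fin n → ℝ, (∃ x, ∀ i, σ i x = s i) ↔ ∀ j, ∑ i, a j i * s i = 0 := by
  have hinj : Function.Injective (LinearMap.pi σ) := by
    rw [injective_iff_map_eq_zero]
    exact fun x hx => hpos.injective fun i => congrFun hx i
  let W := LinearMap.range (LinearMap.pi σ)
  have hW : Module.finrank ℝ W = Module.finrank ℝ E := LinearMap.finrank_range_of_inj hinj
  -- The relations are the coordinate functions of the quotient by the image of the slack map.
  have hq : Module.finrank ℝ ((Fin n → ℝ) ⧸ W) = r := by
    have := Submodule.finrank_quotient_add_finrank W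
    rw [Module.finrank_fin_fun] at this
    omega
  let b := Module.finBasisOfFinrankEq ℝ ((Fin n → ℝ) ⧸ W) hq
  let l : (Fin n → ℝ) →ₗ[ℝ] (Fin r → ℝ) := b.equivFun.toLinearMap ∘ₗ W.mkQ
  have hl : Function.Surjective l := b.equivFun.surjective.comp W.mkQ_surjective
  have hker : ∀ s, l s = 0 ↔ s ∈ W := by
    intro s
    show b.equivFun (W.mkQ s) = 0 ↔ _
    rw [LinearEquiv.map_eq_zero_iff, Submodule.mkQ_apply, Submodule.Quotient.mk_eq_zero]
  have happ : ∀ (s : Fin n → ℝ) (j : Fin r), l s j = ∑ i, l (Pi.single i 1) j * s i := by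
    intro s j
    conv_lhs => rw [pi_eq_sum_univ' s]
    rw [map_sum, Finset.sum_apply]
    refine Finset.sum_congr rfl fun i _ => ?_
    rw [map_smul, Pi.smul_apply, smul_eq_mul, mul_comm]
  refine ⟨fun j i => l (Pi.single i 1) j, ?_, fun s => ?_⟩
  · rw [Fintype.linearIndependent_iff]
    intro c hc
    -- A vanishing combination c of the relations is tested on a preimage of c itself, which gives
    -- the sum of squares of c equal to zero.
    obtain ⟨s, hs⟩ := hl c
    have h1 : ∑ j, c j * c j = 0 := by
      have h2 : ∀ j, c j = ∑ i, l (Pi.single i 1) j * s i := fun j => by rw [← happ, hs]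
      calc ∑ j, c j * c j = ∑ j, c j * ∑ i, l (Pi.single i 1) j * s i :=
            Finset.sum_congr rfl fun j _ => by rw [← h2 j]
        _ = ∑ i, (∑ j, c j * l (Pi.single i 1) j) * s i := by
            simp only [Finset.mul_sum, Finset.sum_mul]
            rw [Finset.sum_comm]
            exact Finset.sum_congr rfl fun i _ => Finset.sum_congr rfl fun j _ => by ring
        _ = 0 := by
            refine Finset.sum_eq_zero fun i _ => ?_
            have := congrFun hc i
            simp only [Finset.sum_apply, Pi.smul_apply, smul_eq_mul, Pi.zero_apply] at this
            rw [this, zero_mul]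
    intro j
    have := (Finset.sum_eq_zero_iff_of_nonneg fun j _ => mul_self_nonneg (c j)).1 h1 j
      (Finset.mem_univ j)
    exact mul_self_eq_zero.1 this
  · have h1 : (∃ x, ∀ i, σ i x = s i) ↔ s ∈ W := by
      constructor
      · rintro ⟨x, hx⟩; exact ⟨x, funext hx⟩
      · rintro ⟨x, hx⟩; exact ⟨x, fun i => congrFun hx i⟩
    rw [h1, ← hker]
    constructor
    · intro hs j
      rw [← happ, hs]; rfl
    · intro hs
      funext j
      rw [happ]; exact hs j

/-- The cone is an orthant: for each index some e has only that slack nonzero, and a ray is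
proportional to the e of any index at which its slack is nonzero. -/
theorem ncard_isRay_le_of_finrank_eq (hpos : ConePos σ h) (hE : Module.finrank ℝ E = n) :
    {x | IsRay σ h x}.ncard ≤ n := by
  classical
  obtain ⟨a, -, ha⟩ := exists_relations hpos (r := 0) (by omega)
  have hex : ∀ i, ∃ e : E, ∀ k, σ k e = if k = i then 1 else 0 := fun i =>
    (ha fun k => if k = i then 1 else 0).2 fun j => j.elim0
  choose e he using hex
  have hne : ∀ x, IsRay σ h x → ∃ i, σ i x ≠ 0 := by
    intro x hx
    by_contra hcon; push Not at hcon
    exact hx.ne_zero (hpos.injective hcon)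
  rcases Set.eq_empty_or_nonempty {x | IsRay σ h x} with hX | ⟨x₀, hx₀⟩
  · rw [hX]; simp
  have : Nonempty (Fin n) := ⟨(hne x₀ hx₀).choose⟩
  choose! f hf using hne
  have hfe : ∀ x, IsRay σ h x → e (f x) = h (e (f x)) • x := by
    intro x hx
    refine hx.minimal _ fun i hi => ?_
    rw [he, if_neg]
    rintro rfl
    exact hf x hx hi
  have := Set.ncard_le_ncard_of_injOn (s := {x | IsRay σ h x}) (t := Set.univ) f
    (fun _ _ => Set.mem_univ _) (fun x hx y hy hxy => ?_) (Set.toFinite _)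
  · simpa using this
  · have h1 := hfe x hx
    have h2 := hfe y hy
    rw [hxy] at h1
    have h0 : h (e (f y)) ≠ 0 := by
      intro h0
      rw [h0, zero_smul] at h2
      have := he (f y) (f y)
      rw [h2] at this
      simp at this
    exact smul_right_injective E h0 (h1.symm.trans h2)

variable [FiniteDimensional ℝ E]

theorem three_le_finrank {K : Submodule ℝ E} {x y z : E} (hx : IsRay σ h x) (hy : IsRay σ h y)
    (hz : IsRay σ h z) (hxy : x ≠ y) (hxz : x ≠ z) (hyz : y ≠ z) (kx : x ∈ K) (ky : y ∈ K)
    (kz : z ∈ K) : 3 ≤ Module.finrank ℝ K := by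
  have hli := hx.linearIndependent hy hz hxy hxz hyz
  have h1 := finrank_span_eq_card hli
  have h2 : Submodule.span ℝ (Set.range ![x, y, z]) ≤ K := by
    rw [Submodule.span_le]
    rintro _ ⟨i, rfl⟩
    fin_cases i
    exacts [kx, ky, kz]
  have h3 := Submodule.finrank_mono h2
  rw [h1] at h3
  simpa using h3

theorem ncard_isRay_inf_le_two {K : Submodule ℝ E} (hK : Module.finrank ℝ K ≤ 2) :
    {x | IsRay σ h x ∧ x ∈ K}.ncard ≤ 2 := by
  by_contra hcon
  push Not at hcon
  rw [Set.two_lt_ncard_iff ((finite_isRay σ h).subset fun x hx => hx.1)] at hcon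
  obtain ⟨a, b, c, ha, hb, hc, hab, hac, hbc⟩ := hcon
  have := three_le_finrank ha.1 hb.1 hc.1 hab hac hbc ha.2 hb.2 hc.2
  omega

theorem finrank_ker_ge (f : E →ₗ[ℝ] ℝ) :
    Module.finrank ℝ E ≤ Module.finrank ℝ (LinearMap.ker f) + 1 := by
  have h1 := f.finrank_range_add_finrank_ker
  have h2 := Submodule.finrank_le (LinearMap.range f)
  rw [Module.finrank_self] at h2
  omega

theorem finrank_ker_eq {f : E →ₗ[ℝ] ℝ} (hf : f ≠ 0) :
    Module.finrank ℝ (LinearMap.ker f) + 1 = Module.finrank ℝ E := by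
  have h1 := f.finrank_range_add_finrank_ker
  rw [LinearMap.range_eq_top.2 (LinearMap.surjective hf), finrank_top, Module.finrank_self] at h1
  omega

/-- A cone over a polygon has at most as many extreme rays as inequalities. -/
theorem ncard_isRay_le_of_finrank_le_three (hE : Module.finrank ℝ E ≤ 3)
    (hn : 2 ≤ n) : {x | IsRay σ h x}.ncard ≤ n := by
  classical
  rcases Nat.lt_or_ge (Module.finrank ℝ E) 3 with hlt | hge
  · have := ncard_isRay_inf_le_two (σ := σ) (h := h) (K := ⊤) (by rw [finrank_top]; omega)
    simp only [Submodule.mem_top, and_true] at this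
    omega
  have h3 : Module.finrank ℝ E = 3 := le_antisymm hE hge
  have hfin := finite_isRay σ h
  -- Double counting of tight pairs: each ray lies on at least two nonzero walls, since a single
  -- wall has a kernel of dimension two and cannot determine it; each such wall contains at most two
  -- rays.
  have hcount := Finset.card_mul_le_card_mul (s := hfin.toFinset)
    (t := Finset.univ.filter fun i : Fin n => σ i ≠ 0)
    (fun x i => σ i x = 0) (m := 2) (n := 2) ?_ ?_
  · rw [Set.ncard_eq_toFinset_card _ hfin]
    have := Finset.card_filter_le (Finset.univ : Finset (Fin n)) (fun i => σ i ≠ 0)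
    simp only [Finset.card_univ, Fintype.card_fin] at this
    omega
  · intro x hx
    rw [Set.Finite.mem_toFinset] at hx
    have hx : IsRay σ h x := hx
    by_contra hcon
    push Not at hcon
    have hle : (Finset.bipartiteAbove (fun x i => σ i x = 0)
      (Finset.univ.filter fun i : Fin n => σ i ≠ 0) x).card ≤ 1 := by omega
    have : Nonempty (Fin n) := ⟨⟨0, by omega⟩⟩
    rw [Finset.card_le_one_iff_subset_singleton] at hle
    obtain ⟨i, hi⟩ := hle
    have hker : LinearMap.ker (σ i) ≤ Submodule.span ℝ {x} := by
      intro y hy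
      rw [Submodule.mem_span_singleton]
      refine ⟨h y, (hx.minimal y fun j hj => ?_).symm⟩
      by_cases hσ : σ j = 0
      · simp [hσ]
      · have := hi (show j ∈ _ by simp [Finset.bipartiteAbove, hσ, hj])
        rw [Finset.mem_singleton] at this
        rw [this]; exact hy
    have h1 := Submodule.finrank_mono hker
    have h2 := finrank_span_singleton (K := ℝ) hx.ne_zero
    have h4 := finrank_ker_ge (σ i)
    omega
  · intro i hi
    simp only [Finset.mem_filter, Finset.mem_univ, true_and] at hi
    have h1 := finrank_ker_eq hi
    have h2 := ncard_isRay_inf_le_two (σ := σ) (h := h) (K := LinearMap.ker (σ i)) (by omega)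
    refine le_trans (le_of_eq ?_) h2
    rw [Set.ncard_eq_toFinset_card _ (hfin.subset fun x hx => hx.1)]
    congr 1
    ext x
    simp [Finset.bipartiteBelow]

end Rays

/-! ### Combinations of polygon vertices and the prism obstruction. -/

section Plane

variable {P : Set (Fin 2 → ℝ)}

theorem eq_of_combo_of_eq {a b c : Fin 2 → ℝ} (ha : a ∈ vertices P) (hb : b ∈ P) (hc : c ∈ P)
    {μ₁ μ₂ μ₃ μ₄ : ℝ} (h3 : 0 < μ₃) (h4 : 0 < μ₄) (hs : μ₁ + μ₂ = μ₃ + μ₄)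
    (he : μ₁ • a + μ₂ • a = μ₃ • b + μ₄ • c) : b = a ∧ c = a := by
  have hp : 0 < μ₃ + μ₄ := by linarith
  have seg : a ∈ openSegment ℝ b c := by
    refine ⟨μ₃ / (μ₃ + μ₄), μ₄ / (μ₃ + μ₄), by positivity, by positivity, by field_simp, ?_⟩
    rw [div_eq_inv_mul, div_eq_inv_mul, mul_smul, mul_smul, ← smul_add, ← he, ← add_smul, hs,
      smul_smul, inv_mul_cancel₀ hp.ne', one_smul]
  exact ⟨ha.2 hb hc seg, ha.2 hc hb (by rwa [openSegment_symm])⟩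

/-- Moving the two multiples of a to the side where their difference is nonnegative exhibits b or c
as a convex combination involving the other. -/
theorem eq_of_combo_cancel {a b c : Fin 2 → ℝ} (ha : a ∈ vertices P) (hb : b ∈ vertices P)
    (hc : c ∈ vertices P) {μ₁ μ₂ μ₃ μ₄ : ℝ} (h2 : 0 < μ₂) (h4 : 0 < μ₄) (hs : μ₁ + μ₂ = μ₃ + μ₄)
    (he : μ₁ • a + μ₂ • b = μ₃ • a + μ₄ • c) : b = c := by
  rcases lt_trichotomy μ₁ μ₃ with h | h | h
  · have e : μ₂ • b + (0 : ℝ) • b = (μ₃ - μ₁) • a + μ₄ • c := by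
      rw [sub_smul, zero_smul, add_zero, sub_add_eq_add_sub, ← he]; abel
    exact (eq_of_combo_of_eq hb ha.1 hc.1 (sub_pos.2 h) h4 (by linarith) e).2.symm
  · subst h
    have : μ₂ = μ₄ := by linarith
    subst this
    exact smul_right_injective _ h2.ne' (add_left_cancel he)
  · have e : μ₄ • c + (0 : ℝ) • c = (μ₁ - μ₃) • a + μ₂ • b := by
      rw [sub_smul, zero_smul, add_zero, sub_add_eq_add_sub, he]; abel
    exact (eq_of_combo_of_eq hc ha.1 hb.1 (sub_pos.2 h) h2 (by linarith) e).2

theorem mem_lineThrough {a b : Fin 2 → ℝ} {s t : ℝ} (h : s + t = 1) :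
    s • a + t • b ∈ lineThrough a b := by
  have : AffineMap.lineMap a b t ∈ lineThrough a b := AffineMap.lineMap_mem_affineSpan_pair t a b
  rw [AffineMap.lineMap_apply_module] at this
  rwa [show s = 1 - t by linarith]

theorem parallel_lineThrough {a b c d : Fin 2 → ℝ} {t : ℝ} (ht : t ≠ 0) (h : a - b = t • (c - d)) :
    (lineThrough a b).Parallel (lineThrough c d) := by
  unfold lineThrough
  rw [AffineSubspace.affineSpan_pair_parallel_iff_vectorSpan_eq, vectorSpan_pair,
    vectorSpan_pair, vsub_eq_sub, vsub_eq_sub, h]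
  exact Submodule.span_singleton_smul_eq (IsUnit.mk0 t ht) _

variable {E : Type*} [AddCommGroup E] [Module ℝ E] {h : E →ₗ[ℝ] ℝ} {π : E →ₗ[ℝ] (Fin 2 → ℝ)}

/-- Normalization to height one, followed by projection to the plane. -/
noncomputable def planePt (h : E →ₗ[ℝ] ℝ) (π : E →ₗ[ℝ] (Fin 2 → ℝ)) (y : E) : Fin 2 → ℝ :=
  π ((h y)⁻¹ • y)

theorem smul_planePt {y : E} (hy : h y ≠ 0) : h y • planePt h π y = π y := by
  rw [planePt, map_smul, smul_smul, mul_inv_cancel₀ hy, one_smul]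

/-- The six vertices of a (projective) prism do not project to six vertices of a polygon in
general position. -/
theorem no_prism (hgen : InGeneralPosition P) {y : Fin 2 → Fin 3 → E} {O : E}
    (hO : ∀ j, y 0 j - y 1 j = O) (hy : ∀ i j, 0 < h (y i j))
    (hv : ∀ i j, planePt h π (y i j) ∈ vertices P)
    (hinj : ∀ i j i' j', planePt h π (y i j) = planePt h π (y i' j') → i = i' ∧ j = j') : False := by
  set q : Fin 2 → Fin 3 → Fin 2 → ℝ := fun i j => planePt h π (y i j) with hq
  have hπ : ∀ j, π O = h (y 0 j) • q 0 j - h (y 1 j) • q 1 j := fun j => by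
    rw [← hO j, map_sub, smul_planePt (hy 0 j).ne', smul_planePt (hy 1 j).ne']
  have hh : ∀ j, h O = h (y 0 j) - h (y 1 j) := fun j => by rw [← hO j, map_sub]
  have inj6 : Function.Injective
      (![q 0 0, q 1 0, q 0 1, q 1 1, q 0 2, q 1 2] : Fin 6 → Fin 2 → ℝ) := by
    have key : ∀ s : Fin 6, (![q 0 0, q 1 0, q 0 1, q 1 1, q 0 2, q 1 2] : Fin 6 → Fin 2 → ℝ) s =
        q ((![0, 1, 0, 1, 0, 1] : Fin 6 → Fin 2) s) ((![0, 0, 1, 1, 2, 2] : Fin 6 → Fin 3) s) := by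
      intro s; fin_cases s <;> rfl
    intro s t hst
    rw [key, key] at hst
    have comb : ∀ s t : Fin 6,
        (![0, 1, 0, 1, 0, 1] : Fin 6 → Fin 2) s = (![0, 1, 0, 1, 0, 1] : Fin 6 → Fin 2) t ∧
        (![0, 0, 1, 1, 2, 2] : Fin 6 → Fin 3) s = (![0, 0, 1, 1, 2, 2] : Fin 6 → Fin 3) t →
        s = t := by decide
    exact comb s t (hinj _ _ _ _ hst)
  -- O is the common point of the three edge lines, at infinity when its height is zero. In that
  -- case two of the projected lines are parallel; otherwise all three pass through the normalized
  -- projection of O.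
  by_cases h0 : h O = 0
  · refine hgen.not_parallel ![q 0 0, q 1 0, q 0 1, q 1 1] ?_ ?_
      (parallel_lineThrough (t := (h (y 0 0))⁻¹ * h (y 0 1)) ?_ ?_)
    · intro s t hst
      have := inj6 (a₁ := Fin.castLE (by norm_num) s) (a₂ := Fin.castLE (by norm_num) t) (by
        revert hst; fin_cases s <;> fin_cases t <;> exact fun h => h)
      exact Fin.castLE_injective (by norm_num) this
    · intro s; fin_cases s
      exacts [hv 0 0, hv 1 0, hv 0 1, hv 1 1]
    · exact mul_ne_zero (inv_ne_zero (hy 0 0).ne') (hy 0 1).ne'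
    · show q 0 0 - q 1 0 = _ • (q 0 1 - q 1 1)
      have e0 := hπ 0
      have e1 := hπ 1
      have m0 : h (y 1 0) = h (y 0 0) := by have := hh 0; rw [h0] at this; linarith
      have m1 : h (y 1 1) = h (y 0 1) := by have := hh 1; rw [h0] at this; linarith
      rw [m0, ← smul_sub] at e0
      rw [m1, ← smul_sub] at e1
      rw [mul_smul, ← e1, e0, smul_smul, inv_mul_cancel₀ (hy 0 0).ne', one_smul]
  · have onLine : ∀ j, (h O)⁻¹ • π O ∈ lineThrough (q 0 j) (q 1 j) := by
      intro j
      have := mem_lineThrough (a := q 0 j) (b := q 1 j) (s := (h O)⁻¹ * h (y 0 j))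
        (t := -((h O)⁻¹ * h (y 1 j))) (by
          have := hh j
          field_simp
          linarith)
      rw [hπ j, smul_sub, smul_smul, smul_smul, sub_eq_add_neg, ← neg_smul]
      exact this
    refine hgen.not_concurrent ![q 0 0, q 1 0, q 0 1, q 1 1, q 0 2, q 1 2] inj6 ?_
      ⟨_, onLine 0, onLine 1, onLine 2⟩
    intro s; fin_cases s
    exacts [hv 0 0, hv 1 0, hv 0 1, hv 1 1, hv 0 2, hv 1 2]

end Plane

/-! ### One slack relation. -/

section OneRelation

variable {E : Type*} [AddCommGroup E] [Module ℝ E] {n : ℕ} {σ : Fin n → E →ₗ[ℝ] ℝ}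
  {h : E →ₗ[ℝ] ℝ} {a : Fin n → ℝ}

open Classical in
/-- The supports of the extreme rays of the nonnegative solutions of `∑ i, a i * s i = 0`. -/
noncomputable def rayPairs (a : Fin n → ℝ) : Finset (Fin n × Fin n) :=
  Finset.univ.filter fun q => (a q.1 = 0 ∧ q.1 = q.2) ∨ (0 < a q.1 ∧ a q.2 < 0)

theorem mem_rayPairs {q : Fin n × Fin n} :
    q ∈ rayPairs a ↔ (a q.1 = 0 ∧ q.1 = q.2) ∨ (0 < a q.1 ∧ a q.2 < 0) := by
  simp [rayPairs]

theorem card_rayPairs_le (a : Fin n → ℝ) : ∃ p m z : ℕ, p + m + z = n ∧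
    (∃ A B : Finset (Fin n), A.card = p ∧ B.card = m ∧ (∀ i, i ∈ A ↔ 0 < a i) ∧
      ∀ i, i ∈ B ↔ a i < 0) ∧ (rayPairs a).card ≤ z + p * m ∧
      (z = 0 → ∀ q ∈ rayPairs a, 0 < a q.1 ∧ a q.2 < 0) := by
  classical
  let A := Finset.univ.filter fun i => 0 < a i
  let B := Finset.univ.filter fun i => a i < 0
  let Z := Finset.univ.filter fun i => a i = 0
  refine ⟨A.card, B.card, Z.card, ?_, ⟨A, B, rfl, rfl, by simp [A], by simp [B]⟩, ?_, ?_⟩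
  · rw [← Finset.card_union_of_disjoint, ← Finset.card_union_of_disjoint]
    · have : A ∪ B ∪ Z = Finset.univ := by
        ext i
        simp only [A, B, Z, Finset.mem_union, Finset.mem_filter, Finset.mem_univ, true_and, iff_true]
        rcases lt_trichotomy (a i) 0 with h | h | h <;> simp [h]
      rw [this]; simp
    · rw [Finset.disjoint_left]
      intro i hi hz
      simp only [A, B, Z, Finset.mem_union, Finset.mem_filter, Finset.mem_univ, true_and] at hi hz
      rcases hi with h | h <;> linarith
    · rw [Finset.disjoint_left]
      intro i hi hz
      simp only [A, B, Finset.mem_filter, Finset.mem_univ, true_and] at hi hz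
      linarith
  · have hsub : rayPairs a ⊆ Z.image (fun i => (i, i)) ∪ A ×ˢ B := by
      rintro ⟨i, j⟩ hq
      rw [mem_rayPairs] at hq
      rw [Finset.mem_union]
      rcases hq with ⟨h1, h2⟩ | h
      · simp only at h1 h2
        subst h2
        exact Or.inl (Finset.mem_image_of_mem _ (by simpa [Z] using h1))
      · exact Or.inr (by simpa [A, B] using h)
    refine (Finset.card_le_card hsub).trans ((Finset.card_union_le _ _).trans ?_)
    rw [Finset.card_product]
    exact Nat.add_le_add_right Finset.card_image_le _
  · intro hz q hq
    rcases mem_rayPairs.1 hq with ⟨h1, -⟩ | h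
    · have : q.1 ∈ Z := by simpa [Z] using h1
      rw [Finset.card_eq_zero] at hz
      rw [hz] at this
      simp at this
    · exact h

/-- Minimal supports of nonnegative solutions of one equation are a single zero index or one
positive with one negative index. Geometrically the cone lies over a product of two simplices with
iterated pyramids; the last clause is the parallelogram relation of the product. -/
theorem exists_pair_rays (hpos : ConePos σ h)
    (ha : ∀ s : Fin n → ℝ, (∃ x, ∀ i, σ i x = s i) ↔ ∑ i, a i * s i = 0) :
    ∃ y : Fin n × Fin n → E, (∀ q ∈ rayPairs a, 0 < h (y q) ∧ IsRay σ h ((h (y q))⁻¹ • y q)) ∧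
      (∀ x, IsRay σ h x → ∃ q ∈ rayPairs a, x = (h (y q))⁻¹ • y q) ∧
      ∀ i i' j j', 0 < a i → 0 < a i' → a j < 0 → a j' < 0 →
        y (i, j) + y (i', j') = y (i, j') + y (i', j) := by
  classical
  -- The weights 1/|a i| make a positive and a negative term cancel and depend on one index only,
  -- which gives the parallelogram relation. At a zero index i the pair (i, i) is counted twice, so
  -- 1/2 gives slack 1.
  let c : Fin n → ℝ := fun i => if a i = 0 then 1 / 2 else 1 / |a i|
  have hc : ∀ i, 0 < c i := by
    intro i; dsimp only [c]; split_ifs with h0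
    · norm_num
    · have := abs_pos.2 h0; positivity
  have hex : ∀ q : Fin n × Fin n, ∃ y : E, q ∈ rayPairs a →
      ∀ k, σ k y = (if k = q.1 then c q.1 else 0) + (if k = q.2 then c q.2 else 0) := by
    intro q
    by_cases hq : q ∈ rayPairs a
    · obtain ⟨y, hy⟩ := (ha fun k => (if k = q.1 then c q.1 else 0) + (if k = q.2 then c q.2 else 0)).2 (by
        simp only [mul_add, Finset.sum_add_distrib, mul_ite, mul_zero, Finset.sum_ite_eq',
          Finset.mem_univ, if_true]
        rcases mem_rayPairs.1 hq with ⟨h1, h2⟩ | ⟨h1, h2⟩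
        · rw [← h2, h1]; ring
        · simp only [c, h1.ne', h2.ne, if_false, abs_of_pos h1, abs_of_neg h2]
          have := h2.ne
          field_simp; norm_num)
      exact ⟨y, fun _ => hy⟩
    · exact ⟨0, fun hq' => absurd hq' hq⟩
  choose y hy using hex
  have hnn : ∀ q ∈ rayPairs a, ∀ k, 0 ≤ σ k (y q) := by
    intro q hq k
    rw [hy q hq]
    have := (hc q.1).le
    have := (hc q.2).le
    split_ifs <;> linarith
  have hsupp : ∀ q ∈ rayPairs a, ∀ k, σ k (y q) = 0 → k ≠ q.1 ∧ k ≠ q.2 := by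
    intro q hq k hk
    rw [hy q hq] at hk
    have := hc q.1
    have := hc q.2
    constructor <;> intro hkq <;> rw [if_pos hkq] at hk <;> split_ifs at hk <;> linarith
  have hsupp' : ∀ q ∈ rayPairs a, ∀ k, k ≠ q.1 → k ≠ q.2 → σ k (y q) = 0 := by
    intro q hq k h1 h2
    rw [hy q hq, if_neg h1, if_neg h2, add_zero]
  have hne : ∀ q ∈ rayPairs a, y q ≠ 0 := by
    intro q hq h0
    exact (hsupp q hq q.1 (by rw [h0, map_zero])).1 rfl
  refine ⟨y, fun q hq => ⟨hpos _ (hnn q hq) (hne q hq),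
    isRay_of_minimal hpos (hnn q hq) (hne q hq) fun w hw => ?_⟩, fun x hx => ?_, ?_⟩
  · have hw0 : ∀ k, k ≠ q.1 → k ≠ q.2 → σ k w = 0 := fun k h1 h2 => hw k (hsupp' q hq k h1 h2)
    have hrel := (ha fun k => σ k w).1 ⟨w, fun _ => rfl⟩
    have ext : ∀ t : ℝ, σ q.1 w = t * σ q.1 (y q) → σ q.2 w = t * σ q.2 (y q) → w = t • y q := by
      intro t h1 h2
      rw [← sub_eq_zero]
      refine hpos.injective fun k => ?_
      rw [map_sub, map_smul, smul_eq_mul, sub_eq_zero]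
      by_cases k1 : k = q.1
      · rw [k1, h1]
      by_cases k2 : k = q.2
      · rw [k2, h2]
      rw [hw0 k k1 k2, hsupp' q hq k k1 k2, mul_zero]
    rcases mem_rayPairs.1 hq with ⟨h1, h2⟩ | ⟨h1, h2⟩
    · have hs := hy q hq q.1
      have hp : σ q.1 (y q) ≠ 0 := fun h0 => (hsupp q hq q.1 h0).1 rfl
      refine ⟨σ q.1 w / σ q.1 (y q), ext _ (by field_simp) ?_⟩
      rw [← h2]; field_simp
    · have h12 : q.1 ≠ q.2 := fun he => by rw [he] at h1; linarith
      have hsum : ∑ k, a k * σ k w = a q.1 * σ q.1 w + a q.2 * σ q.2 w := by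
        rw [← Finset.sum_pair (f := fun k => a k * σ k w) h12]
        symm
        refine Finset.sum_subset (Finset.subset_univ _) fun k _ hk => ?_
        simp only [Finset.mem_insert, Finset.mem_singleton, not_or] at hk
        rw [hw0 k hk.1 hk.2, mul_zero]
      rw [hsum] at hrel
      -- The slack of `y q` at `q.1` is 1 / a q.1, so this is the only possible factor.
      refine ⟨a q.1 * σ q.1 w, ext _ ?_ ?_⟩
      · rw [hy q hq, if_pos rfl, if_neg h12]
        simp only [c, h1.ne', if_false, abs_of_pos h1]
        field_simp; ring
      · rw [hy q hq, if_neg h12.symm, if_pos rfl]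
        simp only [c, h2.ne, if_false, abs_of_neg h2]
        have := h2.ne
        field_simp
        linarith
  · have fin : ∀ q ∈ rayPairs a, (∀ k, σ k x = 0 → σ k (y q) = 0) → x = (h (y q))⁻¹ • y q := by
      intro q hq hsub
      have h1 := hx.minimal _ hsub
      have h2 := hpos _ (hnn q hq) (hne q hq)
      conv_rhs => rw [h1]
      rw [map_smul, hx.one, smul_eq_mul, mul_one, smul_smul, inv_mul_cancel₀ h2.ne', one_smul]
    have fin' : ∀ q ∈ rayPairs a, σ q.1 x ≠ 0 → σ q.2 x ≠ 0 → x = (h (y q))⁻¹ • y q := by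
      intro q hq h1 h2
      refine fin q hq fun k hk => hsupp' q hq k ?_ ?_
      · rintro rfl; exact h1 hk
      · rintro rfl; exact h2 hk
    by_cases hz : ∃ i, a i = 0 ∧ σ i x ≠ 0
    · obtain ⟨i, h1, h2⟩ := hz
      have hq : (i, i) ∈ rayPairs a := mem_rayPairs.2 (Or.inl ⟨h1, rfl⟩)
      exact ⟨_, hq, fin' _ hq h2 h2⟩
    push Not at hz
    have hrel := (ha fun k => σ k x).1 ⟨x, fun _ => rfl⟩
    have hallz : (∀ k, a k * σ k x = 0) → False := by
      intro hall
      apply hx.ne_zero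
      apply hpos.injective
      intro k
      rcases mul_eq_zero.1 (hall k) with h0 | h0
      · exact hz k h0
      · exact h0
    have hp : ∃ i, 0 < a i ∧ σ i x ≠ 0 := by
      by_contra hcon; push Not at hcon
      have hle : ∀ k, a k * σ k x ≤ 0 := fun k => by
        rcases lt_or_ge 0 (a k) with h0 | h0
        · rw [hcon k h0, mul_zero]
        · exact mul_nonpos_of_nonpos_of_nonneg h0 (hx.nonneg k)
      exact hallz fun k => (Finset.sum_eq_zero_iff_of_nonpos fun k _ => hle k).1 hrel k (Finset.mem_univ k)
    have hm : ∃ j, a j < 0 ∧ σ j x ≠ 0 := by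
      by_contra hcon; push Not at hcon
      have hle : ∀ k, 0 ≤ a k * σ k x := fun k => by
        rcases lt_or_ge (a k) 0 with h0 | h0
        · rw [hcon k h0, mul_zero]
        · exact mul_nonneg h0 (hx.nonneg k)
      exact hallz fun k => (Finset.sum_eq_zero_iff_of_nonneg fun k _ => hle k).1 hrel k (Finset.mem_univ k)
    obtain ⟨i, hi, hi'⟩ := hp
    obtain ⟨j, hj, hj'⟩ := hm
    have hq : (i, j) ∈ rayPairs a := mem_rayPairs.2 (Or.inr ⟨hi, hj⟩)
    exact ⟨_, hq, fin' _ hq hi' hj'⟩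
  · intro i i' j j' hi hi' hj hj'
    have m : ∀ {i j}, 0 < a i → a j < 0 → (i, j) ∈ rayPairs a := fun h1 h2 =>
      mem_rayPairs.2 (Or.inr ⟨h1, h2⟩)
    rw [← sub_eq_zero]
    refine hpos.injective fun k => ?_
    rw [map_sub, map_add, map_add, hy _ (m hi hj), hy _ (m hi' hj'), hy _ (m hi hj'), hy _ (m hi' hj)]
    ring

theorem ncard_isRay_le_rayPairs (hpos : ConePos σ h)
    (ha : ∀ s : Fin n → ℝ, (∃ x, ∀ i, σ i x = s i) ↔ ∑ i, a i * s i = 0) :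
    {x | IsRay σ h x}.ncard ≤ (rayPairs a).card := by
  obtain ⟨y, -, hy, -⟩ := exists_pair_rays hpos ha
  have hsub : {x | IsRay σ h x} ⊆ (fun q => (h (y q))⁻¹ • y q) '' (rayPairs a : Set _) := by
    intro x hx
    obtain ⟨q, hq, rfl⟩ := hy x hx
    exact ⟨q, hq, rfl⟩
  refine (Set.ncard_le_ncard hsub ((Finset.finite_toSet _).image _)).trans ?_
  refine (Set.ncard_image_le (Finset.finite_toSet _)).trans ?_
  rw [Set.ncard_coe_finset]

end OneRelation

/-- There are at most z + p m rays with p + m + z = 6. If they project injectively, a subproduct 2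
by 3 is a prism and `no_prism` applies. Otherwise there are at least eight rays, the cone is a pure
product, and collisions propagate along rows and columns until fewer than seven images remain. -/
theorem oneRelation_absurd {E : Type*} [AddCommGroup E] [Module ℝ E] {σ : Fin 6 → E →ₗ[ℝ] ℝ}
    {h : E →ₗ[ℝ] ℝ} (hpos : ConePos σ h) {a : Fin 6 → ℝ}
    (ha : ∀ s : Fin 6 → ℝ, (∃ x, ∀ i, σ i x = s i) ↔ ∑ i, a i * s i = 0)
    {P : Set (Fin 2 → ℝ)} (hcard : (vertices P).ncard = 7) (hgen : InGeneralPosition P)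
    {π : E →ₗ[ℝ] (Fin 2 → ℝ)} (hin : ∀ x, IsRay σ h x → π x ∈ vertices P)
    (hsurj : ∀ v ∈ vertices P, ∃ x, IsRay σ h x ∧ π x = v) : False := by
  classical
  obtain ⟨y, hray, hall, hrel⟩ := exists_pair_rays hpos ha
  obtain ⟨p, m, z, hsum, ⟨A, B, hA, hB, hAm, hBm⟩, hle, hz⟩ := card_rayPairs_le a
  let q : Fin 6 × Fin 6 → Fin 2 → ℝ := fun s => planePt h π (y s)
  have hqv : ∀ s ∈ rayPairs a, q s ∈ vertices P := fun s hs => hin _ (hray s hs).2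
  have hfin : (vertices P).Finite := Set.finite_of_ncard_ne_zero (by omega)
  have himg : (rayPairs a).image q = hfin.toFinset := by
    ext v
    rw [Finset.mem_image, Set.Finite.mem_toFinset]
    constructor
    · rintro ⟨s, hs, rfl⟩; exact hqv s hs
    · intro hv
      obtain ⟨x, hx, rfl⟩ := hsurj v hv
      obtain ⟨s, hs, rfl⟩ := hall x hx
      exact ⟨s, hs, rfl⟩
  have h7 : ((rayPairs a).image q).card = 7 := by
    rw [himg, ← Set.ncard_eq_toFinset_card _ hfin, hcard]
  have mk : ∀ {i j}, 0 < a i → a j < 0 → (i, j) ∈ rayPairs a := fun h1 h2 =>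
    mem_rayPairs.2 (Or.inr ⟨h1, h2⟩)
  have hge : 7 ≤ (rayPairs a).card := h7 ▸ Finset.card_image_le
  by_cases hinj : Set.InjOn q (rayPairs a)
  · -- six of the vertices form a prism
    have hc7 : (rayPairs a).card = 7 := by rw [← Finset.card_image_of_injOn hinj, h7]
    have hcases : 2 ≤ p ∧ 3 ≤ m ∨ 3 ≤ p ∧ 2 ≤ m := by
      have hp6 : p ≤ 6 := by omega
      have hm6 : m ≤ 6 := by omega
      rw [hc7] at hle
      obtain rfl : z = 6 - p - m := by omega
      interval_cases p <;> interval_cases m <;> omega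
    rcases hcases with ⟨h2, h3⟩ | ⟨h3, h2⟩
    · obtain ⟨A', hA', hA'c⟩ := Finset.exists_subset_card_eq (hA ▸ h2)
      obtain ⟨B', hB', hB'c⟩ := Finset.exists_subset_card_eq (hB ▸ h3)
      let α := A'.equivFinOfCardEq hA'c
      let β := B'.equivFinOfCardEq hB'c
      have hα : ∀ i, 0 < a (α.symm i) := fun i => (hAm _).1 (hA' (α.symm i).2)
      have hβ : ∀ j, a (β.symm j) < 0 := fun j => (hBm _).1 (hB' (β.symm j).2)
      refine no_prism hgen (h := h) (π := π) (y := fun i j => y (α.symm i, β.symm j))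
        (O := y (α.symm 0, β.symm 0) - y (α.symm 1, β.symm 0)) (fun j => ?_)
        (fun i j => (hray _ (mk (hα i) (hβ j))).1) (fun i j => hqv _ (mk (hα i) (hβ j)))
        (fun i j i' j' he => ?_)
      · rw [sub_eq_sub_iff_add_eq_add]
        exact hrel _ _ _ _ (hα 0) (hα 1) (hβ j) (hβ 0)
      · have := hinj (mk (hα i) (hβ j)) (mk (hα i') (hβ j')) he
        rw [Prod.mk.injEq] at this
        exact ⟨α.symm.injective (Subtype.ext this.1), β.symm.injective (Subtype.ext this.2)⟩
    · obtain ⟨A', hA', hA'c⟩ := Finset.exists_subset_card_eq (hA ▸ h3)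
      obtain ⟨B', hB', hB'c⟩ := Finset.exists_subset_card_eq (hB ▸ h2)
      let α := A'.equivFinOfCardEq hA'c
      let β := B'.equivFinOfCardEq hB'c
      have hα : ∀ i, 0 < a (α.symm i) := fun i => (hAm _).1 (hA' (α.symm i).2)
      have hβ : ∀ j, a (β.symm j) < 0 := fun j => (hBm _).1 (hB' (β.symm j).2)
      refine no_prism hgen (h := h) (π := π) (y := fun i j => y (α.symm j, β.symm i))
        (O := y (α.symm 0, β.symm 0) - y (α.symm 0, β.symm 1)) (fun j => ?_)
        (fun i j => (hray _ (mk (hα j) (hβ i))).1) (fun i j => hqv _ (mk (hα j) (hβ i)))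
        (fun i j i' j' he => ?_)
      · rw [sub_eq_sub_iff_add_eq_add, add_comm (y (α.symm 0, β.symm 0))]
        exact hrel _ _ _ _ (hα j) (hα 0) (hβ 0) (hβ 1) |>.trans (add_comm _ _)
          |>.trans (add_comm _ _)
      · have := hinj (mk (hα j) (hβ i)) (mk (hα j') (hβ i')) he
        rw [Prod.mk.injEq] at this
        exact ⟨β.symm.injective (Subtype.ext this.2), α.symm.injective (Subtype.ext this.1)⟩
  · -- two vertices collide
    have hc8 : 8 ≤ (rayPairs a).card := by
      by_contra hcon
      apply hinj
      rw [← Finset.card_image_iff, h7]; omega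
    -- Only the sizes 3 by 3, 2 by 4 and 4 by 2 remain, and deleting a row or a column leaves at
    -- most six pairs.
    have hnum : z = 0 ∧ p * (m - 1) ≤ 6 ∧ (p - 1) * m ≤ 6 := by
      have hp6 : p ≤ 6 := by omega
      have hm6 : m ≤ 6 := by omega
      have hle' := hc8.trans hle
      obtain rfl : z = 6 - p - m := by omega
      clear hle hz hA hB hgen hin hsurj himg h7 hrel hall hray
      interval_cases p <;> interval_cases m <;> omega
    obtain ⟨z0, n1, n2⟩ := hnum
    have hprod : rayPairs a = A ×ˢ B := by
      ext s
      rw [Finset.mem_product, hAm, hBm]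
      exact ⟨fun hs => hz z0 s hs, fun hs => mk hs.1 hs.2⟩
    rw [hprod] at h7
    have hh : ∀ {i i' j j'}, 0 < a i → 0 < a i' → a j < 0 → a j' < 0 →
        h (y (i, j)) + h (y (i', j')) = h (y (i, j')) + h (y (i', j)) := by
      intro i i' j j' h1 h2 h3 h4
      rw [← map_add, ← map_add, hrel i i' j j' h1 h2 h3 h4]
    have hπ : ∀ {i i' j j'}, 0 < a i → 0 < a i' → a j < 0 → a j' < 0 →
        h (y (i, j)) • q (i, j) + h (y (i', j')) • q (i', j') =
          h (y (i, j')) • q (i, j') + h (y (i', j)) • q (i', j) := by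
      intro i i' j j' h1 h2 h3 h4
      rw [smul_planePt (hray _ (mk h1 h3)).1.ne', smul_planePt (hray _ (mk h2 h4)).1.ne',
        smul_planePt (hray _ (mk h1 h4)).1.ne', smul_planePt (hray _ (mk h2 h3)).1.ne',
        ← map_add, ← map_add, hrel i i' j j' h1 h2 h3 h4]
    have row : ∀ i ∈ A, ∀ j ∈ B, ∀ j' ∈ B, j ≠ j' → q (i, j) ≠ q (i, j') := by
      intro i hi j hj j' hj' hne he
      have hi' := (hAm i).1 hi
      have bj := (hBm j).1 hj
      have bj' := (hBm j').1 hj'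
      -- A collision in one row cancels in the parallelogram relation with every other row, so the
      -- two columns have the same images.
      have hall' : ∀ k ∈ A, q (k, j') = q (k, j) := by
        intro k hk
        have hk' := (hAm k).1 hk
        have e := hπ hi' hk' bj bj'
        rw [← he] at e
        exact eq_of_combo_cancel (hqv _ (mk hi' bj)) (hqv _ (mk hk' bj')) (hqv _ (mk hk' bj))
          (hray _ (mk hk' bj')).1 (hray _ (mk hk' bj)).1 (hh hi' hk' bj bj') e
      have hsub : (A ×ˢ B).image q ⊆ (A ×ˢ (B.erase j')).image q := by
        intro v hv
        obtain ⟨⟨k, l⟩, hs, rfl⟩ := Finset.mem_image.1 hv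
        rw [Finset.mem_product] at hs
        by_cases hl : l = j'
        · rw [hl, hall' k hs.1]
          exact Finset.mem_image_of_mem _ (Finset.mem_product.2 ⟨hs.1, Finset.mem_erase.2 ⟨hne, hj⟩⟩)
        · exact Finset.mem_image_of_mem _ (Finset.mem_product.2 ⟨hs.1, Finset.mem_erase.2 ⟨hl, hs.2⟩⟩)
      have := (Finset.card_le_card hsub).trans Finset.card_image_le
      rw [h7, Finset.card_product, Finset.card_erase_of_mem hj', hA, hB] at this
      omega
    have col : ∀ i ∈ A, ∀ i' ∈ A, ∀ j ∈ B, i ≠ i' → q (i, j) ≠ q (i', j) := by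
      intro i hi i' hi' j hj hne he
      have ai := (hAm i).1 hi
      have ai' := (hAm i').1 hi'
      have bj := (hBm j).1 hj
      have hall' : ∀ l ∈ B, q (i', l) = q (i, l) := by
        intro l hl
        have bl := (hBm l).1 hl
        have e := hπ ai ai' bj bl
        have e2 := hh ai ai' bj bl
        rw [← he, add_comm (h (y (i, l)) • q (i, l))] at e
        rw [add_comm (h (y (i, l)))] at e2
        exact eq_of_combo_cancel (hqv _ (mk ai bj)) (hqv _ (mk ai' bl)) (hqv _ (mk ai bl))
          (hray _ (mk ai' bl)).1 (hray _ (mk ai bl)).1 e2 e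
      have hsub : (A ×ˢ B).image q ⊆ ((A.erase i') ×ˢ B).image q := by
        intro v hv
        obtain ⟨⟨k, l⟩, hs, rfl⟩ := Finset.mem_image.1 hv
        rw [Finset.mem_product] at hs
        by_cases hk : k = i'
        · rw [hk, hall' l hs.2]
          exact Finset.mem_image_of_mem _ (Finset.mem_product.2 ⟨Finset.mem_erase.2 ⟨hne, hi⟩, hs.2⟩)
        · exact Finset.mem_image_of_mem _ (Finset.mem_product.2 ⟨Finset.mem_erase.2 ⟨hk, hs.1⟩, hs.2⟩)
      have := (Finset.card_le_card hsub).trans Finset.card_image_le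
      rw [h7, Finset.card_product, Finset.card_erase_of_mem hi', hA, hB] at this
      omega
    apply hinj
    rw [hprod]
    rintro ⟨i, j⟩ hs ⟨i', j'⟩ hs' he
    rw [Finset.mem_coe, Finset.mem_product] at hs hs'
    by_cases hii : i = i'
    · subst hii
      by_contra hne
      exact row i hs.1 j hs.2 j' hs'.2 (fun hjj => hne (by rw [hjj])) he
    by_cases hjj : j = j'
    · subst hjj
      exact absurd he (col i hs.1 i' hs'.1 j hs.2 hii)
    -- A diagonal collision writes one vertex as a positive combination of the images of the other
    -- two corners, so these coincide with it and a row collision results.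
    · exfalso
      have ai := (hAm i).1 hs.1
      have ai' := (hAm i').1 hs'.1
      have bj := (hBm j).1 hs.2
      have bj' := (hBm j').1 hs'.2
      have e := hπ ai ai' bj bj'
      rw [← he] at e
      have := eq_of_combo_of_eq (hqv _ (mk ai bj)) (hqv _ (mk ai bj')).1 (hqv _ (mk ai' bj)).1
        (hray _ (mk ai bj')).1 (hray _ (mk ai' bj)).1 (hh ai ai' bj bj') e
      exact row i hs.1 j hs.2 j' hs'.2 hjj this.1.symm

/-! ### Finite check of the sign and level patterns of six plane vectors. -/

/-- Octal digits. -/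
def dig (c i : ℕ) : ℕ := Nat.mod (Nat.div c (Nat.pow 8 i)) 8

/-- Candidates for the supports of extreme rays, as sorted triples with repetitions. -/
def supportTriples : List (ℕ × ℕ × ℕ) :=
  (List.range 6).flatMap (fun j => (List.range j).map fun i => (i, j, j)) ++
  (List.range 6).flatMap (fun k => (List.range k).flatMap fun j => (List.range j).map fun i => (i, j, k))

/-- Whether a triple is the support of an extreme ray, given the signs (`0` or `1`) and the
angular levels of the vectors. -/
def isSupport (s l : ℕ) (t : ℕ × ℕ × ℕ) : Bool :=
  bif Nat.beq t.2.1 t.2.2 then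
    !Nat.beq (dig s t.1) (dig s t.2.1) && Nat.beq (dig l t.1) (dig l t.2.1)
  else !Nat.beq (dig s t.1) (dig s t.2.1) && !Nat.beq (dig s t.2.1) (dig s t.2.2) &&
    !Nat.beq (dig l t.1) (dig l t.2.1) && !Nat.beq (dig l t.2.1) (dig l t.2.2)

def supports (s l : ℕ) : List (ℕ × ℕ × ℕ) := supportTriples.filter (isSupport s l)

/-- Whether the inequality `m` is tight at the ray with the given support. -/
def tightAt (m : ℕ) (t : ℕ × ℕ × ℕ) : Bool :=
  !Nat.beq m t.1 && !Nat.beq m t.2.1 && !Nat.beq m t.2.2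

/-- Three walls such that each two of them share two rays off the third, as for the quadrilaterals
of a prism. -/
def hasPrism (S : List (ℕ × ℕ × ℕ)) : Bool :=
  (List.range 6).any fun i => (List.range 6).any fun j => (List.range 6).any fun k =>
    Nat.ble 2 (S.filter fun t => tightAt i t && tightAt j t && !tightAt k t).length &&
    Nat.ble 2 (S.filter fun t => tightAt j t && tightAt k t && !tightAt i t).length &&
    Nat.ble 2 (S.filter fun t => tightAt i t && tightAt k t && !tightAt j t).length

/-- The last seven tests list, in order, the rays `u 0`, ..., `u 6` of `wedge_absurd`. The two tests
before d is chosen only prune the search: they follow from later ones. -/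
def hasWedge (S : List (ℕ × ℕ × ℕ)) : Bool :=
  (List.range 6).any fun a => (List.range 6).any fun b =>
    (S.any fun t => tightAt a t && tightAt b t) &&
    (List.range 6).any fun c => (S.any fun t => tightAt b t && tightAt c t && !tightAt a t) &&
    (List.range 6).any fun d =>
    (S.any fun t => tightAt a t && tightAt c t && !tightAt b t && !tightAt d t) &&
    (S.any fun t => tightAt a t && tightAt b t && !tightAt c t && !tightAt d t) &&
    (S.any fun t => tightAt a t && tightAt c t && tightAt d t && !tightAt b t) &&
    (S.any fun t => tightAt a t && tightAt b t && tightAt d t && !tightAt c t) &&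
    (S.any fun t => tightAt b t && tightAt c t && !tightAt a t && !tightAt d t) &&
    (S.any fun t => tightAt b t && tightAt d t && !tightAt a t && !tightAt c t) &&
    (S.any fun t => tightAt c t && tightAt d t && !tightAt a t && !tightAt b t)

/-- Two walls with at most three rays each that share at least two rays: triangles with a common
edge. -/
def hasTriangles (S : List (ℕ × ℕ × ℕ)) : Bool :=
  (List.range 6).any fun j => (List.range j).any fun i =>
    Nat.ble (S.filter fun t => tightAt i t).length 3 &&
    Nat.ble (S.filter fun t => tightAt j t).length 3 &&
    Nat.ble 2 (S.filter fun t => tightAt i t && tightAt j t).length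

/-- The combinatorial condition on the supports of the extreme rays. -/
def listOK (S : List (ℕ × ℕ × ℕ)) : Bool :=
  Nat.ble S.length 6 || (Nat.beq S.length 7 && (hasPrism S || hasWedge S)) ||
    (Nat.beq S.length 8 && !hasTriangles S)

/-- Each argument is the jump, 0 or 1, between consecutive keys in the sorted order; the digits are
the partial sums, so equal digits mean equal keys. -/
def levelCode (d₀ d₁ d₂ d₃ d₄ : ℕ) : ℕ :=
  d₀ * 8 + (d₀ + d₁) * 8 ^ 2 + (d₀ + d₁ + d₂) * 8 ^ 3 + (d₀ + d₁ + d₂ + d₃) * 8 ^ 4 +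
    (d₀ + d₁ + d₂ + d₃ + d₄) * 8 ^ 5

def signCode (s₁ s₂ s₃ s₄ s₅ : ℕ) : ℕ :=
  s₁ * 8 + s₂ * 8 ^ 2 + s₃ * 8 ^ 3 + s₄ * 8 ^ 4 + s₅ * 8 ^ 5

/-- The first sign is normalized to 0, since negating all vectors preserves their positive
relations. The code 0 is skipped because then all vectors are parallel, against the independence of
the two relations. -/
def allPatternsOK : Bool :=
  (List.range 2).all fun s₁ => (List.range 2).all fun s₂ =>
  (List.range 2).all fun s₃ => (List.range 2).all fun s₄ => (List.range 2).all fun s₅ =>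
  (List.range 2).all fun d₀ => (List.range 2).all fun d₁ => (List.range 2).all fun d₂ =>
  (List.range 2).all fun d₃ => (List.range 2).all fun d₄ =>
    Nat.beq (levelCode d₀ d₁ d₂ d₃ d₄) 0 ||
      listOK (supports (signCode s₁ s₂ s₃ s₄ s₅) (levelCode d₀ d₁ d₂ d₃ d₄))

theorem allPatternsOK_eq : allPatternsOK = true := by decide +kernel

theorem dig_signCode : ∀ s₁ < 2, ∀ s₂ < 2, ∀ s₃ < 2, ∀ s₄ < 2, ∀ s₅ < 2, ∀ i : Fin 6,
    dig (signCode s₁ s₂ s₃ s₄ s₅) i = (![0, s₁, s₂, s₃, s₄, s₅] : Fin 6 → ℕ) i := by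
  decide +kernel

theorem dig_levelCode : ∀ d₀ < 2, ∀ d₁ < 2, ∀ d₂ < 2, ∀ d₃ < 2, ∀ d₄ < 2, ∀ i : Fin 6,
    dig (levelCode d₀ d₁ d₂ d₃ d₄) i = (![0, d₀, d₀ + d₁, d₀ + d₁ + d₂, d₀ + d₁ + d₂ + d₃,
      d₀ + d₁ + d₂ + d₃ + d₄] : Fin 6 → ℕ) i := by
  decide +kernel

theorem listOK_supports {s₁ s₂ s₃ s₄ s₅ d₀ d₁ d₂ d₃ d₄ : ℕ} (hs₁ : s₁ < 2) (hs₂ : s₂ < 2)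
    (hs₃ : s₃ < 2) (hs₄ : s₄ < 2) (hs₅ : s₅ < 2) (hd₀ : d₀ < 2) (hd₁ : d₁ < 2) (hd₂ : d₂ < 2)
    (hd₃ : d₃ < 2) (hd₄ : d₄ < 2) (hl : levelCode d₀ d₁ d₂ d₃ d₄ ≠ 0) :
    listOK (supports (signCode s₁ s₂ s₃ s₄ s₅) (levelCode d₀ d₁ d₂ d₃ d₄)) = true := by
  have h := allPatternsOK_eq
  unfold allPatternsOK at h
  simp only [List.all_eq_true, List.mem_range] at h
  have h' := h s₁ hs₁ s₂ hs₂ s₃ hs₃ s₄ hs₄ s₅ hs₅ d₀ hd₀ d₁ hd₁ d₂ hd₂ d₃ hd₃ d₄ hd₄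
  rw [Bool.or_eq_true, Nat.beq_eq] at h'
  exact h'.resolve_left hl

theorem sum_jumps_eq_iff {L : Type*} [PartialOrder L] {K : ℕ → L} (hK : Monotone K) {D : ℕ → ℕ}
    (hD : ∀ m, D m = 0 ↔ K m = K (m + 1)) {i j : ℕ} (hij : i ≤ j) :
    ∑ k ∈ Finset.range i, D k = ∑ k ∈ Finset.range j, D k ↔ K i = K j := by
  induction j, hij using Nat.le_induction with
  | base => simp
  | succ j hij ih =>
    rw [Finset.sum_range_succ]
    have h1 : ∑ k ∈ Finset.range i, D k ≤ ∑ k ∈ Finset.range j, D k :=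
      Finset.sum_le_sum_of_subset (Finset.range_subset_range.2 hij)
    constructor
    · intro h
      rw [ih.1 (by omega), (hD j).1 (by omega)]
    · intro h
      have h2 : K i = K j := le_antisymm (hK hij) (h ▸ hK j.le_succ)
      rw [ih.2 h2, (hD j).2 (h2 ▸ h)]; rfl

/-- Supports only depend on which signs agree and which keys agree, so any sorted configuration
matches one of the checked codes. -/
theorem exists_pattern {L : Type*} [PartialOrder L] (U : Fin 6 → Prop) (K : Fin 6 → L)
    (hK : Monotone K) (hne : ∃ i j, K i ≠ K j) : ∃ s l : ℕ, listOK (supports s l) = true ∧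
      (∀ i j : Fin 6, dig s i = dig s j ↔ (U i ↔ U j)) ∧
      ∀ i j : Fin 6, dig l i = dig l j ↔ K i = K j := by
  classical
  let S : Fin 6 → ℕ := fun i => if (U 0 ↔ U i) then 0 else 1
  have hS : ∀ i, S i < 2 := fun i => by dsimp only [S]; split_ifs <;> norm_num
  have hS0 : S 0 = 0 := by simp [S]
  let K' : ℕ → L := fun m => K ⟨min m 5, by omega⟩
  have hK' : Monotone K' := fun a b hab => hK (by
    rw [Fin.mk_le_mk]; omega)
  have hKK : ∀ i : Fin 6, K' i = K i := fun i => congrArg K (Fin.ext (by simp; omega))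
  let D : ℕ → ℕ := fun m => if K' m = K' (m + 1) then 0 else 1
  have hD2 : ∀ i, D i < 2 := fun i => by dsimp only [D]; split_ifs <;> norm_num
  have hD : ∀ m, D m = 0 ↔ K' m = K' (m + 1) := fun m => by simp [D]
  have hs : ∀ i : Fin 6, dig (signCode (S 1) (S 2) (S 3) (S 4) (S 5)) i = S i := by
    intro i
    rw [dig_signCode _ (hS _) _ (hS _) _ (hS _) _ (hS _) _ (hS _)]
    fin_cases i
    exacts [hS0.symm, rfl, rfl, rfl, rfl, rfl]
  have hl : ∀ i : Fin 6, dig (levelCode (D 0) (D 1) (D 2) (D 3) (D 4)) i =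
      ∑ k ∈ Finset.range i, D k := by
    intro i
    rw [dig_levelCode _ (hD2 _) _ (hD2 _) _ (hD2 _) _ (hD2 _) _ (hD2 _)]
    fin_cases i <;> simp [Finset.sum_range_succ]
  have hle : ∀ i j : Fin 6, i ≤ j → (dig (levelCode (D 0) (D 1) (D 2) (D 3) (D 4)) i =
      dig (levelCode (D 0) (D 1) (D 2) (D 3) (D 4)) j ↔ K i = K j) := by
    intro i j hij
    rw [hl, hl, sum_jumps_eq_iff hK' hD (show (i : ℕ) ≤ j from hij), hKK, hKK]
  have hlev : ∀ i j : Fin 6, dig (levelCode (D 0) (D 1) (D 2) (D 3) (D 4)) i =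
      dig (levelCode (D 0) (D 1) (D 2) (D 3) (D 4)) j ↔ K i = K j := by
    intro i j
    rcases le_total i j with hij | hij
    · exact hle i j hij
    · rw [eq_comm, hle j i hij, eq_comm]
  refine ⟨_, _, listOK_supports (hS 1) (hS 2) (hS 3) (hS 4) (hS 5) (hD2 0) (hD2 1) (hD2 2)
    (hD2 3) (hD2 4) ?_, fun i j => ?_, hlev⟩
  · intro h0
    obtain ⟨i, j, hij⟩ := hne
    apply hij
    rw [← hlev, h0]
    have : ∀ i : Fin 6, dig 0 i = 0 := by decide
    rw [this, this]
  · rw [hs, hs]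
    by_cases h0 : U 0 <;> by_cases hi : U i <;> by_cases hj : U j <;> simp [S, h0, hi, hj]

theorem mem_supports_pair {s l : ℕ} {i j : Fin 6} (hij : i < j) (hs : dig s i ≠ dig s j)
    (hl : dig l i = dig l j) : ((i : ℕ), (j : ℕ), (j : ℕ)) ∈ supports s l := by
  unfold supports
  rw [List.mem_filter]
  refine ⟨?_, ?_⟩
  · clear hs hl; revert i j; decide
  · simp only [isSupport, Nat.beq_refl, cond_true, Bool.and_eq_true, Bool.not_eq_true', Nat.beq_eq]
    rw [← Bool.not_eq_true, Nat.beq_eq]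
    exact ⟨hs, hl⟩

theorem mem_supports_triple {s l : ℕ} {i j k : Fin 6} (hij : i < j) (hjk : j < k)
    (hs : dig s i ≠ dig s j) (hs' : dig s j ≠ dig s k) (hl : dig l i ≠ dig l j)
    (hl' : dig l j ≠ dig l k) : ((i : ℕ), (j : ℕ), (k : ℕ)) ∈ supports s l := by
  unfold supports
  rw [List.mem_filter]
  have hb : ∀ {a b : ℕ}, a ≠ b → Nat.beq a b = false := fun h => by
    rw [← Bool.not_eq_true, Nat.beq_eq]; exact h
  refine ⟨?_, ?_⟩
  · clear hs hs' hl hl'; revert i j k; decide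
  · simp [isSupport, hb (show (j : ℕ) ≠ k by omega), hb hs, hb hs', hb hl, hb hl']

theorem mem_supports_cases {s l : ℕ} {t : ℕ × ℕ × ℕ} (ht : t ∈ supports s l) :
    (∃ i j : Fin 6, i < j ∧ t = (↑i, ↑j, ↑j) ∧ dig s i ≠ dig s j ∧ dig l i = dig l j) ∨
    ∃ i j k : Fin 6, i < j ∧ j < k ∧ t = (↑i, ↑j, ↑k) ∧ dig s i ≠ dig s j ∧ dig s j ≠ dig s k ∧
      dig l i ≠ dig l j ∧ dig l j ≠ dig l k := by
  unfold supports at ht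
  rw [List.mem_filter] at ht
  obtain ⟨h1, h2⟩ := ht
  have hb : ∀ {a b : ℕ}, Nat.beq a b = false → a ≠ b := fun h => by
    rwa [← Bool.not_eq_true, Nat.beq_eq] at h
  have hc : ∀ t ∈ supportTriples, (∃ i j : Fin 6, i < j ∧ t = (↑i, ↑j, ↑j)) ∨
      ∃ i j k : Fin 6, i < j ∧ j < k ∧ t = (↑i, ↑j, ↑k) := by decide +kernel
  rcases hc t h1 with ⟨i, j, hij, rfl⟩ | ⟨i, j, k, hij, hjk, rfl⟩
  · simp only [isSupport, Nat.beq_refl, cond_true, Bool.and_eq_true, Bool.not_eq_true', Nat.beq_eq]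
      at h2
    exact Or.inl ⟨i, j, hij, rfl, hb h2.1, h2.2⟩
  · have hn : Nat.beq (j : ℕ) k = false := by
      rw [← Bool.not_eq_true, Nat.beq_eq]; omega
    simp only [isSupport, hn, cond_false, Bool.and_eq_true, Bool.not_eq_true'] at h2
    exact Or.inr ⟨i, j, k, hij, hjk, rfl, hb h2.1.1.1, hb h2.1.1.2, hb h2.1.2, hb h2.2⟩

theorem supports_nodup (s l : ℕ) : (supports s l).Nodup := by
  have : supportTriples.Nodup := by decide +kernel
  exact this.filter _

theorem eq_of_tightAt {s l : ℕ} {t t' : ℕ × ℕ × ℕ} (ht : t ∈ supports s l) (ht' : t' ∈ supports s l)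
    (h : ∀ m : Fin 6, tightAt m t = tightAt m t') : t = t' := by
  have : ∀ t ∈ supportTriples, ∀ t' ∈ supportTriples,
    (∀ m : Fin 6, tightAt m t = tightAt m t') → t = t' := by decide +kernel
  exact this t (List.mem_filter.1 ht).1 t' (List.mem_filter.1 ht').1 h

/-! ### Two slack relations: positive circuits of a plane Gale diagram. -/

section TwoRelations

variable {E : Type*} [AddCommGroup E] [Module ℝ E] {n : ℕ} {σ : Fin n → E →ₗ[ℝ] ℝ}
  {h : E →ₗ[ℝ] ℝ} {α β : Fin n → ℝ}

/-- A positive relation with unique coefficients yields an extreme ray. -/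
theorem exists_ray_of_relation (hpos : ConePos σ h)
    (ha : ∀ s : Fin n → ℝ, (∃ x, ∀ i, σ i x = s i) ↔ ∑ i, α i * s i = 0 ∧ ∑ i, β i * s i = 0)
    {T : Finset (Fin n)} (hT : T.Nonempty) {c : Fin n → ℝ} (hc : ∀ i ∈ T, 0 < c i)
    (hα : ∑ i ∈ T, α i * c i = 0) (hβ : ∑ i ∈ T, β i * c i = 0)
    (huniq : ∀ s : Fin n → ℝ, ∑ i ∈ T, α i * s i = 0 → ∑ i ∈ T, β i * s i = 0 →
      ∃ k : ℝ, ∀ i ∈ T, s i = k * c i) :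
    ∃ x, IsRay σ h x ∧ ∀ i, σ i x = 0 ↔ i ∉ T := by
  classical
  have hsum : ∀ (γ s : Fin n → ℝ), (∀ i ∉ T, s i = 0) → ∑ i, γ i * s i = ∑ i ∈ T, γ i * s i := by
    intro γ s hs
    symm
    refine Finset.sum_subset (Finset.subset_univ _) fun i _ hi => ?_
    rw [hs i hi, mul_zero]
  let c' : Fin n → ℝ := fun i => if i ∈ T then c i else 0
  have hc' : ∀ i ∉ T, c' i = 0 := fun i hi => if_neg hi
  have hcT : ∀ i ∈ T, c' i = c i := fun i hi => if_pos hi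
  obtain ⟨x, hx⟩ := (ha c').2 ⟨by
    rw [hsum α c' hc', ← hα]
    exact Finset.sum_congr rfl fun i hi => by rw [hcT i hi], by
    rw [hsum β c' hc', ← hβ]
    exact Finset.sum_congr rfl fun i hi => by rw [hcT i hi]⟩
  have hx0 : ∀ i, σ i x = 0 ↔ i ∉ T := by
    intro i
    rw [hx]
    refine ⟨fun h0 hi => ?_, hc' i⟩
    rw [hcT i hi] at h0
    exact (hc i hi).ne' h0
  have hnn : ∀ i, 0 ≤ σ i x := by
    intro i
    rw [hx]
    by_cases hi : i ∈ T
    · rw [hcT i hi]; exact (hc i hi).le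
    · rw [hc' i hi]
  have hne : x ≠ 0 := by
    rintro rfl
    obtain ⟨i, hi⟩ := hT
    exact (hx0 i).1 (map_zero _) hi
  have hp := hpos x hnn hne
  refine ⟨_, isRay_of_minimal hpos hnn hne fun y hy => ?_, fun i => ?_⟩
  · have hy' : ∀ i ∉ T, σ i y = 0 := fun i hi => hy i ((hx0 i).2 hi)
    obtain ⟨r1, r2⟩ := (ha fun i => σ i y).1 ⟨y, fun _ => rfl⟩
    rw [hsum _ _ hy'] at r1 r2
    obtain ⟨k, hk⟩ := huniq _ r1 r2
    refine ⟨k, ?_⟩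
    rw [← sub_eq_zero]
    refine hpos.injective fun i => ?_
    rw [map_sub, map_smul, smul_eq_mul]
    by_cases hi : i ∈ T
    · rw [hk i hi, hx, hcT i hi, sub_self]
    · rw [hy' i hi, (hx0 i).2 hi]; simp
  · rw [map_smul, smul_eq_zero, ← hx0 i]
    exact or_iff_right (inv_ne_zero hp.ne')

theorem exists_ray_triple (hpos : ConePos σ h)
    (ha : ∀ s : Fin n → ℝ, (∃ x, ∀ i, σ i x = s i) ↔ ∑ i, α i * s i = 0 ∧ ∑ i, β i * s i = 0)
    {p q r : Fin n} (hpq : 0 < α p * β q - β p * α q) (hqr : 0 < α q * β r - β q * α r)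
    (hrp : 0 < α r * β p - β r * α p) :
    ∃ x, IsRay σ h x ∧ ∀ i, σ i x = 0 ↔ i ≠ p ∧ i ≠ q ∧ i ≠ r := by
  classical
  have npq : p ≠ q := by rintro rfl; linarith
  have nqr : q ≠ r := by rintro rfl; linarith
  have npr : p ≠ r := by rintro rfl; linarith
  have hsum : ∀ f : Fin n → ℝ, ∑ i ∈ ({p, q, r} : Finset (Fin n)), f i = f p + f q + f r := by
    intro f
    rw [Finset.sum_insert (by simp [npq, npr]), Finset.sum_pair nqr, add_assoc]
  obtain ⟨x, hx, hx'⟩ := exists_ray_of_relation hpos ha (T := {p, q, r}) ⟨p, by simp⟩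
    -- Cramer's rule: the coefficients of the relation among three plane vectors are the
    -- complementary determinants.
    (c := fun i => if i = p then α q * β r - β q * α r else if i = q then α r * β p - β r * α p
      else α p * β q - β p * α q) (fun i _ => by split_ifs <;> assumption)
    (by rw [hsum]; simp [npq.symm, npr.symm, nqr.symm]; ring)
    (by rw [hsum]; simp [npq.symm, npr.symm, nqr.symm]; ring) (by
      intro s h1 h2
      rw [hsum] at h1 h2
      refine ⟨s p / (α q * β r - β q * α r), fun i hi => ?_⟩
      have h0 := hqr.ne'
      simp only [Finset.mem_insert, Finset.mem_singleton] at hi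
      rcases hi with rfl | rfl | rfl
      · simp; field_simp
      · simp [npq.symm]; field_simp
        linear_combination β r * h1 - α r * h2
      · simp [npr.symm, nqr.symm]; field_simp
        linear_combination α q * h2 - β q * h1)
  exact ⟨x, hx, fun i => by rw [hx']; simp⟩

theorem exists_ray_pair (hpos : ConePos σ h)
    (ha : ∀ s : Fin n → ℝ, (∃ x, ∀ i, σ i x = s i) ↔ ∑ i, α i * s i = 0 ∧ ∑ i, β i * s i = 0)
    {p q : Fin n} (npq : p ≠ q) {c d : ℝ} (hc : 0 < c) (hd : 0 < d)
    (h1 : α p * c + α q * d = 0) (h2 : β p * c + β q * d = 0) (h0 : α q ≠ 0 ∨ β q ≠ 0) :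
    ∃ x, IsRay σ h x ∧ ∀ i, σ i x = 0 ↔ i ≠ p ∧ i ≠ q := by
  classical
  have hsum : ∀ f : Fin n → ℝ, ∑ i ∈ ({p, q} : Finset (Fin n)), f i = f p + f q :=
    fun f => Finset.sum_pair npq
  obtain ⟨x, hx, hx'⟩ := exists_ray_of_relation hpos ha (T := {p, q}) ⟨p, by simp⟩
    (c := fun i => if i = p then c else d) (fun i _ => by split_ifs <;> assumption)
    (by rw [hsum]; simpa [npq.symm] using h1)
    (by rw [hsum]; simpa [npq.symm] using h2) (by
      intro s h3 h4
      rw [hsum] at h3 h4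
      refine ⟨s p / c, fun i hi => ?_⟩
      simp only [Finset.mem_insert, Finset.mem_singleton] at hi
      rcases hi with rfl | rfl
      · simp; field_simp
      · simp [npq.symm]; field_simp
        rcases h0 with h0 | h0
        · apply mul_left_cancel₀ h0
          linear_combination c * h3 - s p * h1
        · apply mul_left_cancel₀ h0
          linear_combination c * h4 - s p * h2)
  exact ⟨x, hx, fun i => by rw [hx']; simp⟩

end TwoRelations

theorem Upper.exists_parallel {x y x' y' : ℝ} (hu : Upper x y) (hu' : Upper x' y')
    (hd : x * y' - y * x' = 0) : ∃ c d : ℝ, 0 < c ∧ 0 < d ∧ x * c = x' * d ∧ y * c = y' * d := by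
  rcases hu with hy | ⟨hy, hx⟩ <;> rcases hu' with hy' | ⟨hy', hx'⟩
  · exact ⟨y', y, hy', hy, by linarith, by ring⟩
  · subst hy'
    have : y * x' ≠ 0 := (mul_pos hy hx').ne'
    exact absurd (by linarith) this
  · subst hy
    have : x * y' ≠ 0 := (mul_pos hx hy').ne'
    exact absurd (by linarith) this
  · exact ⟨x', x, hx', hx, by ring, by rw [hy, hy']; ring⟩

/-- The second coordinates are nonnegative, so all vanish; the first coordinates are then all
positive. -/
theorem sum_upper_ne_zero {ι : Type*} {T : Finset ι} (hT : T.Nonempty) {a b s : ι → ℝ}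
    (hu : ∀ i ∈ T, Upper (a i) (b i)) (hs : ∀ i ∈ T, 0 < s i) (h1 : ∑ i ∈ T, a i * s i = 0)
    (h2 : ∑ i ∈ T, b i * s i = 0) : False := by
  have hb : ∀ i ∈ T, 0 ≤ b i * s i := fun i hi => mul_nonneg (by
    rcases hu i hi with h | ⟨h, -⟩
    · exact h.le
    · exact h.ge) (hs i hi).le
  have hb0 := (Finset.sum_eq_zero_iff_of_nonneg hb).1 h2
  have ha : ∀ i ∈ T, 0 < a i * s i := fun i hi => by
    rcases hu i hi with h | ⟨-, h⟩
    · exact absurd (hb0 i hi) (mul_pos h (hs i hi)).ne'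
    · exact mul_pos h (hs i hi)
  exact (Finset.sum_pos ha hT).ne' h1

section Sorted

variable {E : Type*} [AddCommGroup E] [Module ℝ E] {n : ℕ} {σ : Fin n → E →ₗ[ℝ] ℝ}
  {h : E →ₗ[ℝ] ℝ} {α β a b : Fin n → ℝ} {U : Fin n → Prop}

/-- Without an opposite pair or an alternating triple in the support, all vectors of the sign of the
first index precede all those of the other sign. The line through the first vector of the other sign
then has the whole support weakly on one side, with the first index strictly there, so no positive
relation exists. -/
theorem exists_alternating_of_relation (hu : ∀ i, Upper (a i) (b i))
    (hU : ∀ i, (U i → α i = a i ∧ β i = b i) ∧ (¬ U i → α i = -a i ∧ β i = -b i))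
    (hK : Monotone fun i => angleKey (a i) (b i)) {s : Fin n → ℝ} (hs : ∀ i, 0 ≤ s i)
    (hs0 : ∃ i, s i ≠ 0) (h1 : ∑ i, α i * s i = 0) (h2 : ∑ i, β i * s i = 0) :
    (∃ i j, i < j ∧ s i ≠ 0 ∧ s j ≠ 0 ∧ ¬ (U i ↔ U j) ∧
      angleKey (a i) (b i) = angleKey (a j) (b j)) ∨
    ∃ i j k, i < j ∧ j < k ∧ s i ≠ 0 ∧ s j ≠ 0 ∧ s k ≠ 0 ∧ ¬ (U i ↔ U j) ∧ ¬ (U j ↔ U k) ∧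
      angleKey (a i) (b i) < angleKey (a j) (b j) ∧ angleKey (a j) (b j) < angleKey (a k) (b k) := by
  classical
  by_contra hcon
  rw [not_or] at hcon
  obtain ⟨hc1, hc2⟩ := hcon
  push Not at hc1 hc2
  let T := Finset.univ.filter fun i => s i ≠ 0
  have hT : ∀ i, i ∈ T ↔ s i ≠ 0 := fun i => by simp [T]
  have hTne : T.Nonempty := by obtain ⟨i, hi⟩ := hs0; exact ⟨i, (hT i).2 hi⟩
  have spos : ∀ i ∈ T, 0 < s i := fun i hi => lt_of_le_of_ne (hs i) ((hT i).1 hi).symm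
  have hsum : ∀ γ : Fin n → ℝ, ∑ i, γ i * s i = ∑ i ∈ T, γ i * s i := by
    intro γ
    symm
    refine Finset.sum_subset (Finset.subset_univ _) fun i _ hi => ?_
    rw [hT, not_not] at hi
    rw [hi, mul_zero]
  let i₀ := T.min' hTne
  have hi₀ : i₀ ∈ T := T.min'_mem hTne
  let O := T.filter fun i => ¬ (U i₀ ↔ U i)
  rcases O.eq_empty_or_nonempty with hO | hO
  · have same : ∀ i ∈ T, (U i₀ ↔ U i) := fun i hi => by
      by_contra hc
      have : i ∈ O := Finset.mem_filter.2 ⟨hi, hc⟩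
      rw [hO] at this
      simp at this
    rw [hsum] at h1 h2
    by_cases hU0 : U i₀
    · refine sum_upper_ne_zero hTne (fun i _ => hu i) spos (h1 ▸ ?_) (h2 ▸ ?_)
      · exact Finset.sum_congr rfl fun i hi => by rw [((hU i).1 ((same i hi).1 hU0)).1]
      · exact Finset.sum_congr rfl fun i hi => by rw [((hU i).1 ((same i hi).1 hU0)).2]
    · refine sum_upper_ne_zero hTne (fun i _ => hu i) spos (neg_eq_zero.1 (h1 ▸ ?_))
        (neg_eq_zero.1 (h2 ▸ ?_)) <;> rw [← Finset.sum_neg_distrib]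
      · exact Finset.sum_congr rfl fun i hi => by
          rw [((hU i).2 fun hc => hU0 ((same i hi).2 hc)).1, neg_mul]
      · exact Finset.sum_congr rfl fun i hi => by
          rw [((hU i).2 fun hc => hU0 ((same i hi).2 hc)).2, neg_mul]
  · let j₀ := O.min' hO
    have hj₀ := Finset.mem_filter.1 (O.min'_mem hO)
    have hjT : j₀ ∈ T := hj₀.1
    have hjU : ¬ (U i₀ ↔ U j₀) := hj₀.2
    have strict : ∀ i ∈ T, ∀ j ∈ T, i < j → ¬ (U i ↔ U j) →
        angleKey (a i) (b i) < angleKey (a j) (b j) := fun i hi j hj hij hne =>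
      lt_of_le_of_ne (hK hij.le) (hc1 i j hij ((hT i).1 hi) ((hT j).1 hj) (by tauto))
    have hij : i₀ < j₀ := lt_of_le_of_ne (T.min'_le _ hjT) (by
      intro he; exact hjU (by rw [← he]))
    -- An index of the first sign after `j₀` would complete an alternating triple.
    have before : ∀ i ∈ T, (U i₀ ↔ U i) → i < j₀ := by
      intro k hk hkU
      by_contra hlt
      have hjk : j₀ < k := lt_of_le_of_ne (not_lt.1 hlt) (by
        rintro rfl; exact hjU hkU)
      have e1 := strict _ hi₀ _ hjT hij hjU
      have e2 := strict _ hjT _ hk hjk (by tauto)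
      exact absurd e2 (not_lt.2 (hc2 _ _ _ hij hjk ((hT _).1 hi₀) ((hT _).1 hjT) ((hT _).1 hk)
        (by tauto) (by tauto) e1))
    have after : ∀ i ∈ T, ¬ (U i₀ ↔ U i) → j₀ ≤ i := fun i hi hiU =>
      O.min'_le i (Finset.mem_filter.2 ⟨hi, hiU⟩)
    have hcross : ∑ i ∈ T, (a j₀ * β i - b j₀ * α i) * s i = 0 := by
      rw [hsum] at h1 h2
      simp only [sub_mul, Finset.sum_sub_distrib, mul_assoc, ← Finset.mul_sum, h1, h2]; ring
    have d1 : ∀ i ∈ T, (U i₀ ↔ U i) → a j₀ * b i - b j₀ * a i < 0 := by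
      intro i hi hiU
      have := angleKey_lt (hu i) (hu j₀) (strict i hi j₀ hjT (before i hi hiU) (by tauto))
      linarith
    have d2 : ∀ i ∈ T, ¬ (U i₀ ↔ U i) → 0 ≤ a j₀ * b i - b j₀ * a i := fun i hi hiU =>
      angleKey_le (hu j₀) (hu i) (hK (after i hi hiU))
    by_cases hU0 : U i₀
    · refine (Finset.sum_neg' (s := T) (f := fun i => (a j₀ * β i - b j₀ * α i) * s i)
        (fun i hi => ?_) ⟨i₀, hi₀, ?_⟩).ne hcross
      · by_cases hi' : U i
        · rw [((hU i).1 hi').1, ((hU i).1 hi').2]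
          exact (mul_neg_of_neg_of_pos (d1 i hi (by tauto)) (spos i hi)).le
        · rw [((hU i).2 hi').1, ((hU i).2 hi').2]
          have := mul_nonneg (d2 i hi (by tauto)) (spos i hi).le
          linarith
      · rw [((hU i₀).1 hU0).1, ((hU i₀).1 hU0).2]
        exact mul_neg_of_neg_of_pos (d1 i₀ hi₀ Iff.rfl) (spos i₀ hi₀)
    · refine (Finset.sum_pos' (s := T) (f := fun i => (a j₀ * β i - b j₀ * α i) * s i)
        (fun i hi => ?_) ⟨i₀, hi₀, ?_⟩).ne' hcross
      · by_cases hi' : U i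
        · rw [((hU i).1 hi').1, ((hU i).1 hi').2]
          exact mul_nonneg (d2 i hi (by tauto)) (spos i hi).le
        · rw [((hU i).2 hi').1, ((hU i).2 hi').2]
          have := mul_neg_of_neg_of_pos (d1 i hi (by tauto)) (spos i hi)
          linarith
      · rw [((hU i₀).2 hU0).1, ((hU i₀).2 hU0).2]
        have := mul_neg_of_neg_of_pos (d1 i₀ hi₀ Iff.rfl) (spos i₀ hi₀)
        linarith

/-- Reversing the middle one of three vectors sorted by angle makes the triple positively spanning,
with cyclic order i, k, j. -/
theorem exists_ray_alternating (hpos : ConePos σ h)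
    (ha : ∀ s : Fin n → ℝ, (∃ x, ∀ i, σ i x = s i) ↔ ∑ i, α i * s i = 0 ∧ ∑ i, β i * s i = 0)
    (hu : ∀ i, Upper (a i) (b i))
    (hU : ∀ i, (U i → α i = a i ∧ β i = b i) ∧ (¬ U i → α i = -a i ∧ β i = -b i)) {i j k : Fin n}
    (hij : ¬ (U i ↔ U j)) (hjk : ¬ (U j ↔ U k)) (kij : angleKey (a i) (b i) < angleKey (a j) (b j))
    (kjk : angleKey (a j) (b j) < angleKey (a k) (b k)) :
    ∃ x, IsRay σ h x ∧ ∀ m, σ m x = 0 ↔ m ≠ i ∧ m ≠ j ∧ m ≠ k := by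
  have d1 := angleKey_lt (hu i) (hu j) kij
  have d2 := angleKey_lt (hu j) (hu k) kjk
  have d3 := angleKey_lt (hu i) (hu k) (kij.trans kjk)
  have : ∃ x, IsRay σ h x ∧ ∀ m, σ m x = 0 ↔ m ≠ i ∧ m ≠ k ∧ m ≠ j := by
    by_cases hi : U i
    · have hj : ¬ U j := by tauto
      have hk : U k := by tauto
      obtain ⟨ai, bi⟩ := (hU i).1 hi
      obtain ⟨aj, bj⟩ := (hU j).2 hj
      obtain ⟨ak, bk⟩ := (hU k).1 hk
      apply exists_ray_triple hpos ha <;> simp only [ai, bi, aj, bj, ak, bk] <;> linarith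
    · have hj : U j := by tauto
      have hk : ¬ U k := by tauto
      obtain ⟨ai, bi⟩ := (hU i).2 hi
      obtain ⟨aj, bj⟩ := (hU j).1 hj
      obtain ⟨ak, bk⟩ := (hU k).2 hk
      apply exists_ray_triple hpos ha <;> simp only [ai, bi, aj, bj, ak, bk] <;> linarith
  obtain ⟨x, hx, hx'⟩ := this
  exact ⟨x, hx, fun m => by rw [hx' m]; tauto⟩

theorem exists_ray_opposite (hpos : ConePos σ h)
    (ha : ∀ s : Fin n → ℝ, (∃ x, ∀ i, σ i x = s i) ↔ ∑ i, α i * s i = 0 ∧ ∑ i, β i * s i = 0)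
    (hu : ∀ i, Upper (a i) (b i))
    (hU : ∀ i, (U i → α i = a i ∧ β i = b i) ∧ (¬ U i → α i = -a i ∧ β i = -b i)) {i j : Fin n}
    (hij : ¬ (U i ↔ U j)) (kij : angleKey (a i) (b i) = angleKey (a j) (b j)) :
    ∃ x, IsRay σ h x ∧ ∀ m, σ m x = 0 ↔ m ≠ i ∧ m ≠ j := by
  obtain ⟨c, d, hc, hd, e1, e2⟩ := (hu i).exists_parallel (hu j) (angleKey_eq (hu i) (hu j) kij)
  have hne : i ≠ j := by rintro rfl; exact hij Iff.rfl
  have h0 : a j ≠ 0 ∨ b j ≠ 0 := by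
    rcases hu j with h0 | h0
    exacts [Or.inr h0.ne', Or.inl h0.2.ne']
  by_cases hi : U i
  · have hj : ¬ U j := by tauto
    refine exists_ray_pair hpos ha hne hc hd ?_ ?_ ?_
    · rw [((hU _).1 hi).1, ((hU _).2 hj).1]; linarith
    · rw [((hU _).1 hi).2, ((hU _).2 hj).2]; linarith
    · rw [((hU _).2 hj).1, ((hU _).2 hj).2, neg_ne_zero, neg_ne_zero]; exact h0
  · have hj : U j := by tauto
    refine exists_ray_pair hpos ha hne hc hd ?_ ?_ ?_
    · rw [((hU _).2 hi).1, ((hU _).1 hj).1]; linarith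
    · rw [((hU _).2 hi).2, ((hU _).1 hj).2]; linarith
    · rw [((hU _).1 hj).1, ((hU _).1 hj).2]; exact h0

end Sorted

theorem IsRay.reindex {E ι κ : Type*} [AddCommGroup E] [Module ℝ E] {σ : ι → E →ₗ[ℝ] ℝ}
    {h : E →ₗ[ℝ] ℝ} (τ : κ ≃ ι) {x : E} : IsRay (fun i => σ (τ i)) h x ↔ IsRay σ h x := by
  constructor
  · intro hx
    refine ⟨hx.one, fun i => ?_, fun y hy => hx.minimal y fun i hi => hy (τ i) hi⟩
    have := hx.nonneg (τ.symm i)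
    rwa [τ.apply_symm_apply] at this
  · intro hx
    refine ⟨hx.one, fun i => hx.nonneg (τ i), fun y hy => hx.minimal y fun i hi => ?_⟩
    have := hy (τ.symm i)
    rw [τ.apply_symm_apply] at this
    exact this hi

theorem tightAt_iff {m i j k : Fin 6} :
    tightAt m ((i : ℕ), (j : ℕ), (k : ℕ)) = true ↔ m ≠ i ∧ m ≠ j ∧ m ≠ k := by
  simp [tightAt, ← Bool.not_eq_true, Fin.ext_iff, and_assoc]

/-- The listed supports give rays, and every ray appears: its slack vector is a positive relation,
hence contains a listed support, and a ray is determined by any listed ray supported inside its own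
support. -/
theorem exists_ray_list_of_monotone {E : Type*} [AddCommGroup E] [Module ℝ E]
    {σ : Fin 6 → E →ₗ[ℝ] ℝ} {h : E →ₗ[ℝ] ℝ} (hpos : ConePos σ h) {α β a b : Fin 6 → ℝ}
    {U : Fin 6 → Prop}
    (ha : ∀ s : Fin 6 → ℝ, (∃ x, ∀ i, σ i x = s i) ↔ ∑ i, α i * s i = 0 ∧ ∑ i, β i * s i = 0)
    (hu : ∀ i, Upper (a i) (b i))
    (hU : ∀ i, (U i → α i = a i ∧ β i = b i) ∧ (¬ U i → α i = -a i ∧ β i = -b i))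
    (hK : Monotone fun i => angleKey (a i) (b i))
    (hne : ∃ i j, angleKey (a i) (b i) ≠ angleKey (a j) (b j)) :
    ∃ (S : List (ℕ × ℕ × ℕ)) (X : ℕ × ℕ × ℕ → E), listOK S = true ∧ S.Nodup ∧
      (∀ t ∈ S, IsRay σ h (X t)) ∧ (∀ x, IsRay σ h x → ∃ t ∈ S, X t = x) ∧
      Set.InjOn X {t | t ∈ S} ∧ ∀ t ∈ S, ∀ m : Fin 6, σ m (X t) = 0 ↔ tightAt m t = true := by
  classical
  obtain ⟨s, l, hok, hs, hl⟩ := exists_pattern U _ hK hne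
  have hex : ∀ t, ∃ x, t ∈ supports s l → IsRay σ h x ∧
      ∀ m : Fin 6, σ m x = 0 ↔ tightAt m t = true := by
    intro t
    by_cases ht : t ∈ supports s l
    swap
    · exact ⟨0, fun h' => absurd h' ht⟩
    rcases mem_supports_cases ht with ⟨i, j, hij, rfl, h1, h2⟩ |
      ⟨i, j, k, hij, hjk, rfl, h1, h2, h3, h4⟩
    · obtain ⟨x, hx, hx'⟩ := exists_ray_opposite hpos ha hu hU (mt (hs i j).2 h1) ((hl i j).1 h2)
      exact ⟨x, fun _ => ⟨hx, fun m => by rw [hx', tightAt_iff]; tauto⟩⟩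
    · obtain ⟨x, hx, hx'⟩ := exists_ray_alternating hpos ha hu hU (mt (hs i j).2 h1)
        (mt (hs j k).2 h2) (lt_of_le_of_ne (hK hij.le) (mt (hl i j).2 h3))
        (lt_of_le_of_ne (hK hjk.le) (mt (hl j k).2 h4))
      exact ⟨x, fun _ => ⟨hx, fun m => by rw [hx', tightAt_iff]⟩⟩
  choose X hX using hex
  refine ⟨supports s l, X, hok, supports_nodup s l, fun t ht => (hX t ht).1, fun x hx => ?_,
    fun t ht t' ht' he => ?_, fun t ht => (hX t ht).2⟩
  · obtain ⟨r1, r2⟩ := (ha fun i => σ i x).1 ⟨x, fun _ => rfl⟩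
    have hx0 : ∃ i, σ i x ≠ 0 := by
      by_contra hcon; push Not at hcon
      exact hx.ne_zero (hpos.injective hcon)
    have fin : ∀ i j k : Fin 6, ((i : ℕ), (j : ℕ), (k : ℕ)) ∈ supports s l → σ i x ≠ 0 →
        σ j x ≠ 0 → σ k x ≠ 0 → ∃ t ∈ supports s l, X t = x := by
      intro i j k ht hi hj hk
      refine ⟨_, ht, hx.eq_of_support (hX _ ht).1 fun m hm => ?_⟩
      rw [(hX _ ht).2, tightAt_iff]
      refine ⟨?_, ?_, ?_⟩ <;> rintro rfl <;> contradiction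
    rcases exists_alternating_of_relation hu hU hK hx.nonneg hx0 r1 r2 with
      ⟨i, j, hij, si, sj, hne', hk⟩ | ⟨i, j, k, hij, hjk, si, sj, sk, n1, n2, k1, k2⟩
    · exact fin i j j (mem_supports_pair hij (mt (hs i j).1 hne') ((hl i j).2 hk)) si sj sj
    · exact fin i j k (mem_supports_triple hij hjk (mt (hs i j).1 n1) (mt (hs j k).1 n2)
        (mt (hl i j).1 k1.ne) (mt (hl j k).1 k2.ne)) si sj sk
  · refine eq_of_tightAt ht ht' fun m => ?_
    rw [Bool.eq_iff_iff, ← (hX t ht).2, ← (hX t' ht').2, he]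

/-- The supports of the extreme rays of a cone with six inequalities in dimension four. -/
theorem exists_ray_list {E : Type*} [AddCommGroup E] [Module ℝ E]
    {σ : Fin 6 → E →ₗ[ℝ] ℝ} {h : E →ₗ[ℝ] ℝ} (hpos : ConePos σ h) {α β : Fin 6 → ℝ}
    (ha : ∀ s : Fin 6 → ℝ, (∃ x, ∀ i, σ i x = s i) ↔ ∑ i, α i * s i = 0 ∧ ∑ i, β i * s i = 0)
    (hnz : ∀ i, α i ≠ 0 ∨ β i ≠ 0) (hrk : ∃ i j, α i * β j - β i * α j ≠ 0) :
    ∃ (τ : Equiv.Perm (Fin 6)) (S : List (ℕ × ℕ × ℕ)) (X : ℕ × ℕ × ℕ → E), listOK S = true ∧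
      S.Nodup ∧ (∀ t ∈ S, IsRay σ h (X t)) ∧ (∀ x, IsRay σ h x → ∃ t ∈ S, X t = x) ∧
      Set.InjOn X {t | t ∈ S} ∧ ∀ t ∈ S, ∀ m : Fin 6, σ (τ m) (X t) = 0 ↔ tightAt m t = true := by
  classical
  -- Each vector is reflected into the upper half plane, U recording whether this was unnecessary;
  -- the indices are then sorted by angle.
  let U : Fin 6 → Prop := fun i => Upper (α i) (β i)
  let a : Fin 6 → ℝ := fun i => if U i then α i else -α i
  let b : Fin 6 → ℝ := fun i => if U i then β i else -β i
  have hU : ∀ i, (U i → α i = a i ∧ β i = b i) ∧ (¬ U i → α i = -a i ∧ β i = -b i) :=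
    fun i => ⟨fun hi => by simp [a, b, hi], fun hi => by simp [a, b, hi]⟩
  have hu : ∀ i, Upper (a i) (b i) := by
    intro i
    by_cases hi : U i
    · rw [← ((hU i).1 hi).1, ← ((hU i).1 hi).2]; exact hi
    · have ea : a i = -α i := by simp [a, hi]
      have eb : b i = -β i := by simp [b, hi]
      rw [ea, eb]
      have hi' : ¬ Upper (α i) (β i) := hi
      unfold Upper at hi' ⊢
      push Not at hi'
      rcases hi'.1.lt_or_eq with h1 | h1
      · left; linarith
      · right
        refine ⟨by linarith, ?_⟩
        have h2 := hi'.2 h1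
        have h3 : α i ≠ 0 := (hnz i).resolve_right (not_not.2 h1)
        have := lt_of_le_of_ne h2 h3
        linarith
  let τ := Tuple.sort fun i => angleKey (a i) (b i)
  have hτ : Monotone ((fun i => angleKey (a i) (b i)) ∘ τ) := Tuple.monotone_sort _
  obtain ⟨S, X, h1, h2, h3, h4, h5, h6⟩ := exists_ray_list_of_monotone
    (σ := fun i => σ (τ i)) (h := h) (α := fun i => α (τ i)) (β := fun i => β (τ i))
    (a := fun i => a (τ i)) (b := fun i => b (τ i)) (U := fun i => U (τ i))
    (fun x hx => hpos x fun i => by simpa using hx (τ.symm i)) (by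
      intro s
      have e1 : ∀ γ : Fin 6 → ℝ, ∑ i, γ (τ i) * s i = ∑ i, γ i * s (τ.symm i) := by
        intro γ
        rw [← Equiv.sum_comp τ fun i => γ i * s (τ.symm i)]
        simp
      rw [e1, e1, ← ha]
      constructor
      · rintro ⟨x, hx⟩; exact ⟨x, fun i => by simpa using hx (τ.symm i)⟩
      · rintro ⟨x, hx⟩; exact ⟨x, fun i => by simpa using hx (τ i)⟩)
    (fun i => hu _) (fun i => hU _) hτ (by
      by_contra hcon
      push Not at hcon
      obtain ⟨i, j, hij⟩ := hrk
      have := hcon (τ.symm i) (τ.symm j)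
      simp only [Equiv.apply_symm_apply] at this
      have hd := angleKey_eq (hu i) (hu j) this
      apply hij
      by_cases hi : U i <;> by_cases hj : U j
      · simp only [(hU i).1 hi, (hU j).1 hj]; linarith
      · simp only [(hU i).1 hi, (hU j).2 hj]; linarith
      · simp only [(hU i).2 hi, (hU j).1 hj]; linarith
      · simp only [(hU i).2 hi, (hU j).2 hj]; linarith)
  exact ⟨τ, S, X, h1, h2, fun t ht => (IsRay.reindex τ).1 (h3 t ht),
    fun x hx => h4 x ((IsRay.reindex τ).2 hx), h5, h6⟩

/-! ### Incidence contradictions for three-dimensional extensions. -/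

theorem vertices_indep {P : Set (Fin 2 → ℝ)} (hP : Convex ℝ P) {a b c : Fin 2 → ℝ}
    (ha : a ∈ vertices P) (hb : b ∈ vertices P) (hc : c ∈ vertices P) (hab : a ≠ b) (hac : a ≠ c)
    (hbc : b ≠ c) {r s t : ℝ} (h1 : r + s + t = 0) (h2 : r • a + s • b + t • c = 0) :
    r = 0 ∧ s = 0 ∧ t = 0 := by
  have hbr := br_ne_zero hP ha hb hc hab hac hbc
  have e0 := congrFun h2 0
  have e1 := congrFun h2 1
  simp only [Pi.add_apply, Pi.smul_apply, smul_eq_mul, Pi.zero_apply] at e0 e1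
  obtain rfl : r = -s - t := by linarith
  unfold br at hbr
  have hs : s = 0 := by
    apply (mul_eq_zero.1 (_ : s * _ = 0)).resolve_right hbr
    linear_combination (c 1 - a 1) * e0 - (c 0 - a 0) * e1
  have ht : t = 0 := by
    apply (mul_eq_zero.1 (_ : t * _ = 0)).resolve_right hbr
    linear_combination (b 0 - a 0) * e1 - (b 1 - a 1) * e0
  subst hs ht
  simp

section Meet

variable {E : Type*} [AddCommGroup E] [Module ℝ E]
  {h : E →ₗ[ℝ] ℝ} {π : E →ₗ[ℝ] (Fin 2 → ℝ)} {P : Set (Fin 2 → ℝ)} {K : Submodule ℝ E}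

theorem map_combo_mem_lineThrough {O u v : E} (hO : ∃ s t : ℝ, s + t = 1 ∧ O = s • u + t • v) :
    π O ∈ lineThrough (π u) (π v) := by
  obtain ⟨s, t, hst, rfl⟩ := hO
  rw [map_add, map_smul, map_smul]
  exact mem_lineThrough hst

theorem combo_mem {O u v : E} (hO : ∃ s t : ℝ, s + t = 1 ∧ O = s • u + t • v) (hu : u ∈ K)
    (hv : v ∈ K) : O ∈ K := by
  obtain ⟨s, t, -, rfl⟩ := hO
  exact K.add_mem (K.smul_mem _ hu) (K.smul_mem _ hv)

variable [FiniteDimensional ℝ E]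

/-- More vectors than the dimension of a subspace containing them are linearly dependent. -/
theorem exists_relation_of_finrank_lt {n : ℕ} {v : Fin n → E} (hv : ∀ i, v i ∈ K)
    (hK : Module.finrank ℝ K < n) : ∃ c : Fin n → ℝ, ∑ i, c i • v i = 0 ∧ ∃ i, c i ≠ 0 := by
  have hli : ¬ LinearIndependent ℝ v := by
    intro hli
    have h1 := finrank_span_eq_card hli
    have h2 : Submodule.span ℝ (Set.range v) ≤ K := by
      rw [Submodule.span_le]
      rintro _ ⟨i, rfl⟩
      exact hv i
    have h3 := Submodule.finrank_mono h2
    rw [h1, Fintype.card_fin] at h3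
    omega
  exact Fintype.not_linearIndependent_iff.1 hli

theorem exists_combo_of_finrank_le_two (hK : Module.finrank ℝ K ≤ 2) {O u v : E} (hO : O ∈ K)
    (hu : u ∈ K) (hv : v ∈ K) (O1 : h O = 1) (u1 : h u = 1) (v1 : h v = 1) (huv : u ≠ v) :
    ∃ s t : ℝ, s + t = 1 ∧ O = s • u + t • v := by
  obtain ⟨c, hc, i, hi⟩ := exists_relation_of_finrank_lt (n := 3) (v := ![O, u, v]) (K := K)
    (by intro i; fin_cases i; exacts [hO, hu, hv]) (by omega)
  simp only [Fin.sum_univ_three, Matrix.cons_val_zero, Matrix.cons_val_one, Matrix.cons_val] at hc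
  have hh : c 0 + c 1 + c 2 = 0 := by
    have := congrArg h hc
    simpa [O1, u1, v1] using this
  have h0 : c 0 ≠ 0 := by
    intro h0
    rw [h0, zero_smul, zero_add, show c 2 = -c 1 by linarith, neg_smul, ← sub_eq_add_neg,
      ← smul_sub, smul_eq_zero] at hc
    have h1 : c 1 = 0 := hc.resolve_right (sub_ne_zero.2 huv)
    have h2 : c 2 = 0 := by linarith
    fin_cases i <;> contradiction
  refine ⟨-(c 0)⁻¹ * c 1, -(c 0)⁻¹ * c 2, ?_, ?_⟩
  · field_simp; linarith
  · have := congrArg ((c 0)⁻¹ • ·) hc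
    simp only [smul_add, smul_smul, inv_mul_cancel₀ h0, one_smul, smul_zero] at this
    rw [neg_mul, neg_mul, neg_smul, neg_smul, ← neg_add, eq_neg_iff_add_eq_zero, ← add_assoc]
    exact this

/-- Two lines through vertices in a common plane meet. -/
theorem exists_meet (hgen : InGeneralPosition P) (hK : Module.finrank ℝ K ≤ 3) {u : Fin 4 → E}
    (hu : ∀ i, u i ∈ K) (h1 : ∀ i, h (u i) = 1) (hv : ∀ i, π (u i) ∈ vertices P)
    (hinj : Function.Injective fun i => π (u i)) :
    ∃ O : E, h O = 1 ∧ (∃ s t : ℝ, s + t = 1 ∧ O = s • u 0 + t • u 1) ∧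
      ∃ s t : ℝ, s + t = 1 ∧ O = s • u 2 + t • u 3 := by
  obtain ⟨c, hc, i, hi⟩ := exists_relation_of_finrank_lt (v := u) hu (by omega)
  rw [Fin.sum_univ_four] at hc
  have hh : c 0 + c 1 + c 2 + c 3 = 0 := by
    have := congrArg h hc
    simpa [h1] using this
  by_cases h0 : c 0 + c 1 = 0
  · exfalso
    have e1 : c 1 = -c 0 := by linarith
    have e3 : c 3 = -c 2 := by linarith
    have hπ := congrArg π hc
    simp only [map_add, map_smul, map_zero] at hπ
    have hπ' : c 0 • (π (u 0) - π (u 1)) = (-c 2) • (π (u 2) - π (u 3)) := by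
      rw [e1, e3] at hπ
      rw [← sub_eq_zero, ← hπ]; module
    have n01 : π (u 0) - π (u 1) ≠ 0 := sub_ne_zero.2 (hinj.ne (by decide : (0 : Fin 4) ≠ 1))
    have n23 : π (u 2) - π (u 3) ≠ 0 := sub_ne_zero.2 (hinj.ne (by decide : (2 : Fin 4) ≠ 3))
    have c0 : c 0 ≠ 0 := by
      intro c0
      rw [c0, zero_smul, eq_comm, smul_eq_zero] at hπ'
      have c2 : c 2 = 0 := by linarith [hπ'.resolve_right n23]
      rw [c0] at e1
      rw [c2] at e3
      fin_cases i <;> simp_all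
    have c2 : c 2 ≠ 0 := by
      intro c2
      rw [c2, neg_zero, zero_smul, smul_eq_zero] at hπ'
      exact c0 (hπ'.resolve_right n01)
    refine hgen.not_parallel (fun i => π (u i)) hinj hv
      (parallel_lineThrough (t := (c 0)⁻¹ * (-c 2)) (by
        exact mul_ne_zero (inv_ne_zero c0) (neg_ne_zero.2 c2)) ?_)
    rw [mul_smul, ← hπ', smul_smul, inv_mul_cancel₀ c0, one_smul]
  · refine ⟨((c 0 + c 1)⁻¹ * c 0) • u 0 + ((c 0 + c 1)⁻¹ * c 1) • u 1, ?_, ⟨_, _, ?_, rfl⟩,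
      -((c 0 + c 1)⁻¹ * c 2), -((c 0 + c 1)⁻¹ * c 3), ?_, ?_⟩
    · simp only [map_add, map_smul, h1, smul_eq_mul]; field_simp
    · field_simp
    · field_simp; linarith
    · rw [← sub_eq_zero]
      have := congrArg ((c 0 + c 1)⁻¹ • ·) hc
      simp only [smul_add, smul_smul, smul_zero] at this
      rw [← this]; module

/-- The lines `u 0` `u 1` and `u 2` `u 3` lie in the plane g = 0 and meet, as their projections are
not parallel. The meeting point satisfies f = g = k = 0, so it lies on the line f = k = 0, which is
`u 4` `u 5`. Projecting gives three concurrent lines. -/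
theorem prism_absurd (hgen : InGeneralPosition P) (hE : Module.finrank ℝ E = 4)
    {f g k : E →ₗ[ℝ] ℝ} {u : Fin 6 → E} (h1 : ∀ i, h (u i) = 1) (hv : ∀ i, π (u i) ∈ vertices P)
    (hinj : Function.Injective fun i => π (u i))
    (f0 : f (u 0) = 0) (g0 : g (u 0) = 0) (k0 : k (u 0) ≠ 0) (f1 : f (u 1) = 0) (g1 : g (u 1) = 0)
    (g2 : g (u 2) = 0) (k2 : k (u 2) = 0) (f2 : f (u 2) ≠ 0) (g3 : g (u 3) = 0) (k3 : k (u 3) = 0)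
    (f4 : f (u 4) = 0) (k4 : k (u 4) = 0) (g4 : g (u 4) ≠ 0) (f5 : f (u 5) = 0) (k5 : k (u 5) = 0) :
    False := by
  have gK : Module.finrank ℝ (LinearMap.ker g) ≤ 3 := by
    have := finrank_ker_eq (f := g) (by rintro rfl; exact g4 rfl)
    omega
  have fK : Module.finrank ℝ (LinearMap.ker f) ≤ 3 := by
    have := finrank_ker_eq (f := f) (by rintro rfl; exact f2 rfl)
    omega
  have fkK : Module.finrank ℝ ↥(LinearMap.ker f ⊓ LinearMap.ker k) ≤ 2 := by
    have : LinearMap.ker f ⊓ LinearMap.ker k < LinearMap.ker f :=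
      lt_of_le_of_ne inf_le_left fun he => k0 (he.ge (show u 0 ∈ LinearMap.ker f from f0)).2
    have := Submodule.finrank_lt_finrank_of_lt this
    omega
  obtain ⟨O, O1, l1, l2⟩ := exists_meet (h := h) (π := π) hgen gK
    (u := fun i : Fin 4 => u (Fin.castLE (by norm_num) i))
    (by intro i; fin_cases i; exacts [g0, g1, g2, g3]) (fun i => h1 _) (fun i => hv _)
    (fun i j hij => Fin.castLE_injective (by norm_num) (hinj hij))
  have l3 := exists_combo_of_finrank_le_two (h := h) fkK (O := O) (u := u 4) (v := u 5)
    ⟨combo_mem l1 f0 f1, combo_mem l2 k2 k3⟩ ⟨f4, k4⟩ ⟨f5, k5⟩ O1 (h1 4) (h1 5)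
    (fun he => by
      have := hinj (congrArg π he)
      exact absurd this (by decide))
  exact hgen.not_concurrent (fun i => π (u i)) hinj hv ⟨π O, map_combo_mem_lineThrough l1,
    map_combo_mem_lineThrough l2, map_combo_mem_lineThrough l3⟩

/-- Each of the walls a, b, c contains two lines that meet: one is a side of the triangle `u 0` `u
1` `u 4`, the other lies in the wall d. The three meeting points therefore lie on the intersection
of the plane of the triangle with d, which is a line, and their projections are collinear. -/
theorem wedge_absurd (hgen : InGeneralPosition P) (hE : Module.finrank ℝ E = 4)
    {a b c d : E →ₗ[ℝ] ℝ} {u : Fin 7 → E} (h1 : ∀ i, h (u i) = 1) (hv : ∀ i, π (u i) ∈ vertices P)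
    (hinj : Function.Injective fun i => π (u i))
    (a0 : a (u 0) = 0) (c0 : c (u 0) = 0) (b0 : b (u 0) ≠ 0) (d0 : d (u 0) ≠ 0)
    (a1 : a (u 1) = 0) (b1 : b (u 1) = 0) (c1 : c (u 1) ≠ 0)
    (a2 : a (u 2) = 0) (c2 : c (u 2) = 0) (d2 : d (u 2) = 0)
    (a3 : a (u 3) = 0) (b3 : b (u 3) = 0) (d3 : d (u 3) = 0)
    (b4 : b (u 4) = 0) (c4 : c (u 4) = 0) (a4 : a (u 4) ≠ 0)
    (b5 : b (u 5) = 0) (d5 : d (u 5) = 0) (c6 : c (u 6) = 0) (d6 : d (u 6) = 0) : False := by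
  have hker : ∀ {f : E →ₗ[ℝ] ℝ} {x : E}, f x ≠ 0 → Module.finrank ℝ (LinearMap.ker f) ≤ 3 := by
    intro f x hx
    have := finrank_ker_eq (f := f) (by rintro rfl; exact hx rfl)
    omega
  have hW : Module.finrank ℝ (Submodule.span ℝ (Set.range ![u 0, u 1, u 4])) ≤ 3 := by
    exact (finrank_range_le_card (R := ℝ) ![u 0, u 1, u 4]).trans (by simp)
  set W := Submodule.span ℝ (Set.range ![u 0, u 1, u 4]) with hWdef
  have w0 : u 0 ∈ W := Submodule.subset_span ⟨0, rfl⟩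
  have w1 : u 1 ∈ W := Submodule.subset_span ⟨1, rfl⟩
  have w4 : u 4 ∈ W := Submodule.subset_span ⟨2, rfl⟩
  have hWd : Module.finrank ℝ ↥(W ⊓ LinearMap.ker d) ≤ 2 := by
    have : W ⊓ LinearMap.ker d < W := lt_of_le_of_ne inf_le_left fun he => d0 (he.ge w0).2
    have := Submodule.finrank_lt_finrank_of_lt this
    omega
  have meet : ∀ {f : E →ₗ[ℝ] ℝ} {x : E} (_ : f x ≠ 0) (j : Fin 4 → Fin 7)
      (_ : Function.Injective j) (_ : ∀ i, f (u (j i)) = 0), ∃ O : E, h O = 1 ∧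
      (∃ s t : ℝ, s + t = 1 ∧ O = s • u (j 0) + t • u (j 1)) ∧
      ∃ s t : ℝ, s + t = 1 ∧ O = s • u (j 2) + t • u (j 3) := by
    intro f x hx j hj hf
    exact exists_meet (h := h) (π := π) hgen (hker hx) (u := fun i => u (j i)) hf (fun i => h1 _)
      (fun i => hv _) (fun i i' hi => hj (hinj hi))
  obtain ⟨A, A1, m1, m2⟩ := meet a4 ![0, 1, 2, 3] (by decide)
    (by intro i; fin_cases i; exacts [a0, a1, a2, a3])
  obtain ⟨B, B1, m3, m4⟩ := meet b0 ![1, 4, 3, 5] (by decide)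
    (by intro i; fin_cases i; exacts [b1, b4, b3, b5])
  obtain ⟨C, C1, m5, m6⟩ := meet c1 ![2, 6, 0, 4] (by decide)
    (by intro i; fin_cases i; exacts [c2, c6, c0, c4])
  have kA : A ∈ W ⊓ LinearMap.ker d := ⟨combo_mem m1 w0 w1, combo_mem m2 d2 d3⟩
  have kB : B ∈ W ⊓ LinearMap.ker d := ⟨combo_mem m3 w1 w4, combo_mem m4 d3 d5⟩
  have kC : C ∈ W ⊓ LinearMap.ker d := ⟨combo_mem m6 w0 w4, combo_mem m5 d2 d6⟩
  refine hgen.not_collinear (fun i => π (u i)) hinj hv ⟨π A, π B, π C,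
    ⟨map_combo_mem_lineThrough m1, map_combo_mem_lineThrough m2⟩,
    ⟨map_combo_mem_lineThrough m3, map_combo_mem_lineThrough m4⟩,
    ⟨map_combo_mem_lineThrough m5, map_combo_mem_lineThrough m6⟩, ?_⟩
  by_cases hAB : A = B
  · rw [hAB, Set.insert_eq_of_mem (Set.mem_insert _ _)]
    exact collinear_pair ℝ _ _
  · have := map_combo_mem_lineThrough (π := π)
      (exists_combo_of_finrank_le_two (h := h) hWd kC kA kB C1 A1 B1 hAB)
    have h3 := collinear_insert_of_mem_affineSpan_pair this
    convert h3 using 1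
    ext x; simp only [Set.mem_insert_iff, Set.mem_singleton_iff]; tauto

end Meet

section RayList

variable {E : Type*} [AddCommGroup E] [Module ℝ E]
  {σ : Fin 6 → E →ₗ[ℝ] ℝ} {h : E →ₗ[ℝ] ℝ} {π : E →ₗ[ℝ] (Fin 2 → ℝ)} {P : Set (Fin 2 → ℝ)}
  {S : List (ℕ × ℕ × ℕ)} {X : ℕ × ℕ × ℕ → E}

theorem exists_two_of_le_length_filter {A : Type*} {S : List A} (hnd : S.Nodup) {p : A → Bool}
    (hp : 2 ≤ (S.filter p).length) : ∃ t ∈ S, ∃ t' ∈ S, t ≠ t' ∧ p t = true ∧ p t' = true := by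
  classical
  rw [← List.toFinset_card_of_nodup (hnd.filter _)] at hp
  obtain ⟨t, ht, t', ht', hne⟩ := Finset.one_lt_card.1 hp
  rw [List.mem_toFinset, List.mem_filter] at ht ht'
  exact ⟨t, ht.1, t', ht'.1, hne, ht.2, ht'.2⟩

/-- If the midpoint of two rays projects to a vertex, then so does the face spanned by them. -/
theorem map_eq_of_collision (hpos : ConePos σ h) (hP : Convex ℝ P)
    (hin : ∀ x, IsRay σ h x → π x ∈ P) {x y : E} (hx : IsRay σ h x) (hy : IsRay σ h y)
    (hp : π x ∈ vertices P) (hxy : π x = π y) {w : E}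
    (hw : ∀ i, σ i x = 0 → σ i y = 0 → σ i w = 0) : π w = h w • π x := by
  have base : ∀ z, h z = 1 → (∀ i, 0 ≤ σ i z) → π z ∈ P := by
    intro z h1 hz
    have := mem_convexHull_isRay hpos h1 hz
    have h2 : π z ∈ π '' convexHull ℝ {x | IsRay σ h x} := ⟨z, this, rfl⟩
    rw [LinearMap.image_convexHull] at h2
    refine convexHull_min ?_ hP h2
    rintro _ ⟨z, hz, rfl⟩
    exact hin z hz
  -- The midpoint is interior to the smallest face containing x and y. A height-zero direction w' of
  -- that face can be followed both ways from m, and extremality of the common image forces the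
  -- projection of w' to be zero.
  let m : E := (1 / 2 : ℝ) • x + (1 / 2 : ℝ) • y
  have hm1 : h m = 1 := by simp [m, hx.one, hy.one]; norm_num
  have hmp : π m = π x := by
    simp only [m, map_add, map_smul, ← hxy, ← add_smul]; norm_num
  have hm0 : ∀ i, 0 ≤ σ i m ∧ (σ i m = 0 → σ i x = 0 ∧ σ i y = 0) := by
    intro i
    have h1 := hx.nonneg i
    have h2 := hy.nonneg i
    simp only [m, map_add, map_smul, smul_eq_mul]
    exact ⟨by linarith, fun h0 => ⟨by linarith, by linarith⟩⟩
  let w' := w - h w • m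
  have hw'1 : h w' = 0 := by simp [w', hm1]
  have hw' : ∀ i, σ i m = 0 → σ i w' = 0 := by
    intro i hi
    obtain ⟨h1, h2⟩ := (hm0 i).2 hi
    simp [w', hi, hw i h1 h2]
  obtain ⟨e, he, hle⟩ : ∃ e : ℝ, 0 < e ∧ ∀ i, e * |σ i w'| ≤ σ i m := by
    have : ∀ i, ∃ e : ℝ, 0 < e ∧ e * |σ i w'| ≤ σ i m := by
      intro i
      by_cases h0 : σ i w' = 0
      · exact ⟨1, one_pos, by simpa [h0] using (hm0 i).1⟩
      · have hp : 0 < σ i m := lt_of_le_of_ne (hm0 i).1 fun h' => h0 (hw' i h'.symm)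
        have := abs_pos.2 h0
        exact ⟨σ i m / |σ i w'|, by positivity, by field_simp; exact le_rfl⟩
    choose e he1 he2 using this
    refine ⟨Finset.univ.inf' Finset.univ_nonempty e, ?_, fun i => ?_⟩
    · rw [Finset.lt_inf'_iff]; exact fun i _ => he1 i
    · exact (mul_le_mul_of_nonneg_right (Finset.inf'_le _ (Finset.mem_univ i)) (abs_nonneg _)).trans
        (he2 i)
  have q1 : π (m + e • w') ∈ P := base _ (by simp [hm1, hw'1]) fun i => by
    have h1 := hle i
    have h2 := mul_le_mul_of_nonneg_left (neg_abs_le (σ i w')) he.le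
    simp only [map_add, map_smul, smul_eq_mul]
    linarith
  have q2 : π (m - e • w') ∈ P := base _ (by simp [hm1, hw'1]) fun i => by
    have h1 := hle i
    have h2 := mul_le_mul_of_nonneg_left (le_abs_self (σ i w')) he.le
    simp only [map_sub, map_smul, smul_eq_mul]
    linarith
  have q3 := hp.2 q1 q2 ⟨1 / 2, 1 / 2, by norm_num, by norm_num, by norm_num, by
    rw [← hmp, ← map_smul, ← map_smul, ← map_add]
    congr 1; module⟩
  rw [map_add, hmp, add_eq_left, map_smul, smul_eq_zero] at q3
  have q4 := q3.resolve_left he.ne'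
  simp only [w', map_sub, map_smul, hmp, sub_eq_zero] at q4
  exact q4

variable [FiniteDimensional ℝ E]

theorem hasPrism_absurd (hgen : InGeneralPosition P) (hE : Module.finrank ℝ E = 4)
    (hnd : S.Nodup) (hX : ∀ t ∈ S, IsRay σ h (X t))
    (htight : ∀ t ∈ S, ∀ m : Fin 6, σ m (X t) = 0 ↔ tightAt m t = true)
    (hin : ∀ t ∈ S, π (X t) ∈ vertices P) (hinj : Set.InjOn (fun t => π (X t)) {t | t ∈ S})
    (hS : hasPrism S = true) : False := by
  unfold hasPrism at hS
  simp only [List.any_eq_true, List.mem_range, Bool.and_eq_true, Nat.ble_eq] at hS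
  obtain ⟨i, hi, j, hj, k, hk, ⟨h1, h2⟩, h3⟩ := hS
  obtain ⟨t0, m0, t1, m1, n01, p0, p1⟩ := exists_two_of_le_length_filter hnd h1
  obtain ⟨t2, m2, t3, m3, n23, p2, p3⟩ := exists_two_of_le_length_filter hnd h2
  obtain ⟨t4, m4, t5, m5, n45, p4, p5⟩ := exists_two_of_le_length_filter hnd h3
  lift i to Fin 6 using hi
  lift j to Fin 6 using hj
  lift k to Fin 6 using hk
  simp only [Bool.and_eq_true, Bool.not_eq_true', ← Bool.not_eq_true] at p0 p1 p2 p3 p4 p5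
  have mem : ∀ s, (![t0, t1, t2, t3, t4, t5] : Fin 6 → ℕ × ℕ × ℕ) s ∈ S := by
    intro s; fin_cases s
    exacts [m0, m1, m2, m3, m4, m5]
  have tinj : Function.Injective (![t0, t1, t2, t3, t4, t5] : Fin 6 → ℕ × ℕ × ℕ) := by
    intro s s' hs
    fin_cases s <;> fin_cases s' <;> first
      | rfl
      | exfalso; simp at hs; subst hs; tauto
  refine prism_absurd hgen hE (h := h) (π := π) (f := σ i) (g := σ j) (k := σ k)
    (u := fun s => X ((![t0, t1, t2, t3, t4, t5] : Fin 6 → ℕ × ℕ × ℕ) s))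
    (fun s => (hX _ (mem s)).one) (fun s => hin _ (mem s))
    (fun s s' hs => tinj (hinj (mem s) (mem s') hs)) ((htight _ m0 _).2 p0.1.1)
    ((htight _ m0 _).2 p0.1.2) (mt (htight _ m0 _).1 p0.2) ((htight _ m1 _).2 p1.1.1)
    ((htight _ m1 _).2 p1.1.2) ((htight _ m2 _).2 p2.1.1) ((htight _ m2 _).2 p2.1.2)
    (mt (htight _ m2 _).1 p2.2) ((htight _ m3 _).2 p3.1.1) ((htight _ m3 _).2 p3.1.2)
    ((htight _ m4 _).2 p4.1.1) ((htight _ m4 _).2 p4.1.2) (mt (htight _ m4 _).1 p4.2)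
    ((htight _ m5 _).2 p5.1.1) ((htight _ m5 _).2 p5.1.2)

theorem hasWedge_absurd (hgen : InGeneralPosition P) (hE : Module.finrank ℝ E = 4)
    (hX : ∀ t ∈ S, IsRay σ h (X t))
    (htight : ∀ t ∈ S, ∀ m : Fin 6, σ m (X t) = 0 ↔ tightAt m t = true)
    (hin : ∀ t ∈ S, π (X t) ∈ vertices P) (hinj : Set.InjOn (fun t => π (X t)) {t | t ∈ S})
    (hS : hasWedge S = true) : False := by
  unfold hasWedge at hS
  simp only [List.any_eq_true, List.mem_range, Bool.and_eq_true] at hS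
  -- The discarded components are the pruning tests.
  obtain ⟨a, ha, b, hb, -, c, hc, -, d, hd, hS⟩ := hS
  obtain ⟨⟨⟨⟨⟨⟨⟨t0, m0, p0⟩, t1, m1, p1⟩, t2, m2, p2⟩, t3, m3, p3⟩, t4, m4, p4⟩, t5, m5, p5⟩,
    t6, m6, p6⟩ := hS
  lift a to Fin 6 using ha
  lift b to Fin 6 using hb
  lift c to Fin 6 using hc
  lift d to Fin 6 using hd
  simp only [Bool.not_eq_true'] at p0 p1 p2 p3 p4 p5 p6
  have mem : ∀ s, (![t0, t1, t2, t3, t4, t5, t6] : Fin 7 → ℕ × ℕ × ℕ) s ∈ S := by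
    intro s; fin_cases s
    exacts [m0, m1, m2, m3, m4, m5, m6]
  have tinj : Function.Injective (![t0, t1, t2, t3, t4, t5, t6] : Fin 7 → ℕ × ℕ × ℕ) := by
    apply Function.Injective.of_comp (f := fun t => (tightAt a t, tightAt b t, tightAt c t, tightAt d t))
    have : (fun t => (tightAt a t, tightAt b t, tightAt c t, tightAt d t)) ∘
        (![t0, t1, t2, t3, t4, t5, t6] : Fin 7 → ℕ × ℕ × ℕ) =
        ![(true, false, true, false), (true, true, false, false), (true, false, true, true),
          (true, true, false, true), (false, true, true, false), (false, true, false, true),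
          (false, false, true, true)] := by
      funext s; fin_cases s <;> simp_all
    rw [this]
    decide
  have ne : ∀ {t}, t ∈ S → ∀ m : Fin 6, tightAt m t = false → σ m (X t) ≠ 0 := fun ht m hm h0 => by
    rw [htight _ ht, hm] at h0
    exact absurd h0 (by decide)
  refine wedge_absurd hgen hE (h := h) (π := π) (a := σ a) (b := σ b) (c := σ c) (d := σ d)
    (u := fun s => X ((![t0, t1, t2, t3, t4, t5, t6] : Fin 7 → ℕ × ℕ × ℕ) s))
    (fun s => (hX _ (mem s)).one) (fun s => hin _ (mem s))
    (fun s s' hs => tinj (hinj (mem s) (mem s') hs))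
    ((htight _ m0 _).2 p0.1.1.1) ((htight _ m0 _).2 p0.1.1.2) (ne m0 _ p0.1.2) (ne m0 _ p0.2)
    ((htight _ m1 _).2 p1.1.1.1) ((htight _ m1 _).2 p1.1.1.2) (ne m1 _ p1.1.2)
    ((htight _ m2 _).2 p2.1.1.1) ((htight _ m2 _).2 p2.1.1.2) ((htight _ m2 _).2 p2.1.2)
    ((htight _ m3 _).2 p3.1.1.1) ((htight _ m3 _).2 p3.1.1.2) ((htight _ m3 _).2 p3.1.2)
    ((htight _ m4 _).2 p4.1.1.1) ((htight _ m4 _).2 p4.1.1.2) (ne m4 _ p4.1.2)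
    ((htight _ m5 _).2 p5.1.1.1) ((htight _ m5 _).2 p5.1.1.2)
    ((htight _ m6 _).2 p6.1.1.1) ((htight _ m6 _).2 p6.1.1.2)

/-- Eight rays over seven vertices have exactly one colliding pair. Its smallest face lies in a
fibre, whose linear span has dimension at most two, so at least two walls contain the pair, and each
such wall carries at most three rays. -/
theorem hasTriangles_of_collision (hpos : ConePos σ h) (hE : Module.finrank ℝ E = 4)
    (hP : Convex ℝ P) (hcard : (vertices P).ncard = 7)
    (hnd : S.Nodup) (hX : ∀ t ∈ S, IsRay σ h (X t)) (hXs : ∀ x, IsRay σ h x → ∃ t ∈ S, X t = x)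
    (hXi : Set.InjOn X {t | t ∈ S})
    (htight : ∀ t ∈ S, ∀ m : Fin 6, σ m (X t) = 0 ↔ tightAt m t = true)
    (hin : ∀ t ∈ S, π (X t) ∈ vertices P) (hsurj : ∀ v ∈ vertices P, ∃ t ∈ S, π (X t) = v)
    (hlen : S.length = 8) : hasTriangles S = true := by
  classical
  have hfin : (vertices P).Finite := Set.finite_of_ncard_ne_zero (by omega)
  have himg : S.toFinset.image (fun t => π (X t)) = hfin.toFinset := by
    ext v
    simp only [Finset.mem_image, List.mem_toFinset, Set.Finite.mem_toFinset]
    exact ⟨by rintro ⟨t, ht, rfl⟩; exact hin t ht, fun hv => hsurj v hv⟩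
  have h7 : (S.toFinset.image fun t => π (X t)).card = 7 := by
    rw [himg, ← Set.ncard_eq_toFinset_card _ hfin, hcard]
  have h8 : S.toFinset.card = 8 := by rw [List.toFinset_card_of_nodup hnd, hlen]
  obtain ⟨t, ht, t', ht', hne, hcol⟩ : ∃ t ∈ S, ∃ t' ∈ S, t ≠ t' ∧ π (X t) = π (X t') := by
    by_contra hcon; push Not at hcon
    have : (S.toFinset.image fun t => π (X t)).card = S.toFinset.card := by
      refine Finset.card_image_of_injOn fun t ht t' ht' he => ?_
      by_contra hne
      exact hcon t (by simpa using ht) t' (by simpa using ht') hne he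
    omega
  -- Without `t'` the seven remaining rays still cover the seven vertices, hence injectively.
  have hinj : ∀ u ∈ S, ∀ v ∈ S, u ≠ t' → v ≠ t' → π (X u) = π (X v) → u = v := by
    have he : (S.toFinset.erase t').image (fun t => π (X t)) = S.toFinset.image fun t => π (X t) := by
      refine Finset.Subset.antisymm (Finset.image_subset_image (Finset.erase_subset _ _)) ?_
      intro v hv
      obtain ⟨u, hu, rfl⟩ := Finset.mem_image.1 hv
      by_cases hut : u = t'
      · subst hut
        exact Finset.mem_image.2 ⟨t, Finset.mem_erase.2 ⟨hne, by simpa using ht⟩, hcol⟩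
      · exact Finset.mem_image_of_mem _ (Finset.mem_erase.2 ⟨hut, hu⟩)
    have hc : ((S.toFinset.erase t').image fun t => π (X t)).card = (S.toFinset.erase t').card := by
      rw [he, h7, Finset.card_erase_of_mem (by simpa using ht'), h8]
    have := Finset.card_image_iff.1 hc
    intro u hu v hv hut hvt huv
    exact this (by simp [hut, hu]) (by simp [hvt, hv]) huv
  set p := π (X t) with hp
  have hface : ∀ w, (∀ i, σ i (X t) = 0 → σ i (X t') = 0 → σ i w = 0) → π w = h w • p := fun w hw =>
    map_eq_of_collision hpos hP (fun x hx => by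
      obtain ⟨s, hs, rfl⟩ := hXs x hx
      exact (hin s hs).1) (hX t ht) (hX t' ht') (hin t ht) hcol hw
  -- the face has codimension at least two
  let Ψ : E →ₗ[ℝ] (Fin 2 → ℝ) := π - h.smulRight p
  have hΨ : ∀ w, Ψ w = π w - h w • p := fun w => rfl
  have hΨk : Module.finrank ℝ (LinearMap.ker Ψ) ≤ 2 := by
    obtain ⟨v₁, hv₁, v₂, hv₂, n1, n2, n3⟩ : ∃ v₁ ∈ vertices P, ∃ v₂ ∈ vertices P, v₁ ≠ p ∧ v₂ ≠ p ∧
        v₁ ≠ v₂ := by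
      have h1 : 1 < (hfin.toFinset.erase p).card := by
        rw [Finset.card_erase_of_mem (by simpa using hin t ht), ← Set.ncard_eq_toFinset_card _ hfin,
          hcard]
        norm_num
      obtain ⟨v₁, h1, v₂, h2, h3⟩ := Finset.one_lt_card.1 h1
      simp only [Finset.mem_erase, Set.Finite.mem_toFinset] at h1 h2
      exact ⟨v₁, h1.2, v₂, h2.2, h1.1, h2.1, h3⟩
    obtain ⟨s₁, hs₁, rfl⟩ := hsurj v₁ hv₁
    obtain ⟨s₂, hs₂, rfl⟩ := hsurj v₂ hv₂
    have hli : LinearIndependent ℝ ![Ψ (X s₁), Ψ (X s₂)] := by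
      rw [LinearIndependent.pair_iff]
      intro a b hab
      rw [hΨ, hΨ, (hX s₁ hs₁).one, (hX s₂ hs₂).one, one_smul] at hab
      have := vertices_indep hP (hin t ht) hv₁ hv₂ n1.symm n2.symm n3 (r := -a - b) (s := a)
        (t := b) (by ring) (by rw [← hab]; module)
      exact ⟨this.2.1, this.2.2⟩
    have h1 := finrank_span_eq_card hli
    have h2 : Submodule.span ℝ (Set.range ![Ψ (X s₁), Ψ (X s₂)]) ≤ LinearMap.range Ψ := by
      rw [Submodule.span_le]
      rintro _ ⟨i, rfl⟩
      fin_cases i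
      exacts [⟨_, rfl⟩, ⟨_, rfl⟩]
    have h3 := Submodule.finrank_mono h2
    have h4 := Ψ.finrank_range_add_finrank_ker
    rw [h1, Fintype.card_fin] at h3
    omega
  obtain ⟨i, j, hij, ⟨i0, i1, i2⟩, j0, j1, j2⟩ : ∃ i j : Fin 6, i < j ∧
      (σ i ≠ 0 ∧ σ i (X t) = 0 ∧ σ i (X t') = 0) ∧ σ j ≠ 0 ∧ σ j (X t) = 0 ∧ σ j (X t') = 0 := by
    let T := Finset.univ.filter fun i : Fin 6 => σ i ≠ 0 ∧ σ i (X t) = 0 ∧ σ i (X t') = 0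
    have hT : 1 < T.card := by
      by_contra hcon
      rw [not_lt, Finset.card_le_one_iff_subset_singleton] at hcon
      obtain ⟨i, hi⟩ := hcon
      have hker : LinearMap.ker (σ i) ≤ LinearMap.ker Ψ := by
        intro w hw
        rw [LinearMap.mem_ker, hΨ, sub_eq_zero]
        refine hface w fun m h1 h2 => ?_
        by_cases h0 : σ m = 0
        · simp [h0]
        · have := hi (show m ∈ T by simp [T, h0, h1, h2])
          rw [Finset.mem_singleton] at this
          rw [this]; exact hw
      have h1 := Submodule.finrank_mono hker
      have h2 := finrank_ker_ge (σ i)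
      omega
    obtain ⟨i, hi, j, hj, hij⟩ := Finset.one_lt_card.1 hT
    simp only [T, Finset.mem_filter, Finset.mem_univ, true_and] at hi hj
    rcases lt_or_gt_of_ne hij with hlt | hlt
    · exact ⟨i, j, hlt, hi, hj⟩
    · exact ⟨j, i, hlt, hj, hi⟩
  have hface3 : ∀ i : Fin 6, σ i ≠ 0 → σ i (X t) = 0 → σ i (X t') = 0 →
      (S.filter fun t => tightAt i t).length ≤ 3 := by
    intro i i0 i1 i2
    by_contra hcon
    rw [not_le, ← List.toFinset_card_of_nodup (hnd.filter _)] at hcon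
    have hc : 1 < (((S.filter fun t => tightAt i t).toFinset.erase t).erase t').card := by
      have h1 := Finset.pred_card_le_card_erase (s := (S.filter fun t => tightAt i t).toFinset)
        (a := t)
      have h2 := Finset.pred_card_le_card_erase
        (s := (S.filter fun t => tightAt i t).toFinset.erase t) (a := t')
      omega
    obtain ⟨u, hu, v, hv, huv⟩ := Finset.one_lt_card.1 hc
    simp only [Finset.mem_erase, List.mem_toFinset, List.mem_filter] at hu hv
    obtain ⟨ut', ut, uS, ui⟩ := hu
    obtain ⟨vt', vt, vS, vi⟩ := hv
    -- With two further rays u, v on the wall, four vectors in a three-dimensional space are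
    -- dependent. The difference of the colliding rays projects to zero, so the other coefficients
    -- give a relation among three distinct vertices of P and vanish.
    obtain ⟨c, hc, k, hk⟩ := exists_relation_of_finrank_lt (n := 4) (K := LinearMap.ker (σ i))
      (v := ![X t, X u, X v, X t - X t']) (by
        intro k; fin_cases k
        · exact i1
        · exact (htight u uS i).2 ui
        · exact (htight v vS i).2 vi
        · show σ i (X t - X t') = 0
          rw [map_sub, i1, i2, sub_zero]) (by
        have := finrank_ker_eq i0
        omega)
    simp only [Fin.sum_univ_four, Matrix.cons_val_zero, Matrix.cons_val_one, Matrix.cons_val] at hc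
    have e1 := congrArg h hc
    have e2 := congrArg π hc
    simp only [map_add, map_smul, map_sub, (hX t ht).one, (hX t' ht').one, (hX u uS).one,
      (hX v vS).one, smul_eq_mul, map_zero, ← hcol, ← hp, sub_self, smul_zero, mul_zero, mul_one,
      add_zero] at e1 e2
    obtain ⟨c0, c1, c2⟩ := vertices_indep hP (hin t ht) (hin u uS) (hin v vS)
      (fun he => ut (hinj t ht u uS hne ut' he).symm) (fun he => vt (hinj t ht v vS hne vt' he).symm)
      (fun he => huv (hinj u uS v vS ut' vt' he)) e1 e2
    rw [c0, c1, c2] at hc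
    simp only [zero_smul, zero_add, smul_eq_zero, sub_eq_zero] at hc
    have c3 : c 3 = 0 := hc.resolve_right fun he => hne (hXi ht ht' he)
    fin_cases k <;> contradiction
  unfold hasTriangles
  simp only [List.any_eq_true, List.mem_range, Bool.and_eq_true, Nat.ble_eq]
  refine ⟨j, j.2, i, hij, ⟨hface3 i i0 i1 i2, hface3 j j0 j1 j2⟩, ?_⟩
  rw [← List.toFinset_card_of_nodup (hnd.filter _)]
  refine Finset.one_lt_card.2 ⟨t, ?_, t', ?_, hne⟩
  · rw [List.mem_toFinset, List.mem_filter, Bool.and_eq_true]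
    exact ⟨ht, (htight t ht i).1 i1, (htight t ht j).1 j1⟩
  · rw [List.mem_toFinset, List.mem_filter, Bool.and_eq_true]
    exact ⟨ht', (htight t' ht' i).1 i2, (htight t' ht' j).1 j2⟩

theorem rayList_absurd (hpos : ConePos σ h) (hE : Module.finrank ℝ E = 4)
    (hgen : InGeneralPosition P) (hP : Convex ℝ P) (hcard : (vertices P).ncard = 7)
    (hok : listOK S = true) (hnd : S.Nodup) (hX : ∀ t ∈ S, IsRay σ h (X t))
    (hXs : ∀ x, IsRay σ h x → ∃ t ∈ S, X t = x) (hXi : Set.InjOn X {t | t ∈ S})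
    (htight : ∀ t ∈ S, ∀ m : Fin 6, σ m (X t) = 0 ↔ tightAt m t = true)
    (hin : ∀ x, IsRay σ h x → π x ∈ vertices P)
    (hsurj : ∀ v ∈ vertices P, ∃ x, IsRay σ h x ∧ π x = v) : False := by
  classical
  have hin' : ∀ t ∈ S, π (X t) ∈ vertices P := fun t ht => hin _ (hX t ht)
  have hsurj' : ∀ v ∈ vertices P, ∃ t ∈ S, π (X t) = v := by
    intro v hv
    obtain ⟨x, hx, rfl⟩ := hsurj v hv
    obtain ⟨t, ht, rfl⟩ := hXs x hx
    exact ⟨t, ht, rfl⟩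
  have hfin : (vertices P).Finite := Set.finite_of_ncard_ne_zero (by omega)
  have himg : S.toFinset.image (fun t => π (X t)) = hfin.toFinset := by
    ext v
    simp only [Finset.mem_image, List.mem_toFinset, Set.Finite.mem_toFinset]
    exact ⟨by rintro ⟨t, ht, rfl⟩; exact hin' t ht, fun hv => hsurj' v hv⟩
  have h7 : (S.toFinset.image fun t => π (X t)).card = 7 := by
    rw [himg, ← Set.ncard_eq_toFinset_card _ hfin, hcard]
  have hlen : S.toFinset.card = S.length := List.toFinset_card_of_nodup hnd
  unfold listOK at hok
  simp only [Bool.or_eq_true, Bool.and_eq_true, Nat.ble_eq, Nat.beq_eq, Bool.not_eq_true'] at hok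
  rcases hok with (h6 | ⟨h7', hpw⟩) | ⟨h8, ht⟩
  · have := Finset.card_image_le (s := S.toFinset) (f := fun t => π (X t))
    omega
  · have hinj : Set.InjOn (fun t => π (X t)) {t | t ∈ S} := by
      have := Finset.card_image_iff.1 (show (S.toFinset.image fun t => π (X t)).card =
        S.toFinset.card by omega)
      intro u hu v hv huv
      exact this (by simpa using hu) (by simpa using hv) huv
    rcases hpw with hp | hw
    · exact hasPrism_absurd hgen hE hnd hX htight hin' hinj hp
    · exact hasWedge_absurd hgen hE hX htight hin' hinj hw
  · have := hasTriangles_of_collision hpos hE hP hcard hnd hX hXs hXi htight hin' hsurj' h8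
    rw [this] at ht
    exact absurd ht (by decide)

end RayList

/-! ### At most nine rays, and a hidden one. -/

section Bounds

variable {E : Type*} [AddCommGroup E] [Module ℝ E] [FiniteDimensional ℝ E]

/-- The cone is a pyramid with apex e: a ray off the wall i is proportional to e, and the others are
rays of a cone of dimension at most three with n inequalities. -/
theorem ncard_isRay_le_of_unit {n : ℕ} {σ : Fin (n + 1) → E →ₗ[ℝ] ℝ} {h : E →ₗ[ℝ] ℝ}
    {i : Fin (n + 1)} {e : E} (hei : σ i e = 1) (he : ∀ m, m ≠ i → σ m e = 0)
    (hE : Module.finrank ℝ E ≤ 4) (hn : 2 ≤ n) : {x | IsRay σ h x}.ncard ≤ n + 1 := by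
  have hfin := finite_isRay σ h
  let K := LinearMap.ker (σ i)
  have hK : Module.finrank ℝ K ≤ 3 := by
    have : Module.finrank ℝ K + 1 = _ := finrank_ker_eq (by intro h0; simp [h0] at hei)
    omega
  let σ' : Fin n → K →ₗ[ℝ] ℝ := fun m => (σ (i.succAbove m)).comp K.subtype
  have h1 := ncard_isRay_le_of_finrank_le_three (σ := σ') (h := h.comp K.subtype) hK hn
  have hsub : {x | IsRay σ h x} ⊆ {x | IsRay σ h x ∧ σ i x ≠ 0} ∪
      K.subtype '' {x | IsRay σ' (h.comp K.subtype) x} := by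
    intro x hx
    have hx : IsRay σ h x := hx
    by_cases h0 : σ i x = 0
    · refine Or.inr ⟨⟨x, h0⟩, ⟨hx.one, fun m => hx.nonneg _, fun y hy => ?_⟩, rfl⟩
      refine Subtype.ext (hx.minimal y fun m hm => ?_)
      rcases eq_or_ne m i with rfl | hmi
      · exact y.2
      · obtain ⟨m, rfl⟩ := Fin.exists_succAbove_eq hmi
        exact hy m hm
    · exact Or.inl ⟨hx, h0⟩
  have hfin' := finite_isRay σ' (h.comp K.subtype)
  have h2 : {x | IsRay σ h x ∧ σ i x ≠ 0}.ncard ≤ 1 := by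
    rw [Set.ncard_le_one (hfin.subset fun x hx => hx.1)]
    have key : ∀ x, IsRay σ h x → σ i x ≠ 0 → e = h e • x := by
      intro x hx h0
      refine hx.minimal e fun m hm => he m ?_
      rintro rfl
      exact h0 hm
    rintro x ⟨hx, hx0⟩ y ⟨hy, hy0⟩
    have k1 := key x hx hx0
    have k2 := key y hy hy0
    have hne : h e ≠ 0 := by
      intro h0
      rw [h0, zero_smul] at k1
      rw [k1] at hei
      simp at hei
    exact smul_right_injective E hne (k1.symm.trans k2)
  have h3 := Set.ncard_le_ncard hsub ((hfin.subset fun x hx => hx.1).union (hfin'.image _))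
  have h4 := Set.ncard_union_le {x | IsRay σ h x ∧ σ i x ≠ 0}
    (K.subtype '' {x | IsRay σ' (h.comp K.subtype) x})
  have h5 := Set.ncard_image_le (f := K.subtype) hfin'
  omega

variable {σ : Fin 6 → E →ₗ[ℝ] ℝ} {h : E →ₗ[ℝ] ℝ}

theorem exists_minor_ne_zero {n : ℕ} {a : Fin 2 → Fin n → ℝ} (ha : LinearIndependent ℝ a) :
    ∃ i j, a 0 i * a 1 j - a 1 i * a 0 j ≠ 0 := by
  by_contra hcon
  push Not at hcon
  rw [Fintype.linearIndependent_iff] at ha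
  have h0 : ∀ i, a 0 i = 0 := by
    intro i
    have := ha ![-a 1 i, a 0 i] (by
      rw [Fin.sum_univ_two]
      funext j
      simp
      linarith [hcon i j]) 1
    simpa using this
  have := ha ![1, 0] (by
    rw [Fin.sum_univ_two]
    funext j
    simp [h0 j]) 0
  simp at this

theorem ncard_isRay_le_six_or_exists_list (hpos : ConePos σ h) (hE : Module.finrank ℝ E = 4) :
    {x | IsRay σ h x}.ncard ≤ 6 ∨
    ∃ (τ : Equiv.Perm (Fin 6)) (S : List (ℕ × ℕ × ℕ)) (X : ℕ × ℕ × ℕ → E), listOK S = true ∧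
      S.Nodup ∧ (∀ t ∈ S, IsRay σ h (X t)) ∧ (∀ x, IsRay σ h x → ∃ t ∈ S, X t = x) ∧
      Set.InjOn X {t | t ∈ S} ∧
      ∀ t ∈ S, ∀ m : Fin 6, σ (τ m) (X t) = 0 ↔ tightAt m t = true := by
  classical
  obtain ⟨a, hli, ha⟩ := exists_relations hpos (r := 2) (by omega)
  have ha' : ∀ s : Fin 6 → ℝ, (∃ x, ∀ i, σ i x = s i) ↔
      ∑ i, a 0 i * s i = 0 ∧ ∑ i, a 1 i * s i = 0 := fun s => by rw [ha, Fin.forall_fin_two]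
  -- A zero vector in the Gale diagram is the pyramid case; otherwise the sorted-angle analysis
  -- applies.
  by_cases hz : ∃ i, a 0 i = 0 ∧ a 1 i = 0
  · left
    obtain ⟨i, h0, h1⟩ := hz
    obtain ⟨e, he⟩ := (ha' fun m => if m = i then 1 else 0).2 (by simp [h0, h1])
    exact ncard_isRay_le_of_unit (n := 5) (i := i) (e := e) (by simp [he])
      (fun m hm => by simp [he, hm]) hE.le (by norm_num)
  · right
    push Not at hz
    exact exists_ray_list hpos ha' (fun i => by
      by_cases h0 : a 0 i = 0
      · exact Or.inr (hz i h0)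
      · exact Or.inl h0) (exists_minor_ne_zero hli)

/-- The bound 9 comes from one relation with three positive and three negative signs, the product of
two triangles; `listOK` limits dimension four to eight rays. -/
theorem ncard_isRay_le_nine (hpos : ConePos σ h) : {x | IsRay σ h x}.ncard ≤ 9 := by
  classical
  have hle := finrank_le_of_conePos hpos
  rcases (show Module.finrank ℝ E = 6 ∨ Module.finrank ℝ E = 5 ∨ Module.finrank ℝ E = 4 ∨
    Module.finrank ℝ E ≤ 3 by omega) with hE | hE | hE | hE
  · exact (ncard_isRay_le_of_finrank_eq hpos hE).trans (by norm_num)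
  · obtain ⟨a, -, ha⟩ := exists_relations hpos (r := 1) (by omega)
    have h1 := ncard_isRay_le_rayPairs hpos (a := a 0) (fun s => by rw [ha, Fin.forall_fin_one])
    obtain ⟨p, m, z, hsum, -, hcard, -⟩ := card_rayPairs_le (a 0)
    have hp6 : p ≤ 6 := by omega
    have hm6 : m ≤ 6 := by omega
    obtain rfl : z = 6 - p - m := by omega
    refine (h1.trans hcard).trans ?_
    clear h1 hcard ha
    interval_cases p <;> interval_cases m <;> omega
  · rcases ncard_isRay_le_six_or_exists_list hpos hE with h6 | ⟨τ, S, X, hok, hnd, -, hXs, -, -⟩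
    · omega
    · have hlen : S.length ≤ 9 := by
        unfold listOK at hok
        simp only [Bool.or_eq_true, Bool.and_eq_true, Nat.ble_eq, Nat.beq_eq] at hok
        omega
      have hsub : {x | IsRay σ h x} ⊆ ↑(S.toFinset.image X) := by
        intro x hx
        obtain ⟨t, ht, rfl⟩ := hXs x hx
        simpa using ⟨_, _, _, ht, rfl⟩
      refine (Set.ncard_le_ncard hsub (Finset.finite_toSet _)).trans ?_
      rw [Set.ncard_coe_finset]
      exact (Finset.card_image_le.trans (List.toFinset_card_le S)).trans hlen
  · exact (ncard_isRay_le_of_finrank_le_three hE (by norm_num)).trans (by norm_num)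

/-- With one relation on five slacks the maximum of z + p m is 2 · 3; the other dimensions allow at
most five rays. -/
theorem ncard_isRay_le_six {σ : Fin 5 → E →ₗ[ℝ] ℝ} (hpos : ConePos σ h) :
    {x | IsRay σ h x}.ncard ≤ 6 := by
  have hle := finrank_le_of_conePos hpos
  rcases (show Module.finrank ℝ E = 5 ∨ Module.finrank ℝ E = 4 ∨
    Module.finrank ℝ E ≤ 3 by omega) with hE | hE | hE
  · exact (ncard_isRay_le_of_finrank_eq hpos hE).trans (by norm_num)
  · obtain ⟨a, -, ha⟩ := exists_relations hpos (r := 1) (by omega)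
    have h1 := ncard_isRay_le_rayPairs hpos (a := a 0) (fun s => by rw [ha, Fin.forall_fin_one])
    obtain ⟨p, m, z, hsum, -, hcard, -⟩ := card_rayPairs_le (a 0)
    have hp6 : p ≤ 5 := by omega
    have hm6 : m ≤ 5 := by omega
    obtain rfl : z = 5 - p - m := by omega
    refine (h1.trans hcard).trans ?_
    clear h1 hcard ha
    interval_cases p <;> interval_cases m <;> omega
  · exact (ncard_isRay_le_of_finrank_le_three hE (by norm_num)).trans (by norm_num)

/-- Some extreme ray of the cone over an extension of size six is hidden. -/
theorem exists_hidden_ray (hpos : ConePos σ h) {P : Set (Fin 2 → ℝ)} (hgen : InGeneralPosition P)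
    (hP : Convex ℝ P) (hcard : (vertices P).ncard = 7) {π : E →ₗ[ℝ] (Fin 2 → ℝ)}
    (hsurj : ∀ v ∈ vertices P, ∃ x, IsRay σ h x ∧ π x = v) :
    ∃ x, IsRay σ h x ∧ π x ∉ vertices P := by
  by_contra hcon
  push Not at hcon
  have h7 : 7 ≤ {x | IsRay σ h x}.ncard := by
    rw [← hcard]
    refine (Set.ncard_le_ncard (t := π '' {x | IsRay σ h x}) (fun v hv => ?_)
      ((finite_isRay σ h).image _)).trans (Set.ncard_image_le (finite_isRay σ h))
    obtain ⟨x, hx, rfl⟩ := hsurj v hv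
    exact ⟨x, hx, rfl⟩
  have hle := finrank_le_of_conePos hpos
  rcases (show Module.finrank ℝ E = 6 ∨ Module.finrank ℝ E = 5 ∨ Module.finrank ℝ E = 4 ∨
    Module.finrank ℝ E ≤ 3 by omega) with hE | hE | hE | hE
  · have := ncard_isRay_le_of_finrank_eq hpos hE
    omega
  · obtain ⟨a, -, ha⟩ := exists_relations hpos (r := 1) (by omega)
    exact oneRelation_absurd hpos (a := a 0) (fun s => by rw [ha, Fin.forall_fin_one]) hcard hgen
      hcon hsurj
  · rcases ncard_isRay_le_six_or_exists_list hpos hE with h6 |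
      ⟨τ, S, X, hok, hnd, hX, hXs, hXi, htight⟩
    · omega
    · exact rayList_absurd (σ := fun i => σ (τ i)) (h := h) (π := π)
        (fun x hx => hpos x fun i => by simpa using hx (τ.symm i)) hE hgen hP hcard hok hnd
        (fun t ht => (IsRay.reindex τ).2 (hX t ht)) (fun x hx => hXs x ((IsRay.reindex τ).1 hx))
        hXi htight (fun x hx => hcon x ((IsRay.reindex τ).1 hx))
        (fun v hv => by
          obtain ⟨x, hx, hv⟩ := hsurj v hv
          exact ⟨x, (IsRay.reindex τ).2 hx, hv⟩)
  · have := ncard_isRay_le_of_finrank_le_three (σ := σ) (h := h) hE (by norm_num)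
    omega

end Bounds

/-! ### Assembling the base case and the theorem. -/

/-- Every vertex of a linear image is the image of a vertex. -/
theorem exists_extremePoint_of_image {N k : ℕ} {Q : Set (Fin N → ℝ)} {P : Set (Fin 2 → ℝ)}
    {π : (Fin N → ℝ) →ₗ[ℝ] (Fin 2 → ℝ)} (hb : Bornology.IsBounded Q) (hnt : Q.Nontrivial)
    (h : HRep Q k) (hπ : π '' Q = P) {v : Fin 2 → ℝ} (hv : v ∈ vertices P) :
    ∃ x ∈ Q.extremePoints ℝ, π x = v := by
  by_contra hcon
  push Not at hcon
  have hP : Convex ℝ P := hπ ▸ h.convex.linear_image π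
  have hd := convex_sdiff_extremePoint hP hv
  obtain ⟨x, hx, hxv⟩ : ∃ x ∈ Q, π x = v := by
    have : v ∈ π '' Q := hπ ▸ hv.1
    exact this
  rw [(isPolytope_of_hRep h hb hnt).2] at hx
  have h1 : π x ∈ π '' convexHull ℝ (Q.extremePoints ℝ) := ⟨x, hx, rfl⟩
  rw [LinearMap.image_convexHull] at h1
  have h2 := convexHull_min (t := P \ {v}) (by
    rintro _ ⟨y, hy, rfl⟩
    exact ⟨hπ ▸ ⟨y, hy.1, rfl⟩, hcon y hy⟩) hd h1
  exact h2.2 hxv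

theorem not_hRep_five {P : Set (Fin 2 → ℝ)} (hP : IsConvexHeptagon P) (N : ℕ)
    (Q : Set (Fin N → ℝ)) (π : (Fin N → ℝ) →ₗ[ℝ] (Fin 2 → ℝ)) (hb : Bornology.IsBounded Q)
    (hπ : π '' Q = P) : ¬ HRep Q 5 := by
  intro h
  have hnt := nontrivial_of_image hπ hP.nontrivial
  obtain ⟨S, s, hQ⟩ := h.fintype_form
  have hpos := conePos_of_bounded hQ hb hnt
  have hi := image_isRay hQ hpos
  have h6 := ncard_isRay_le_six hpos
  have h1 := (Set.InjOn.ncard_image (injOn_basePoint (S := S)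
    (σ := fun i => slack S (s i)))).symm
  rw [hi] at h1
  have hfin : (Q.extremePoints ℝ).Finite := (isPolytope_of_hRep h hb hnt).1
  have h7 : (vertices P).ncard ≤ (Q.extremePoints ℝ).ncard := by
    refine (Set.ncard_le_ncard (t := π '' Q.extremePoints ℝ) (fun v hv => ?_)
      (hfin.image _)).trans (Set.ncard_image_le hfin)
    obtain ⟨x, hx, rfl⟩ := exists_extremePoint_of_image hb hnt h hπ hv
    exact ⟨x, hx, rfl⟩
  rw [hP.2] at h7
  omega

/-- At most nine vertices, at least one of them hidden. -/
theorem ncard_le_hidden_of_hRep_six {P : Set (Fin 2 → ℝ)} (hP : IsConvexHeptagon P)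
    (hgen : InGeneralPosition P) (N : ℕ) (Q : Set (Fin N → ℝ))
    (π : (Fin N → ℝ) →ₗ[ℝ] (Fin 2 → ℝ)) (hb : Bornology.IsBounded Q) (hπ : π '' Q = P)
    (h : HRep Q 6) :
    (Q.extremePoints ℝ).ncard ≤ 9 * {v ∈ Q.extremePoints ℝ | π v ∉ vertices P}.ncard := by
  have hnt := nontrivial_of_image hπ hP.nontrivial
  have hconv : Convex ℝ P := hπ ▸ h.convex.linear_image π
  obtain ⟨S, s, hQ⟩ := h.fintype_form
  have hpos := conePos_of_bounded hQ hb hnt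
  have hi := image_isRay hQ hpos
  have h9 := ncard_isRay_le_nine hpos
  have h1 := (Set.InjOn.ncard_image (injOn_basePoint (S := S)
    (σ := fun i => slack S (s i)))).symm
  rw [hi] at h1
  have hfin : (Q.extremePoints ℝ).Finite := (isPolytope_of_hRep h hb hnt).1
  obtain ⟨p, hp, hp'⟩ := exists_hidden_ray hpos hgen hconv hP.2 (π := π.comp (basePoint S))
    (fun v hv => by
      obtain ⟨x, hx, rfl⟩ := exists_extremePoint_of_image hb hnt h hπ hv
      rw [← hi] at hx
      obtain ⟨p, hp, rfl⟩ := hx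
      exact ⟨p, hp, rfl⟩)
  have hne : {v ∈ Q.extremePoints ℝ | π v ∉ vertices P}.Nonempty :=
    ⟨basePoint S p, hi ▸ ⟨p, hp, rfl⟩, hp'⟩
  have := (Set.ncard_pos (hfin.subset fun x hx => hx.1)).2 hne
  omega

theorem mainTheorem2 (P : Set (Fin 2 → ℝ)) (hP : IsConvexHeptagon P)
    (hgen : InGeneralPosition P) (d q : ℕ) (Q : Set (Fin (2 + d + q) → ℝ))
    (hQ : IsMinimumSizeExtension (prodCube P d) Q) :
    (1 / 9 : ℝ) * ((vertices Q).ncard : ℝ) ≤ ((hiddenVertices (prodCube P d) Q).ncard : ℝ) := by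
  obtain ⟨Q', hQ', hsize⟩ := exists_extension hP d
  -- The comparison extension uses a single extra coordinate, the height of the lift.
  have hle := (hQ.2 1 Q' hQ').trans hsize
  obtain ⟨⟨hpoly, himg⟩, -⟩ := hQ
  have hnt := nontrivial_of_image himg (prodCube_nontrivial hP.nontrivial d)
  have hrep := hRep_of_isPolytope hpoly hnt hle
  have hb : Bornology.IsBounded Q := by
    obtain ⟨s, hs, rfl⟩ := hpoly
    exact (hs.isCompact_convexHull (𝕜 := ℝ)).isBounded
  have key := card_le_hidden hP.nontrivial (not_hRep_five hP) (ncard_le_hidden_of_hRep_six hP hgen)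
    d _ Q (proj (2 + d) q) hb himg hrep
  have key' : ((vertices Q).ncard : ℝ) ≤ 9 * ((hiddenVertices (prodCube P d) Q).ncard : ℝ) := by
    exact_mod_cast key
  linarith
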